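/- **Theorem.** Let $I$ be a finite or countable index set, and let $x_i\in\mathbb{R}^3$ and $r_i>0$ ($i\in I$) be the centres and radii of the particles $B_i=B_{r_i}(x_i)$. Put $K=\bigcup_{i\in I}\overline{B_i}$, and assume that $K$ is closed. Let $d_i=\inf_{j\ne i}|x_i-x_j|$ (with $d_i=\infty$ if there is no other particle), and let $\mu_0=\sup_{i\in I} r_i d_i^{-3}$ be the capacity bound (with $r_i d_i^{-3}=0$ if $d_i=\infty$, and $\mu_0=0$ if $I$ is empty). Let $\xi>0$, $\alpha>0$, $\kappa>1$, and assume $$\frac{d_i}{2}>\kappa r_i\quad\text{and}\quad r_i\le\alpha\xi\qquad\text{for all } i\in I .$$ For $u,v\in H^1(\mathbb{R}^3)$ (real valued) put $(u,v)_\xi=(\nabla u,\nabla v)_{L^2}+\xi^{-2}(u,v)_{L^2}$. For a closed set $A\subset\mathbb{R}^3$ let $H^1_0(\mathbb{R}^3\setminus A)$ be the closure in $H^1(\mathbb{R}^3)$ of the set of functions in $C_c^\infty(\mathbb{R}^3)$ that vanish in $A$. For $f\in H^{-1}(\mathbb{R}^3)=H^1(\mathbb{R}^3)^*$, a weak solution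 of $$-\Delta u+\xi^{-2}u=f\ \text{ in }\mathbb{R}^3\setminus K,\qquad u=0\ \text{ in }K \tag{1}$$ is a function $u\in H^1_0(\mathbb{R}^3\setminus K)$ with $(u,v)_\xi=\langle f,v\rangle$ for all $v\in H^1_0(\mathbb{R}^3\setminus K)$. For $h\in H^1(\mathbb{R}^3)$ let $Q_ih\in H^1(\mathbb{R}^3)$ be the weak solution of $-\Delta w+\xi^{-2}w=0$ in $\mathbb{R}^3\setminus\overline{B_i}$, $w=h$ in $\overline{B_i}$, that is, $w-h\in H^1_0(\mathbb{R}^3\setminus\overline{B_i})$ and $(w,v)_\xi=0$ for all $v\in H^1_0(\mathbb{R}^3\setminus\overline{B_i})$. The Method of Reflections defines $\Phi_0\in H^1(\mathbb{R}^3)$ as the weak solution of $-\Delta\Phi_0+\xi^{-2}\Phi_0=f$ in $\mathbb{R}^3$, and $$\Phi_{1,i}=-Q_i\Phi_0,\qquad \Phi_{k,i}=-Q_i\sum_{j\ne i}\Phi_{k-1,j}\ \ (k\ge2),\qquad \Phi_k=\sum_{i\in I}\Phi_{k,i}\ \ (k\ge1).$$ There exist constants $C_0>0$ depending only on $\alpha$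 and $\kappa$, $\varepsilon\in(0,1)$ depending only on $\kappa$, and $C$ depending only on $\xi$, such that the following holds for all particle configurations as above that satisfy $\mu_0<C_0\xi^{-2}$ and all $f\in H^{-1}(\mathbb{R}^3)$. Problem (1) has a unique weak solution $u$; the functions $\Phi_{k,i}$, $\Phi_k$ are well defined, the series over the particles converging unconditionally in $H^1(\mathbb{R}^3)$; the series $\sum_{k=0}^\infty\Phi_k$ converges to $u$ in $H^1(\mathbb{R}^3\setminus K)$; and $$\Big\|\sum_{k=0}^N\Phi_k-u\Big\|_{H^1(\mathbb{R}^3\setminus K)}\le C\,\varepsilon^N\,\|f\|_{H^{-1}(\mathbb{R}^3)}\qquad\text{for all } N\ge0 .$$ Here $\|\cdot\|_{H^{-1}}$ is the dual norm of the standard norm of $H^1(\mathbb{R}^3)$. In particular, for fixed $\xi$, $\alpha$, $\kappa$ the convergence is uniform in all such configurations. -/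

import Mathlib

open MeasureTheory Filter Topology
open scoped ENNReal ContDiff

noncomputable section

/-- Three-dimensional Euclidean space. -/
abbrev E3 : Type := EuclideanSpace ℝ (Fin 3)

/-- `g` is the weak (distributional) gradient of `u` on the whole space. -/
def IsWeakGradient (u : E3 → ℝ) (g : E3 → E3) : Prop :=
  ∀ φ : E3 → ℝ, ContDiff ℝ ∞ φ → HasCompactSupport φ → ∀ k : Fin 3,
    ∫ y, u y * fderiv ℝ φ y (EuclideanSpace.single k 1) = - ∫ y, g y k * φ y

theorem memLp_fderiv_of_test {φ : E3 → ℝ} (hφ : ContDiff ℝ ∞ φ) (hc : HasCompactSupport φ)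
    (v : E3) : MemLp (fun y => fderiv ℝ φ y v) 2 (volume : Measure E3) := by
  have h1 : Continuous (fderiv ℝ φ) := hφ.continuous_fderiv (by simp)
  have h2 : HasCompactSupport (fun y => fderiv ℝ φ y v) :=
    (hc.fderiv (𝕜 := ℝ)).comp_left (g := fun L : E3 →L[ℝ] ℝ => L v) (by simp)
  exact (h1.clm_apply continuous_const).memLp_of_hasCompactSupport h2

theorem memLp_coord {g : E3 → E3} (hg : MemLp g 2 (volume : Measure E3)) (k : Fin 3) :
    MemLp (fun y => g y k) 2 (volume : Measure E3) :=
  (EuclideanSpace.proj k : E3 →L[ℝ] ℝ).comp_memLp' hg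

theorem IsWeakGradient.congr {u u' : E3 → ℝ} {g g' : E3 → E3} (h : IsWeakGradient u g)
    (hu : u' =ᵐ[volume] u) (hg : g' =ᵐ[volume] g) : IsWeakGradient u' g' := by
  intro φ hφ hc k
  have e1 : ∫ y, u' y * fderiv ℝ φ y (EuclideanSpace.single k 1)
      = ∫ y, u y * fderiv ℝ φ y (EuclideanSpace.single k 1) :=
    integral_congr_ae (by filter_upwards [hu] with y hy; rw [hy])
  have e2 : ∫ y, g' y k * φ y = ∫ y, g y k * φ y :=
    integral_congr_ae (by filter_upwards [hg] with y hy; rw [hy])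
  rw [e1, e2]
  exact h φ hφ hc k

theorem IsWeakGradient.add {u u' : E3 → ℝ} {g g' : E3 → E3} (h : IsWeakGradient u g)
    (h' : IsWeakGradient u' g') (hu : MemLp u 2 volume) (hu' : MemLp u' 2 volume)
    (hg : MemLp g 2 volume) (hg' : MemLp g' 2 volume) :
    IsWeakGradient (u + u') (g + g') := by
  intro φ hφ hc k
  have hφ2 : MemLp φ 2 (volume : Measure E3) :=
    hφ.continuous.memLp_of_hasCompactSupport hc
  have hd := memLp_fderiv_of_test hφ hc (EuclideanSpace.single k 1)
  have i1 : Integrable (fun y => u y * fderiv ℝ φ y (EuclideanSpace.single k 1)) :=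
    hu.integrable_mul hd
  have i2 : Integrable (fun y => u' y * fderiv ℝ φ y (EuclideanSpace.single k 1)) :=
    hu'.integrable_mul hd
  have i3 : Integrable (fun y => g y k * φ y) := (memLp_coord hg k).integrable_mul hφ2
  have i4 : Integrable (fun y => g' y k * φ y) := (memLp_coord hg' k).integrable_mul hφ2
  simp only [Pi.add_apply, PiLp.add_apply, add_mul]
  rw [integral_add i1 i2, integral_add i3 i4, h φ hφ hc k, h' φ hφ hc k]
  ring

theorem IsWeakGradient.smul {u : E3 → ℝ} {g : E3 → E3} (h : IsWeakGradient u g) (c : ℝ) :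
    IsWeakGradient (c • u) (c • g) := by
  intro φ hφ hc k
  simp only [Pi.smul_apply, PiLp.smul_apply, smul_eq_mul, mul_assoc]
  rw [integral_const_mul, integral_const_mul, h φ hφ hc k]
  ring

/-- The pairs `(u, ∇u)` with `u` and its weak gradient square integrable, inside `L² × L²`. -/
def sobolevGraph : Submodule ℝ
    (WithLp 2 (Lp ℝ 2 (volume : Measure E3) × Lp E3 2 (volume : Measure E3))) where
  carrier := {w | IsWeakGradient w.fst w.snd}
  add_mem' := by
    intro a b ha hb
    exact (IsWeakGradient.add ha hb (Lp.memLp _) (Lp.memLp _) (Lp.memLp _) (Lp.memLp _)).congr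
      (Lp.coeFn_add _ _) (Lp.coeFn_add _ _)
  zero_mem' := by
    have h : IsWeakGradient 0 0 := by intro φ _ _ k; simp
    exact h.congr (Lp.coeFn_zero _ _ _) (Lp.coeFn_zero _ _ _)
  smul_mem' := by
    intro c a ha
    exact (IsWeakGradient.smul ha c).congr (Lp.coeFn_smul _ _) (Lp.coeFn_smul _ _)

/-- The Sobolev space `H¹(ℝ³)`, normed by `‖u‖² = ‖u‖²_{L²} + ‖∇u‖²_{L²}`. -/
abbrev H1 : Type := sobolevGraph

namespace H1

/-- The underlying `L²` function. -/
def val (u : H1) : Lp ℝ 2 (volume : Measure E3) := u.1.fst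

/-- The weak gradient. -/
def grad (u : H1) : Lp E3 2 (volume : Measure E3) := u.1.snd

/-- The norm of the restriction of `u` to `U` in `H¹(U)`. -/
def normOn (U : Set E3) (u : H1) : ℝ :=
  Real.sqrt (∫ y in U, ((u.val y) ^ 2 + ‖u.grad y‖ ^ 2))

/-- For a closed set `A`, the space `H¹₀(ℝ³ ∖ A)`: the closure in `H¹(ℝ³)` of the set of smooth
compactly supported functions on `ℝ³` that vanish in `A`. -/
def zeroOn (A : Set E3) : Set H1 :=
  closure {u : H1 | ∃ φ : E3 → ℝ, ContDiff ℝ ∞ φ ∧ HasCompactSupport φ ∧ (∀ y ∈ A, φ y = 0) ∧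
    u.val =ᵐ[volume] φ}

/-- The scalar product `(∇u, ∇v)_{L²} + ξ⁻² (u, v)_{L²}`, the weak form of `-Δ + ξ⁻²`. -/
def form (ξ : ℝ) (u v : H1) : ℝ :=
  inner ℝ u.grad v.grad + (ξ ^ 2)⁻¹ * inner ℝ u.val v.val

end H1

/-- The space `H⁻¹(ℝ³)`: the dual of `H¹(ℝ³)`, with the dual norm. -/
abbrev Hneg1 : Type := StrongDual ℝ H1

/-- `u` is a weak solution of `-Δu + ξ⁻² u = f` in `ℝ³ ∖ A`, `u = 0` in `A` (`A` closed). -/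
def IsDirichletSolution (ξ : ℝ) (A : Set E3) (f : Hneg1) (u : H1) : Prop :=
  u ∈ H1.zeroOn A ∧ ∀ v ∈ H1.zeroOn A, H1.form ξ u v = f v

/-- `w` is a weak solution of `-Δw + ξ⁻² w = 0` in `ℝ³ ∖ A`, `w = h` in `A` (`A` closed). -/
def IsExteriorSolution (ξ : ℝ) (A : Set E3) (h w : H1) : Prop :=
  w - h ∈ H1.zeroOn A ∧ ∀ v ∈ H1.zeroOn A, H1.form ξ w v = 0

/-- The Method of Reflections for the closed balls with centres `x i` and radii `r i`, with source
`f` and homogeneous Dirichlet data. Here `Φ k` is the `k`-th order term, and `φ k i` is the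
contribution of the particle `i` to `Φ (k + 1)`. -/
structure IsMethodOfReflections {I : Type} (ξ : ℝ) (x : I → E3) (r : I → ℝ) (f : Hneg1)
    (Φ : ℕ → H1) (φ : ℕ → I → H1) : Prop where
  /-- `Φ₀` is the weak solution of `-ΔΦ₀ + ξ⁻² Φ₀ = f` in the whole space. -/
  zero : ∀ v : H1, H1.form ξ (Φ 0) v = f v
  /-- The first corrections cancel `Φ₀` in each particle. -/
  one : ∀ i, IsExteriorSolution ξ (Metric.closedBall (x i) (r i)) (-Φ 0) (φ 0 i)
  /-- The next corrections cancel, in each particle, the sum of the previous corrections of all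
  the other particles. -/
  succ : ∀ k i, IsExteriorSolution ξ (Metric.closedBall (x i) (r i))
    (-∑' j : {j : I // j ≠ i}, φ k j) (φ (k + 1) i)
  /-- `Φ (k + 1)` is the sum over all particles; the series converges unconditionally in
  `H¹(ℝ³)`. -/
  sum : ∀ k, HasSum (φ k) (Φ (k + 1))

/-- The set occupied by the particles. -/
def particles {I : Type} (x : I → E3) (r : I → ℝ) : Set E3 :=
  ⋃ i, Metric.closedBall (x i) (r i)

/-- The distance `d i` of the particle `i` to the closest other particle
(`∞` if there is no other one). -/
def nearestDist {I : Type} (x : I → E3) (i : I) : ℝ≥0∞ :=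
  ⨅ (j : I) (_ : j ≠ i), edist (x i) (x j)

/-- The capacity bound `μ₀ = sup_i r_i d_i⁻³`. -/
def capacityBound {I : Type} (x : I → E3) (r : I → ℝ) : ℝ≥0∞ :=
  ⨆ i, ENNReal.ofReal (r i) / nearestDist x i ^ 3

end

noncomputable section

/-! ### The method of reflections in a Hilbert space -/

section Hilbert

variable {V : Type*} [NormedAddCommGroup V] [InnerProductSpace ℝ V] {I : Type*}

/-! In `H¹` with the scalar product `H1.form ξ`, each `Q_i` is the orthogonal projection onto `Y_i`,
the orthogonal complement of the functions vanishing in the ball `i`. A correction `φ k i` lies in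
`Y_i`, so `Q_i` reproduces it; this supplies the omitted term `j = i`, and the recursion collapses
to `φ k i = -Q_i S_k` with `S_k` the `k`-th partial sum, i.e. `S_{k+1} = (1 - ∑ Q_i) S_k`. The
solution `u` is the projection of `Φ 0` onto the space `W` of functions vanishing in all particles.
Every `Q_i` kills `W`, so the error `z = S_k - u` stays in `Wᗮ` and is multiplied by `1 - ∑ Q_i`.

Convergence thus needs only two bounds: `∑ ‖Q_i v‖² ≤ A ‖v‖²` with `A < 2`, and `c ‖z‖² ≤ ∑ ‖Q_i
z‖²` on `Wᗮ`. Since `⟪z, Q_i z⟫ = ‖Q_i z‖²` and the first bound also gives `‖∑ Q_i z‖² ≤ A ∑ ‖Q_i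
z‖²`, expanding the square yields the contraction factor `1 - (2 - A) c`.

Both bounds rest on a minimum principle: `Q_i v` has the least energy among all functions equal to
`v` in the ball.

Upper bound, `A = 3/2` (`sum_norm_starProjection_sq_le`): it suffices to extend `v` from the small
ball with at most 3/2 of its energy in a ball of radius `R_i`, these larger balls being disjoint.
With `m` the mean of `v` there, `exists_extension_energy_le` cuts off `v - m` logarithmically, at
small cost by the Hardy and Poincaré inequalities, and cuts off `m` at the scale `r_i`. The latter
costs about `r_i m²`, the capacity of the ball, which the zeroth order term of the energy absorbs
when `r_i ξ² / R_i³` is small. The bound on `μ₀` ensures this.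

Lower bound (`norm_starProjection_sq_le_sum`): near-optimal extensions from the single balls are cut
off inside the disjoint balls of radius `κ r_i` and added. By Hardy's inequality each cutoff
multiplies the energy by at most a constant depending on `κ` alone, hence so does `ε`. Closedness of
the union makes the particles locally finite, so finite sums suffice for test functions.

Both bounds are proved for test functions and extended by density. -/

theorem hasSum_subtype_ne {M : Type*} [AddCommGroup M] [TopologicalSpace M]
    [IsTopologicalAddGroup M] {f : I → M} {a : M} (h : HasSum f a) (i : I) :
    HasSum (fun j : {j : I // j ≠ i} => f j) (a - f i) := by
  classical
  have h5 := h.sub (hasSum_ite_eq i (f i))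
  have e : (fun n => f n - if n = i then f i else 0) = Set.indicator {j | j ≠ i} f := by
    ext n
    by_cases hn : n = i <;> simp [hn]
  rw [e] at h5
  exact hasSum_subtype_iff_indicator.2 h5

/-- Finite sums of vectors from subspaces whose orthogonal projections satisfy a Bessel
inequality. -/
theorem norm_sum_sq_le_of_bessel {Y : I → Submodule ℝ V} [∀ i, (Y i).HasOrthogonalProjection]
    {A : ℝ} (hA : 0 < A)
    (hU : ∀ (F : Finset I) (u : V), ∑ i ∈ F, ‖(Y i).starProjection u‖ ^ 2 ≤ A * ‖u‖ ^ 2)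
    {v : I → V} (hv : ∀ i, v i ∈ Y i) (F : Finset I) :
    ‖∑ i ∈ F, v i‖ ^ 2 ≤ A * ∑ i ∈ F, ‖v i‖ ^ 2 := by
  set s := ∑ i ∈ F, v i with hs
  have h1 : ‖s‖ ^ 2 = ∑ i ∈ F, inner ℝ (v i) ((Y i).starProjection s) := by
    rw [← real_inner_self_eq_norm_sq]
    conv_lhs => rw [hs, sum_inner]
    refine Finset.sum_congr rfl fun i _ => ?_
    rw [← Submodule.inner_starProjection_left_eq_right,
      Submodule.starProjection_eq_self_iff.2 (hv i)]
  -- The weights in Young's inequality are such that the Bessel bound turns the second term into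
  -- `‖s‖² / 2`, which is absorbed on the left.
  have h2 : ∀ i ∈ F, inner ℝ (v i) ((Y i).starProjection s)
      ≤ A / 2 * ‖v i‖ ^ 2 + 1 / (2 * A) * ‖(Y i).starProjection s‖ ^ 2 := by
    intro i _
    refine (real_inner_le_norm _ _).trans ?_
    have : A / 2 * ‖v i‖ ^ 2 + 1 / (2 * A) * ‖(Y i).starProjection s‖ ^ 2
        - ‖v i‖ * ‖(Y i).starProjection s‖
        = 1 / (2 * A) * (A * ‖v i‖ - ‖(Y i).starProjection s‖) ^ 2 := by
      field_simp
      ring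
    have h3 : 0 ≤ 1 / (2 * A) * (A * ‖v i‖ - ‖(Y i).starProjection s‖) ^ 2 := by positivity
    linarith
  have h3 := Finset.sum_le_sum h2
  rw [← h1, Finset.sum_add_distrib, ← Finset.mul_sum, ← Finset.mul_sum] at h3
  have h4 : 1 / (2 * A) * ∑ i ∈ F, ‖(Y i).starProjection s‖ ^ 2 ≤ 1 / (2 * A) * (A * ‖s‖ ^ 2) :=
    mul_le_mul_of_nonneg_left (hU F s) (by positivity)
  have h5 : 1 / (2 * A) * (A * ‖s‖ ^ 2) = ‖s‖ ^ 2 / 2 := by field_simp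
  linarith

/-- Applied to finite blocks outside a large set, the dual Bessel inequality transfers the Cauchy
criterion from `∑ ‖v i‖²` to `∑ v i`. Absolute convergence is not required. -/
theorem summable_of_bessel [CompleteSpace V]
    {Y : I → Submodule ℝ V} [∀ i, (Y i).HasOrthogonalProjection]
    {A : ℝ} (hA : 0 < A)
    (hU : ∀ (F : Finset I) (u : V), ∑ i ∈ F, ‖(Y i).starProjection u‖ ^ 2 ≤ A * ‖u‖ ^ 2)
    {v : I → V} (hv : ∀ i, v i ∈ Y i) (hs : Summable fun i => ‖v i‖ ^ 2) : Summable v := by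
  rw [summable_iff_vanishing_norm]
  intro ε hε
  obtain ⟨s, h⟩ := summable_iff_vanishing_norm.1 hs (ε ^ 2 / A) (by positivity)
  refine ⟨s, fun t ht => ?_⟩
  have h1 := h t ht
  rw [Real.norm_of_nonneg (Finset.sum_nonneg fun i _ => by positivity), lt_div_iff₀ hA] at h1
  have h2 := norm_sum_sq_le_of_bessel hA hU hv t
  exact lt_of_pow_lt_pow_left₀ 2 hε.le (by linarith)

theorem norm_sq_le_of_hasSum {Y : I → Submodule ℝ V} [∀ i, (Y i).HasOrthogonalProjection]
    {A : ℝ} (hA : 0 < A)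
    (hU : ∀ (F : Finset I) (u : V), ∑ i ∈ F, ‖(Y i).starProjection u‖ ^ 2 ≤ A * ‖u‖ ^ 2)
    {v : I → V} (hv : ∀ i, v i ∈ Y i) {l : V} (hl : HasSum v l)
    {T : ℝ} (hT : HasSum (fun i => ‖v i‖ ^ 2) T) : ‖l‖ ^ 2 ≤ A * T :=
  le_of_tendsto_of_tendsto ((continuous_norm.tendsto l).comp hl |>.pow 2)
    (Tendsto.const_mul A hT) (Eventually.of_forall fun F => norm_sum_sq_le_of_bessel hA hU hv F)

theorem summable_norm_sq_starProjection
    {Y : I → Submodule ℝ V} [∀ i, (Y i).HasOrthogonalProjection] {A : ℝ}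
    (hU : ∀ (F : Finset I) (u : V), ∑ i ∈ F, ‖(Y i).starProjection u‖ ^ 2 ≤ A * ‖u‖ ^ 2)
    (u : V) : Summable fun i => ‖(Y i).starProjection u‖ ^ 2 :=
  summable_of_sum_le (fun _ => by positivity) fun F => hU F u

theorem summable_starProjection [CompleteSpace V]
    {Y : I → Submodule ℝ V} [∀ i, (Y i).HasOrthogonalProjection] {A : ℝ} (hA : 0 < A)
    (hU : ∀ (F : Finset I) (u : V), ∑ i ∈ F, ‖(Y i).starProjection u‖ ^ 2 ≤ A * ‖u‖ ^ 2)
    (u : V) : Summable fun i => (Y i).starProjection u :=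
  summable_of_bessel hA hU (fun _ => Submodule.starProjection_apply_mem _ _)
    (summable_norm_sq_starProjection hU u)

/-- The Bessel inequality and the reverse inequality on `Z` make `1 - ∑ Q_i` a contraction
on `Z`. -/
theorem norm_sub_sq_le_of_hasSum_starProjection
    {Y : I → Submodule ℝ V} [∀ i, (Y i).HasOrthogonalProjection]
    {A c : ℝ} (hA : 0 < A) (hA2 : A ≤ 2)
    (hU : ∀ (F : Finset I) (u : V), ∑ i ∈ F, ‖(Y i).starProjection u‖ ^ 2 ≤ A * ‖u‖ ^ 2)
    {z : V} (hz : c * ‖z‖ ^ 2 ≤ ∑' i, ‖(Y i).starProjection z‖ ^ 2)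
    {l : V} (hl : HasSum (fun i => (Y i).starProjection z) l) :
    ‖z - l‖ ^ 2 ≤ (1 - (2 - A) * c) * ‖z‖ ^ 2 := by
  have hT := (summable_norm_sq_starProjection hU z).hasSum
  have h1 := norm_sq_le_of_hasSum hA hU (fun i => Submodule.starProjection_apply_mem _ _) hl hT
  have h2 : HasSum (fun i => ‖(Y i).starProjection z‖ ^ 2) (inner ℝ z l) := by
    have := hl.mapL (innerSL ℝ z)
    have e : (fun i => ‖(Y i).starProjection z‖ ^ 2)
        = fun i => innerSL ℝ z ((Y i).starProjection z) := by
      ext i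
      symm
      rw [innerSL_apply_apply, ← real_inner_self_eq_norm_sq,
        Submodule.inner_starProjection_left_eq_right, Submodule.starProjection_eq_self_iff.2
          (Submodule.starProjection_apply_mem (Y i) z)]
    rw [e]
    exact this
  have h3 := h2.unique hT
  -- With `T = ∑ ‖Q_i z‖²` the expansion is `‖z‖² - 2 T + ‖l‖² ≤ ‖z‖² - (2 - A) T`, and `T ≥ c
  -- ‖z‖²`.
  rw [norm_sub_sq_real, h3]
  nlinarith

/-- The recursion of the method of reflections, solved: the `k`-th corrections cancel the partial
sums. -/
theorem reflection_eq_neg_starProjection_sum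
    {Y : I → Submodule ℝ V} [∀ i, (Y i).HasOrthogonalProjection]
    {Φ : ℕ → V} {φ : ℕ → I → V} (h1 : ∀ i, φ 0 i = (Y i).starProjection (-Φ 0))
    (h2 : ∀ k i, φ (k + 1) i = (Y i).starProjection (-∑' j : {j : I // j ≠ i}, φ k j))
    (h3 : ∀ k, HasSum (φ k) (Φ (k + 1))) (k : ℕ) (i : I) :
    φ k i = -(Y i).starProjection (∑ l ∈ Finset.range (k + 1), Φ l) := by
  induction k with
  | zero => simp [h1]
  | succ k ih =>
    have hmem : φ k i ∈ Y i := by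
      rw [ih]
      exact (Y i).neg_mem (Submodule.starProjection_apply_mem _ _)
    have e : ∑' j : {j : I // j ≠ i}, φ k j = Φ (k + 1) - φ k i := by
      exact (hasSum_subtype_ne (h3 k) i).tsum_eq
    rw [h2, e, Finset.sum_range_succ _ (k + 1), map_add, neg_add, ← ih, map_neg, map_sub,
      Submodule.starProjection_eq_self_iff.2 hmem]
    module

/-- The construction starts from the solved form: partial sums are defined by iterating `1 - ∑ Q_i`,
corrections are read off as `-Q_i S_k`, and the original recursion is then verified. -/
theorem exists_reflections [CompleteSpace V]
    {Y : I → Submodule ℝ V} [∀ i, (Y i).HasOrthogonalProjection] {A : ℝ} (hA : 0 < A)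
    (hU : ∀ (F : Finset I) (u : V), ∑ i ∈ F, ‖(Y i).starProjection u‖ ^ 2 ≤ A * ‖u‖ ^ 2)
    (Φ₀ : V) :
    ∃ (Φ : ℕ → V) (φ : ℕ → I → V), Φ 0 = Φ₀ ∧ (∀ i, φ 0 i = (Y i).starProjection (-Φ 0)) ∧
      (∀ k i, φ (k + 1) i = (Y i).starProjection (-∑' j : {j : I // j ≠ i}, φ k j)) ∧
      (∀ k, HasSum (φ k) (Φ (k + 1))) := by
  let S : ℕ → V := fun n => Nat.rec Φ₀ (fun _ s => s - ∑' i, (Y i).starProjection s) n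
  have hS : ∀ n, S (n + 1) = S n - ∑' i, (Y i).starProjection (S n) := fun n => rfl
  have hsum : ∀ k, HasSum (fun i => -(Y i).starProjection (S k)) (S (k + 1) - S k) := by
    intro k
    rw [hS, sub_sub_cancel_left]
    exact (summable_starProjection hA hU (S k)).hasSum.neg
  refine ⟨fun n => Nat.casesOn n Φ₀ fun k => S (k + 1) - S k,
    fun k i => -(Y i).starProjection (S k), rfl, fun i => by simp [S], fun k i => ?_, hsum⟩
  have h4 := hasSum_subtype_ne (hsum k) i
  rw [h4.tsum_eq, map_neg, map_sub, map_sub, map_neg, Submodule.starProjection_eq_self_iff.2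
    (Submodule.starProjection_apply_mem (Y i) (S k))]
  module

/-- A reverse Bessel inequality on a dense set extends to the whole subspace. -/
theorem mul_norm_sq_le_tsum_of_dense {Y : I → Submodule ℝ V} [∀ i, (Y i).HasOrthogonalProjection]
    (Z : Submodule ℝ V) [Z.HasOrthogonalProjection] {A c : ℝ}
    (hU : ∀ (F : Finset I) (u : V), ∑ i ∈ F, ‖(Y i).starProjection u‖ ^ 2 ≤ A * ‖u‖ ^ 2)
    {D : Set V} (hD : Dense D)
    (hL : ∀ u ∈ D, ∃ F : Finset I, c * ‖Z.starProjection u‖ ^ 2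
      ≤ ∑ i ∈ F, ‖(Y i).starProjection u‖ ^ 2) {z : V} (hz : z ∈ Z) :
    c / 2 * ‖z‖ ^ 2 ≤ ∑' i, ‖(Y i).starProjection z‖ ^ 2 := by
  -- The finite set depends on `u` and cannot survive the limit `u → z`. It is replaced by the full
  -- series at `z`, with an error controlled by the Bessel bound for `u - z`; splitting the squares
  -- costs the factor 2 that turns `c` into `c / 2`.
  have key : ∀ u ∈ D, c * ‖Z.starProjection u‖ ^ 2
      ≤ 2 * (∑' i, ‖(Y i).starProjection z‖ ^ 2) + 2 * (A * ‖u - z‖ ^ 2) := by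
    intro u hu
    obtain ⟨F, hF⟩ := hL u hu
    refine hF.trans ?_
    have h1 : ∀ i ∈ F, ‖(Y i).starProjection u‖ ^ 2
        ≤ 2 * ‖(Y i).starProjection z‖ ^ 2 + 2 * ‖(Y i).starProjection (u - z)‖ ^ 2 := by
      intro i _
      have e : (Y i).starProjection u = (Y i).starProjection z + (Y i).starProjection (u - z) := by
        rw [← map_add, add_sub_cancel]
      have h2 := norm_add_le ((Y i).starProjection z) ((Y i).starProjection (u - z))
      rw [← e] at h2
      nlinarith [norm_nonneg ((Y i).starProjection u),
        sq_nonneg (‖(Y i).starProjection z‖ - ‖(Y i).starProjection (u - z)‖)]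
    refine (Finset.sum_le_sum h1).trans ?_
    rw [Finset.sum_add_distrib, ← Finset.mul_sum, ← Finset.mul_sum]
    have h3 := (summable_norm_sq_starProjection hU z).sum_le_tsum F fun i _ => by positivity
    have h4 := hU F (u - z)
    linarith
  have hcl : IsClosed {u : V | c * ‖Z.starProjection u‖ ^ 2
      ≤ 2 * (∑' i, ‖(Y i).starProjection z‖ ^ 2) + 2 * (A * ‖u - z‖ ^ 2)} :=
    isClosed_le (by fun_prop) (by fun_prop)
  have h := hcl.closure_subset_iff.2 key (hD z)
  simp only [Set.mem_ofPred_eq, sub_self, norm_zero, Submodule.starProjection_eq_self_iff.2 hz] at h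
  linarith

/-- Geometric convergence of the method of reflections. -/
theorem norm_sum_reflections_sub_le {Y : I → Submodule ℝ V} [∀ i, (Y i).HasOrthogonalProjection]
    (W : Submodule ℝ V) (hW : ∀ i, W ≤ (Y i)ᗮ) {A c : ℝ} (hA : 0 < A) (hA2 : A ≤ 2)
    (hc : 0 ≤ 1 - (2 - A) * c)
    (hU : ∀ (F : Finset I) (u : V), ∑ i ∈ F, ‖(Y i).starProjection u‖ ^ 2 ≤ A * ‖u‖ ^ 2)
    (hL : ∀ z ∈ Wᗮ, c * ‖z‖ ^ 2 ≤ ∑' i, ‖(Y i).starProjection z‖ ^ 2)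
    {Φ : ℕ → V} {φ : ℕ → I → V} (h1 : ∀ i, φ 0 i = (Y i).starProjection (-Φ 0))
    (h2 : ∀ k i, φ (k + 1) i = (Y i).starProjection (-∑' j : {j : I // j ≠ i}, φ k j))
    (h3 : ∀ k, HasSum (φ k) (Φ (k + 1))) {u : V} (hu : u ∈ W) (hu' : Φ 0 - u ∈ Wᗮ) (N : ℕ) :
    ‖∑ k ∈ Finset.range (N + 1), Φ k - u‖ ≤ Real.sqrt (1 - (2 - A) * c) ^ N * ‖Φ 0 - u‖ := by
  -- The reverse inequality holds only on `Wᗮ`, so membership has to be carried through the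
  -- induction.
  suffices H : ∑ k ∈ Finset.range (N + 1), Φ k - u ∈ Wᗮ ∧
      ‖∑ k ∈ Finset.range (N + 1), Φ k - u‖
        ≤ Real.sqrt (1 - (2 - A) * c) ^ N * ‖Φ 0 - u‖ from H.2
  induction N with
  | zero => simpa using hu'
  | succ N ih =>
    obtain ⟨hz, hn⟩ := ih
    set z := ∑ k ∈ Finset.range (N + 1), Φ k - u with hzdef
    have hl : HasSum (fun i => (Y i).starProjection z) (-Φ (N + 1)) := by
      convert (h3 N).neg using 2 with i
      symm
      rw [reflection_eq_neg_starProjection_sum h1 h2 h3 N i, neg_neg, hzdef, map_sub]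
      rw [(Submodule.starProjection_apply_eq_zero_iff (K := Y i)).2 (hW i hu), sub_zero]
    have e : ∑ k ∈ Finset.range (N + 1 + 1), Φ k - u = z - -Φ (N + 1) := by
      rw [Finset.sum_range_succ, hzdef]
      module
    rw [e]
    constructor
    · refine Submodule.sub_mem _ hz ?_
      have : ∀ i, (Y i).starProjection z ∈ Wᗮ := fun i => by
        rw [Submodule.mem_orthogonal]
        intro w hw
        exact Submodule.inner_left_of_mem_orthogonal (Submodule.starProjection_apply_mem _ _)
          (hW i hw)
      exact (Submodule.isClosed_orthogonal W).mem_of_tendsto hl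
        (Eventually.of_forall fun F => Submodule.sum_mem _ fun i _ => this i)
    · have h4 := norm_sub_sq_le_of_hasSum_starProjection hA hA2 hU (hL z hz) hl
      have h5 : ‖z - -Φ (N + 1)‖ ≤ Real.sqrt (1 - (2 - A) * c) * ‖z‖ := by
        refine le_of_sq_le_sq ?_ (by positivity)
        rw [mul_pow, Real.sq_sqrt hc]
        exact h4
      refine h5.trans ?_
      rw [pow_succ', mul_assoc]
      exact mul_le_mul_of_nonneg_left hn (Real.sqrt_nonneg _)

end Hilbert

/-! ### The Sobolev space -/

/-- Smooth compactly supported functions. -/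
def testSpace : Submodule ℝ (E3 → ℝ) where
  carrier := {φ | ContDiff ℝ ∞ φ ∧ HasCompactSupport φ}
  add_mem' h h' := ⟨h.1.add h'.1, h.2.add h'.2⟩
  zero_mem' := ⟨contDiff_const, HasCompactSupport.zero⟩
  smul_mem' c _ h := ⟨h.1.const_smul c, h.2.smul_left (f := fun _ => c)⟩

/-- A smooth compactly supported function. -/
abbrev Test : Type := testSpace

namespace Test

theorem contDiff (φ : Test) : ContDiff ℝ ∞ φ.1 := φ.2.1

theorem hasCompactSupport (φ : Test) : HasCompactSupport φ.1 := φ.2.2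

theorem differentiable (φ : Test) : Differentiable ℝ φ.1 := φ.contDiff.differentiable (by simp)

theorem continuous (φ : Test) : Continuous φ.1 := φ.contDiff.continuous

theorem continuous_fderiv (φ : Test) : Continuous (fderiv ℝ φ.1) :=
  φ.contDiff.continuous_fderiv (by simp)

theorem memLp (φ : Test) : MemLp φ.1 2 (volume : Measure E3) :=
  φ.continuous.memLp_of_hasCompactSupport φ.hasCompactSupport

theorem integrable (φ : Test) : Integrable φ.1 (volume : Measure E3) :=
  φ.continuous.integrable_of_hasCompactSupport φ.hasCompactSupport

theorem gradient_apply (φ : E3 → ℝ) (y : E3) (k : Fin 3) :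
    gradient φ y k = fderiv ℝ φ y (EuclideanSpace.single k 1) := by
  have h : inner ℝ (gradient φ y) (EuclideanSpace.single k (1 : ℝ))
      = fderiv ℝ φ y (EuclideanSpace.single k 1) := by
    rw [gradient, InnerProductSpace.toDual_symm_apply]
  rw [← h, EuclideanSpace.inner_single_right]
  simp

theorem norm_gradient (φ : E3 → ℝ) (y : E3) : ‖gradient φ y‖ = ‖fderiv ℝ φ y‖ := by
  rw [gradient, LinearIsometryEquiv.norm_map]

theorem memLp_gradient (φ : Test) : MemLp (gradient φ.1) 2 (volume : Measure E3) := by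
  refine Continuous.memLp_of_hasCompactSupport ?_ ?_
  · exact (InnerProductSpace.toDual ℝ E3).symm.continuous.comp φ.continuous_fderiv
  · exact (φ.hasCompactSupport.fderiv (𝕜 := ℝ)).comp_left
      (g := (InnerProductSpace.toDual ℝ E3).symm) (by simp)

theorem isWeakGradient_gradient (φ : Test) : IsWeakGradient φ.1 (gradient φ.1) := by
  intro ψ hψ hc k
  simp_rw [gradient_apply]
  have hd := memLp_fderiv_of_test hψ hc (EuclideanSpace.single k 1)
  have hd' := memLp_fderiv_of_test φ.contDiff φ.hasCompactSupport (EuclideanSpace.single k 1)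
  have hψ2 : MemLp ψ 2 (volume : Measure E3) := hψ.continuous.memLp_of_hasCompactSupport hc
  exact integral_mul_fderiv_eq_neg_fderiv_mul_of_integrable (hd'.integrable_mul hψ2)
    (φ.memLp.integrable_mul hd) (φ.memLp.integrable_mul hψ2) (fun y _ => φ.differentiable y)
    (fun y _ => hψ.differentiable (by simp) y)

end Test

/-- Each defining identity equates two `L²` scalar products against fixed functions, so the graph is
an intersection of closed sets. This gives completeness of `H¹`. -/
theorem isClosed_sobolevGraph : IsClosed (sobolevGraph : Set
    (WithLp 2 (Lp ℝ 2 (volume : Measure E3) × Lp E3 2 (volume : Measure E3)))) := by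
  have e : (sobolevGraph : Set (WithLp 2 (Lp ℝ 2 (volume : Measure E3) ×
      Lp E3 2 (volume : Measure E3)))) = ⋂ φ : Test, ⋂ k : Fin 3,
      {w | inner ℝ (memLp_fderiv_of_test φ.contDiff φ.hasCompactSupport
          (EuclideanSpace.single k 1)).toLp w.fst
        = - inner ℝ φ.memLp.toLp ((EuclideanSpace.proj k : E3 →L[ℝ] ℝ).compLp w.snd)} := by
    ext w
    simp only [Set.mem_iInter, Set.mem_ofPred_eq, SetLike.mem_coe]
    have e1 : ∀ (φ : Test) (k : Fin 3), inner ℝ (memLp_fderiv_of_test φ.contDiff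
        φ.hasCompactSupport (EuclideanSpace.single k 1)).toLp w.fst
        = ∫ y, w.fst y * fderiv ℝ φ.1 y (EuclideanSpace.single k 1) := by
      intro φ k
      rw [L2.inner_def]
      refine integral_congr_ae ?_
      filter_upwards [(memLp_fderiv_of_test φ.contDiff φ.hasCompactSupport
          (EuclideanSpace.single k 1)).coeFn_toLp] with y hy
      rw [hy]
      simp
    have e2 : ∀ (φ : Test) (k : Fin 3), inner ℝ φ.memLp.toLp
        ((EuclideanSpace.proj k : E3 →L[ℝ] ℝ).compLp w.snd) = ∫ y, w.snd y k * φ.1 y := by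
      intro φ k
      rw [L2.inner_def]
      refine integral_congr_ae ?_
      filter_upwards [φ.memLp.coeFn_toLp,
        (EuclideanSpace.proj k : E3 →L[ℝ] ℝ).coeFn_compLp w.snd] with y hy hy'
      rw [hy, hy']
      simp
    simp_rw [e1, e2]
    exact ⟨fun h φ k => h φ.1 φ.contDiff φ.hasCompactSupport k,
      fun h φ hφ hc k => h ⟨φ, hφ, hc⟩ k⟩
  rw [e]
  refine isClosed_iInter fun φ => isClosed_iInter fun k => isClosed_eq ?_ ?_
  · exact Continuous.inner continuous_const (WithLp.prod_continuous_ofLp 2 _ _).fst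
  · refine (Continuous.inner continuous_const ?_).neg
    exact ((EuclideanSpace.proj k : E3 →L[ℝ] ℝ).compLpL 2 volume).continuous.comp
      (WithLp.prod_continuous_ofLp 2 _ _).snd

instance : CompleteSpace H1 := isClosed_sobolevGraph.completeSpace_coe

namespace H1

theorem isWeakGradient (u : H1) : IsWeakGradient u.val u.grad := u.2

theorem ae_eq_zero_of_forall_test {h : E3 → ℝ} (hh : MemLp h 2 (volume : Measure E3))
    (h0 : ∀ φ : Test, ∫ y, h y * φ.1 y = 0) : h =ᵐ[volume] 0 := by
  refine ae_eq_zero_of_integral_contDiff_smul_eq_zero (hh.locallyIntegrable (by norm_num)) ?_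
  intro g hg hc
  have := h0 ⟨g, hg, hc⟩
  simpa [mul_comm] using this

/-- A weak gradient is determined by its function, so identities in `H1` need only be checked on the
`L²` component. -/
theorem eq_zero_of_val {u : H1} (hu : u.val =ᵐ[volume] 0) : u = 0 := by
  have h1 : ∀ k, (fun y => u.grad y k) =ᵐ[volume] 0 := by
    intro k
    refine ae_eq_zero_of_forall_test (memLp_coord (Lp.memLp _) k) fun φ => ?_
    have := u.isWeakGradient φ.1 φ.contDiff φ.hasCompactSupport k
    have h2 : ∫ y, u.val y * fderiv ℝ φ.1 y (EuclideanSpace.single k 1) = 0 := by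
      rw [integral_congr_ae (g := fun _ => (0 : ℝ)) (by filter_upwards [hu] with y hy; simp [hy])]
      simp
    linarith
  have h2 : u.grad =ᵐ[volume] 0 := by
    filter_upwards [ae_all_iff.2 h1] with y hy
    ext k
    simpa using hy k
  apply Subtype.ext
  have e1 : u.1.fst = 0 := (Lp.eq_zero_iff_ae_eq_zero).2 hu
  have e2 : u.1.snd = 0 := (Lp.eq_zero_iff_ae_eq_zero).2 h2
  exact WithLp.ofLp_injective 2 (Prod.ext e1 e2)

theorem val_sub (u v : H1) : (u - v).val = u.val - v.val := rfl
theorem val_add (u v : H1) : (u + v).val = u.val + v.val := rfl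
theorem val_smul (c : ℝ) (v : H1) : (c • v).val = c • v.val := rfl
theorem ext_val {u v : H1} (h : u.val =ᵐ[volume] v.val) : u = v := by
  rw [← sub_eq_zero]
  apply eq_zero_of_val
  rw [val_sub]
  filter_upwards [Lp.coeFn_sub u.val v.val, h] with y hy h'
  rw [hy, Pi.sub_apply, h', sub_self]
  rfl

/-- The element of `H¹` with a given test function as representative. -/
def mkTest (φ : Test) : H1 :=
  ⟨WithLp.toLp 2 (φ.memLp.toLp, φ.memLp_gradient.toLp),
    φ.isWeakGradient_gradient.congr φ.memLp.coeFn_toLp φ.memLp_gradient.coeFn_toLp⟩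

theorem mkTest_val (φ : Test) : (mkTest φ).val =ᵐ[volume] φ.1 := φ.memLp.coeFn_toLp

theorem mkTest_grad (φ : Test) : (mkTest φ).grad =ᵐ[volume] gradient φ.1 :=
  φ.memLp_gradient.coeFn_toLp

/-- The inclusion of the test functions into `H¹`. -/
def ofTest : Test →ₗ[ℝ] H1 where
  toFun := mkTest
  map_add' φ ψ := by
    apply ext_val
    rw [val_add]
    filter_upwards [mkTest_val φ, mkTest_val ψ, mkTest_val (φ + ψ),
      Lp.coeFn_add (mkTest φ).val (mkTest ψ).val] with y h1 h2 h3 h4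
    rw [h3, h4, Pi.add_apply, h1, h2]
    rfl
  map_smul' c φ := by
    apply ext_val
    rw [RingHom.id_apply, val_smul]
    filter_upwards [mkTest_val φ, mkTest_val (c • φ),
      Lp.coeFn_smul c (mkTest φ).val] with y h1 h3 h4
    rw [h3, h4, Pi.smul_apply, h1]
    rfl

theorem ofTest_val (φ : Test) : (ofTest φ).val =ᵐ[volume] φ.1 := mkTest_val φ

theorem ofTest_grad (φ : Test) : (ofTest φ).grad =ᵐ[volume] gradient φ.1 := mkTest_grad φ

theorem form_ofTest (ξ : ℝ) (φ ψ : Test) : form ξ (ofTest φ) (ofTest ψ)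
    = ∫ y, (inner ℝ (gradient φ.1 y) (gradient ψ.1 y) + (ξ ^ 2)⁻¹ * (φ.1 y * ψ.1 y)) := by
  rw [integral_add, integral_const_mul, form]
  · congr 1
    · rw [L2.inner_def]
      refine integral_congr_ae ?_
      filter_upwards [ofTest_grad φ, ofTest_grad ψ] with y h1 h2
      rw [h1, h2]
    · congr 1
      rw [L2.inner_def]
      refine integral_congr_ae ?_
      filter_upwards [ofTest_val φ, ofTest_val ψ] with y h1 h2
      rw [h1, h2]
      simp [mul_comm]
  · refine (L2.integrable_inner (𝕜 := ℝ) (ofTest φ).grad (ofTest ψ).grad).congr ?_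
    filter_upwards [ofTest_grad φ, ofTest_grad ψ] with y h1 h2
    rw [h1, h2]
  · exact (φ.memLp.integrable_mul ψ.memLp).const_mul _

/-- The functions vanishing on a set, as a subspace. -/
def zeroSubmodule (A : Set E3) : Submodule ℝ H1 :=
  (Submodule.map ofTest
    { carrier := {φ | ∀ y ∈ A, φ.1 y = 0}
      add_mem' := fun h h' y hy => by simp [h y hy, h' y hy]
      zero_mem' := fun y _ => rfl
      smul_mem' := fun c φ h y hy => by simp [h y hy] }).topologicalClosure

theorem coe_zeroSubmodule (A : Set E3) : (zeroSubmodule A : Set H1) = zeroOn A := by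
  rw [zeroSubmodule, Submodule.topologicalClosure_coe, zeroOn]
  congr 1
  ext u
  constructor
  · rintro ⟨φ, h, rfl⟩
    exact ⟨φ.1, φ.contDiff, φ.hasCompactSupport, h, ofTest_val φ⟩
  · rintro ⟨φ, h1, h2, h3, h4⟩
    exact ⟨⟨φ, h1, h2⟩, h3, ext_val ((ofTest_val _).trans h4.symm)⟩

theorem isClosed_zeroSubmodule (A : Set E3) : IsClosed (zeroSubmodule A : Set H1) :=
  Submodule.isClosed_topologicalClosure _

theorem ofTest_mem_zeroSubmodule {A : Set E3} {φ : Test} (h : ∀ y ∈ A, φ.1 y = 0) :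
    ofTest φ ∈ zeroSubmodule A :=
  Submodule.le_topologicalClosure _ ⟨φ, h, rfl⟩

theorem zeroSubmodule_anti {A B : Set E3} (h : A ⊆ B) : zeroSubmodule B ≤ zeroSubmodule A := by
  refine Submodule.topologicalClosure_mono (Submodule.map_mono ?_)
  intro φ hφ y hy
  exact hφ y (h hy)

end H1

/-! ### Density of the test functions -/

namespace Test

/-- The directional derivative of a test function. -/
def lineDeriv (φ : Test) (v : E3) : Test :=
  ⟨fun y => fderiv ℝ φ.1 y v,
    (φ.contDiff.fderiv_right (m := ∞) (by simp)).clm_apply contDiff_const,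
    (φ.hasCompactSupport.fderiv (𝕜 := ℝ)).comp_left (g := fun L : E3 →L[ℝ] ℝ => L v) (by simp)⟩

/-- The test function `t ↦ φ (x - t)`. -/
def reflect (φ : Test) (x : E3) : Test :=
  ⟨fun t => φ.1 (x - t), φ.contDiff.comp (contDiff_const.sub contDiff_id),
    φ.hasCompactSupport.comp_homeomorph (Homeomorph.subLeft x)⟩

theorem fderiv_reflect (φ : Test) (x t v : E3) :
    fderiv ℝ (φ.reflect x).1 t v = -fderiv ℝ φ.1 (x - t) v := by
  have h1 : HasFDerivAt (fun t : E3 => x - t) (-ContinuousLinearMap.id ℝ E3) t :=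
    (hasFDerivAt_id t).const_sub x
  have h2 := (φ.differentiable (x - t)).hasFDerivAt.comp t h1
  have h3 : fderiv ℝ (φ.reflect x).1 t
      = (fderiv ℝ φ.1 (x - t)).comp (-ContinuousLinearMap.id ℝ E3) := h2.fderiv
  rw [h3]
  simp

end Test

/-- The convolution of a function with a test function. -/
def testConv (h : E3 → ℝ) (ρ : Test) : E3 → ℝ :=
  convolution h ρ.1 (ContinuousLinearMap.lsmul ℝ ℝ) volume

theorem testConv_apply (h : E3 → ℝ) (ρ : Test) (x : E3) :
    testConv h ρ x = ∫ t, h t * ρ.1 (x - t) := rfl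

theorem contDiff_testConv {h : E3 → ℝ} (hh : MemLp h 2 (volume : Measure E3)) (ρ : Test) :
    ContDiff ℝ ∞ (testConv h ρ) :=
  ρ.hasCompactSupport.contDiff_convolution_right (n := ⊤) _ (hh.locallyIntegrable (by norm_num))
    ρ.contDiff

theorem fderiv_testConv {h : E3 → ℝ} (hh : MemLp h 2 (volume : Measure E3)) (ρ : Test)
    (x v : E3) :
    fderiv ℝ (testConv h ρ) x v = testConv h (ρ.lineDeriv v) x := by
  have hl := hh.locallyIntegrable (by norm_num)
  have h1 := ρ.hasCompactSupport.hasFDerivAt_convolution_right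
    (ContinuousLinearMap.lsmul ℝ ℝ) hl (ρ.contDiff.of_le (by simp)) x
  rw [testConv, h1.fderiv, convolution_precompR_apply]
  · rfl
  · exact hl
  · exact ρ.hasCompactSupport.fderiv (𝕜 := ℝ)
  · exact ρ.continuous_fderiv

/-- By `|a b| ≤ (a² + b²) / 2` and translation invariance the bound does not depend on `x`. -/
theorem exists_abs_testConv_le {h : E3 → ℝ} (hh : MemLp h 2 (volume : Measure E3)) (ρ : Test) :
    ∃ M : ℝ, ∀ x, |testConv h ρ x| ≤ M := by
  refine ⟨(∫ t, h t ^ 2 / 2) + ∫ t, ρ.1 t ^ 2 / 2, fun x => ?_⟩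
  have i1 : Integrable (fun t => h t ^ 2 / 2) := hh.integrable_sq.div_const 2
  have i2 : Integrable (fun t => ρ.1 (x - t) ^ 2 / 2) :=
    (ρ.reflect x).memLp.integrable_sq.div_const 2
  rw [testConv_apply, ← integral_sub_left_eq_self (fun t => ρ.1 t ^ 2 / 2) volume x,
    ← integral_add i1 i2, ← Real.norm_eq_abs]
  refine norm_integral_le_of_norm_le (i1.add i2) (ae_of_all _ fun t => ?_)
  rw [Real.norm_eq_abs, abs_le]
  constructor <;>
    nlinarith [sq_nonneg (h t + ρ.1 (x - t)), sq_nonneg (h t - ρ.1 (x - t))]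

/-- A polynomially decaying weight with small logarithmic gradient. -/
def slowWeight (x : E3) : ℝ := ((16 + ‖x‖ ^ 2) ^ 2)⁻¹

theorem slowWeight_pos (x : E3) : 0 < slowWeight x := by unfold slowWeight; positivity

theorem contDiff_slowWeight : ContDiff ℝ ∞ slowWeight := by
  unfold slowWeight
  refine ContDiff.inv (((contDiff_const.add (contDiff_norm_sq ℝ)).pow 2)) fun x => ?_
  positivity

/-- The constant 16 in the weight gives `8 ‖x‖ ≤ 16 + ‖x‖²`. The resulting factor 1/2 is small
enough that the three cross terms in `eq_zero_of_laplacian_eq` consume only three quarters of `w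
U²`. -/
theorem abs_fderiv_slowWeight_le (x : E3) (k : Fin 3) :
    |fderiv ℝ slowWeight x (EuclideanSpace.single k 1)| ≤ slowWeight x / 2 := by
  have h0 : 0 < 16 + ‖x‖ ^ 2 := by positivity
  have h1 : HasFDerivAt (fun x : E3 => 16 + ‖x‖ ^ 2) (2 • innerSL ℝ x) x :=
    (hasStrictFDerivAt_norm_sq x).hasFDerivAt.const_add 16
  have h2 := (hasDerivAt_inv (x := (16 + ‖x‖ ^ 2) ^ 2) (by positivity)).comp_hasFDerivAt x
    (h1.pow 2)
  have h3 : fderiv ℝ slowWeight x = _ := h2.fderiv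
  rw [h3]
  have h4 : |x k| ≤ ‖x‖ := by
    have := PiLp.norm_apply_le x k
    simpa using this
  simp only [slowWeight, smul_apply, innerSL_apply_apply, smul_eq_mul,
    EuclideanSpace.inner_single_right]
  simp only [nsmul_eq_mul, conj_trivial, one_mul, Nat.cast_ofNat, Nat.add_one_sub_one,
    pow_one]
  rw [abs_mul, abs_neg, abs_of_pos (by positivity)]
  rw [abs_mul, abs_mul, abs_mul, abs_of_pos h0, abs_two]
  rw [← sub_nonneg]
  have : ((16 + ‖x‖ ^ 2) ^ 2)⁻¹ / 2 - (((16 + ‖x‖ ^ 2) ^ 2) ^ 2)⁻¹ *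
      (2 * (16 + ‖x‖ ^ 2) * (2 * |x k|))
      = (16 + ‖x‖ ^ 2 - 8 * |x k|) / (2 * (16 + ‖x‖ ^ 2) ^ 3) := by
    field_simp
    ring
  rw [this]
  refine div_nonneg ?_ (by positivity)
  nlinarith [sq_nonneg (‖x‖ - 4)]

theorem integrable_slowWeight : Integrable slowWeight := by
  have h := integrable_rpow_neg_one_add_norm_sq (E := E3) (μ := volume) (r := 4)
    (by simp; norm_num)
  refine h.mono' contDiff_slowWeight.continuous.aestronglyMeasurable (ae_of_all _ fun x => ?_)
  rw [Real.norm_of_nonneg (slowWeight_pos x).le, slowWeight,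
    show (-4 / 2 : ℝ) = -(2 : ℕ) by norm_num, Real.rpow_neg (by positivity), Real.rpow_natCast]
  gcongr
  norm_num

theorem Integrable.slowWeight_mul {f : E3 → ℝ} (hf : Continuous f) {M : ℝ} (hM : ∀ x, |f x| ≤ M) :
    Integrable fun x => slowWeight x * f x :=
  integrable_slowWeight.mul_bdd hf.aestronglyMeasurable (ae_of_all _ hM)

/-- A bounded smooth function whose bounded gradient field has divergence equal to the function
vanishes. -/
theorem eq_zero_of_laplacian_eq {U : E3 → ℝ} {G : Fin 3 → E3 → ℝ} (hU : ContDiff ℝ ∞ U)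
    (hG : ∀ k, ContDiff ℝ ∞ (G k))
    (hUG : ∀ k x, fderiv ℝ U x (EuclideanSpace.single k 1) = G k x)
    (hdiv : ∀ x, ∑ k, fderiv ℝ (G k) x (EuclideanSpace.single k 1) = U x)
    {M : ℝ} (hUM : ∀ x, |U x| ≤ M) (hGM : ∀ k x, |G k x| ≤ M)
    (hGM' : ∀ k x, |fderiv ℝ (G k) x (EuclideanSpace.single k 1)| ≤ M) (x : E3) : U x = 0 := by
  set w := slowWeight with hw
  have hM : 0 ≤ M := (abs_nonneg _).trans (hUM 0)
  have hmul : ∀ a b : ℝ, |a| ≤ M → |b| ≤ M → |a * b| ≤ M * M := fun a b ha hb => by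
    rw [abs_mul]; exact mul_le_mul ha hb (abs_nonneg _) hM
  have hwd : Differentiable ℝ w := contDiff_slowWeight.differentiable (by simp)
  have hUd : Differentiable ℝ U := hU.differentiable (by simp)
  have hGd : ∀ k, Differentiable ℝ (G k) := fun k => (hG k).differentiable (by simp)
  let w' : Fin 3 → E3 → ℝ := fun k x => fderiv ℝ w x (EuclideanSpace.single k 1)
  let G' : Fin 3 → E3 → ℝ := fun k x => fderiv ℝ (G k) x (EuclideanSpace.single k 1)
  have cw' : ∀ k, Continuous (w' k) := fun k =>
    (contDiff_slowWeight.continuous_fderiv (by simp)).clm_apply continuous_const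
  have cG' : ∀ k, Continuous (G' k) := fun k =>
    ((hG k).continuous_fderiv (by simp)).clm_apply continuous_const
  have iw' : ∀ k, Integrable (w' k) := fun k => by
    refine integrable_slowWeight.mono' (cw' k).aestronglyMeasurable (ae_of_all _ fun x => ?_)
    have := abs_fderiv_slowWeight_le x k
    have h2 := slowWeight_pos x
    rw [Real.norm_eq_abs]
    linarith
  have i1 : ∀ k, Integrable fun x => w' k x * (U x * G k x) := fun k =>
    (iw' k).mul_bdd (hU.continuous.mul (hG k).continuous).aestronglyMeasurable
      (ae_of_all _ fun x => hmul _ _ (hUM x) (hGM k x))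
  have i2 : ∀ k, Integrable fun x => w x * (G k x * G k x) := fun k =>
    Integrable.slowWeight_mul ((hG k).continuous.mul (hG k).continuous)
      fun x => hmul _ _ (hGM k x) (hGM k x)
  have i3 : ∀ k, Integrable fun x => w x * (U x * G' k x) := fun k =>
    Integrable.slowWeight_mul (hU.continuous.mul (cG' k))
      fun x => hmul _ _ (hUM x) (hGM' k x)
  have i4 : ∀ k, Integrable fun x => w x * (U x * G k x) := fun k =>
    Integrable.slowWeight_mul (hU.continuous.mul (hG k).continuous)
      fun x => hmul _ _ (hUM x) (hGM k x)
  have i12 : ∀ k, Integrable fun x => w' k x * (U x * G k x) + w x * (G k x * G k x) :=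
    fun k => (i1 k).add (i2 k)
  have i123 : ∀ k, Integrable fun x =>
      w' k x * (U x * G k x) + w x * (G k x * G k x) + w x * (U x * G' k x) :=
    fun k => (i12 k).add (i3 k)
  have hd : ∀ k x, fderiv ℝ (fun x => w x * U x) x (EuclideanSpace.single k 1)
      = w x * G k x + U x * w' k x := by
    intro k x
    rw [fderiv_fun_mul (hwd x) (hUd x)]
    simp [hUG, w']
  -- The integrand is the `k`-th term of the divergence of `w U G`. The integrable weight against
  -- bounded factors rules out a contribution from infinity.
  have key : ∀ k, ∫ x, (w' k x * (U x * G k x) + w x * (G k x * G k x) + w x * (U x * G' k x))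
      = 0 := by
    intro k
    have h := integral_mul_fderiv_eq_neg_fderiv_mul_of_integrable (𝕜 := ℝ)
      (μ := (volume : Measure E3)) (f := fun x => w x * U x) (g := G k)
      (v := EuclideanSpace.single k 1) ?_ ?_ ?_ (fun x _ => (hwd.mul hUd) x) (fun x _ => hGd k x)
    · simp_rw [hd] at h
      rw [integral_add (i12 k) (i3 k)]
      have e1 : ∫ x, w x * U x * fderiv ℝ (G k) x (EuclideanSpace.single k 1)
          = ∫ x, w x * (U x * G' k x) := by simp_rw [mul_assoc]; rfl
      have e2 : ∫ x, (w x * G k x + U x * w' k x) * G k x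
          = ∫ x, (w' k x * (U x * G k x) + w x * (G k x * G k x)) := by
        congr 1; ext x; ring
      rw [e1, e2] at h
      rw [h]
      exact add_neg_cancel _
    · simp_rw [hd]
      refine ((i1 k).add (i2 k)).congr (ae_of_all _ fun x => ?_)
      simp only [Pi.add_apply]
      ring
    · refine (i3 k).congr (ae_of_all _ fun x => ?_)
      simp only [G']
      ring
    · refine (i4 k).congr (ae_of_all _ fun x => ?_)
      ring
  have hsum : ∫ x, ∑ k, (w' k x * (U x * G k x) + w x * (G k x * G k x) + w x * (U x * G' k x))
      = 0 := by
    rw [integral_finsetSum _ fun k _ => i123 k]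
    exact Finset.sum_eq_zero fun k _ => key k
  have iU : Integrable fun x => w x * (U x * U x) := Integrable.slowWeight_mul
    (hU.continuous.mul hU.continuous) fun x => hmul _ _ (hUM x) (hUM x)
  have hle : ∫ x, w x * (U x * U x) / 4 ≤ 0 := by
    rw [← hsum]
    refine integral_mono (iU.div_const 4)
      (integrable_finsetSum _ fun k _ => i123 k) fun x => ?_
    have hwx : 0 < w x := slowWeight_pos x
    have e : ∑ k, (w' k x * (U x * G k x) + w x * (G k x * G k x) + w x * (U x * G' k x))
        = ∑ k, (w' k x * (U x * G k x) + w x * (G k x * G k x)) + w x * (U x * U x) := by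
      rw [Finset.sum_add_distrib, ← Finset.mul_sum, ← Finset.mul_sum]
      congr 3
      exact hdiv x
    -- Young's inequality on the cross term; its `G²` part is absorbed by `w G²`. Summing over three
    -- coordinates leaves `w U² - 3/4 w U² = w U² / 4`.
    have h1 : ∀ k, -(w x / 4 * (U x * U x)) ≤
        (w' k x * (U x * G k x) + w x * (G k x * G k x)) := by
      intro k
      have h2 : |w' k x * (U x * G k x)| ≤ w x / 2 * |U x * G k x| := by
        rw [abs_mul]
        exact mul_le_mul_of_nonneg_right (abs_fderiv_slowWeight_le x k) (abs_nonneg _)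
      have h3 : |U x * G k x| ≤ (U x * U x + G k x * G k x) / 2 := by
        rw [abs_le]
        constructor <;> nlinarith [sq_nonneg (U x + G k x), sq_nonneg (U x - G k x)]
      have h4 := (abs_le.1 h2).1
      have h5 := mul_le_mul_of_nonneg_left h3 (by positivity : 0 ≤ w x / 2)
      nlinarith [mul_nonneg hwx.le (mul_self_nonneg (G k x))]
    rw [e]
    have h6 := Finset.sum_le_sum fun k (_ : k ∈ Finset.univ) => h1 k
    simp only [Finset.sum_const, Finset.card_univ, Fintype.card_fin, nsmul_eq_mul] at h6
    push_cast at h6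
    linarith
  have h0 : ∫ x, w x * (U x * U x) / 4 = 0 := le_antisymm hle
    (integral_nonneg fun x => div_nonneg
      (mul_nonneg (slowWeight_pos x).le (mul_self_nonneg _)) (by norm_num))
  rw [integral_eq_zero_iff_of_nonneg (fun x => div_nonneg
      (mul_nonneg (slowWeight_pos x).le (mul_self_nonneg _)) (by norm_num)) (iU.div_const 4)] at h0
  have h7 := Measure.eq_of_ae_eq h0 (by
    exact (contDiff_slowWeight.continuous.mul (hU.continuous.mul hU.continuous)).div_const 4)
    continuous_const
  have h8 := congrFun h7 x
  have h9 := slowWeight_pos x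
  simp only [Pi.zero_apply, div_eq_zero_iff, mul_eq_zero] at h8
  simpa [h9.ne'] using h8

namespace H1

theorem inner_ofTest (u : H1) (φ : Test) : inner ℝ u (ofTest φ)
    = (∫ y, u.val y * φ.1 y)
      + ∑ k, ∫ y, u.grad y k * fderiv ℝ φ.1 y (EuclideanSpace.single k 1) := by
  have h : inner ℝ u (ofTest φ) = inner ℝ u.val (ofTest φ).val
      + inner ℝ u.grad (ofTest φ).grad := WithLp.prod_inner_apply _ _
  rw [h, L2.inner_def, L2.inner_def]
  congr 1
  · refine integral_congr_ae ?_
    filter_upwards [ofTest_val φ] with y hy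
    rw [hy]
    simp [mul_comm]
  · rw [← integral_finsetSum]
    · refine integral_congr_ae ?_
      filter_upwards [ofTest_grad φ] with y hy
      rw [hy, PiLp.inner_apply]
      refine Finset.sum_congr rfl fun k _ => ?_
      rw [Test.gradient_apply]
      simp [mul_comm]
    · intro k _
      exact (memLp_coord (Lp.memLp u.grad) k).integrable_mul (φ.lineDeriv _).memLp

/-- Orthogonality to all test functions says `-Δu + u = 0` in the sense of distributions.
Convolution with a test function gives a bounded smooth solution with bounded derivatives, which
vanishes by `eq_zero_of_laplacian_eq`; since the convolving function is arbitrary, so does `u`. -/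
theorem eq_zero_of_inner_ofTest {u : H1} (hu : ∀ φ, inner ℝ u (ofTest φ) = 0) : u = 0 := by
  apply eq_zero_of_val
  have hv : MemLp u.val 2 (volume : Measure E3) := Lp.memLp _
  have hg : ∀ k, MemLp (fun y => u.grad y k) 2 (volume : Measure E3) :=
    fun k => memLp_coord (Lp.memLp _) k
  have hconv : ∀ (ρ : Test) x, testConv u.val ρ x = 0 := by
    intro ρ
    obtain ⟨M₁, hM₁⟩ := exists_abs_testConv_le hv ρ
    choose M₂ hM₂ using fun k => exists_abs_testConv_le (hg k) ρ
    choose M₃ hM₃ using fun k => exists_abs_testConv_le (hg k)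
      (ρ.lineDeriv (EuclideanSpace.single k 1))
    have p1 : 0 ≤ M₁ := (abs_nonneg _).trans (hM₁ 0)
    have p2 : ∀ k, 0 ≤ M₂ k := fun k => (abs_nonneg _).trans (hM₂ k 0)
    have p3 : ∀ k, 0 ≤ M₃ k := fun k => (abs_nonneg _).trans (hM₃ k 0)
    have q2 : ∀ k, M₂ k ≤ ∑ k, M₂ k := fun k =>
      Finset.single_le_sum (fun k _ => p2 k) (Finset.mem_univ k)
    have q3 : ∀ k, M₃ k ≤ ∑ k, M₃ k := fun k =>
      Finset.single_le_sum (fun k _ => p3 k) (Finset.mem_univ k)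
    have s2 : 0 ≤ ∑ k, M₂ k := Finset.sum_nonneg fun k _ => p2 k
    have s3 : 0 ≤ ∑ k, M₃ k := Finset.sum_nonneg fun k _ => p3 k
    refine eq_zero_of_laplacian_eq (M := M₁ + ∑ k, M₂ k + ∑ k, M₃ k) (contDiff_testConv hv ρ)
      (fun k => contDiff_testConv (hg k) ρ) ?_ ?_ ?_ ?_ ?_
    · intro k x
      rw [fderiv_testConv hv, testConv_apply, testConv_apply]
      have h := u.isWeakGradient (ρ.reflect x).1 (ρ.reflect x).contDiff
        (ρ.reflect x).hasCompactSupport k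
      simp_rw [Test.fderiv_reflect, mul_neg] at h
      rw [integral_neg] at h
      exact neg_injective h
    · intro x
      simp_rw [fderiv_testConv (hg _), testConv_apply]
      have h := hu (ρ.reflect x)
      rw [inner_ofTest] at h
      simp_rw [Test.fderiv_reflect, mul_neg, integral_neg] at h
      rw [Finset.sum_neg_distrib] at h
      exact (sub_eq_zero.1 (by rw [sub_eq_add_neg]; exact h)).symm
    · intro x
      linarith [hM₁ x]
    · intro k x
      linarith [hM₂ k x, q2 k]
    · intro k x
      rw [fderiv_testConv (hg k)]
      linarith [hM₃ k x, q3 k]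
  refine ae_eq_zero_of_forall_test hv fun φ => ?_
  have h := hconv (φ.reflect 0) 0
  rw [testConv_apply] at h
  simpa [Test.reflect] using h

theorem dense_range_ofTest : Dense (Set.range ofTest) := by
  have h : (LinearMap.range ofTest).topologicalClosure = ⊤ := by
    rw [Submodule.topologicalClosure_eq_top_iff, Submodule.eq_bot_iff]
    intro u hu
    refine eq_zero_of_inner_ofTest fun φ => ?_
    exact Submodule.inner_left_of_mem_orthogonal (LinearMap.mem_range_self ofTest φ) hu
  exact Submodule.dense_iff_topologicalClosure_eq_top.2 h

end H1

/-! ### Hardy's inequality -/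

namespace Test

/-- The product of a smooth function and a test function. -/
def mulLeft (η : E3 → ℝ) (hη : ContDiff ℝ ∞ η) (φ : Test) : Test :=
  ⟨fun y => η y * φ.1 y, hη.mul φ.contDiff, φ.hasCompactSupport.mul_left⟩

theorem integrable_mul_continuous (φ : Test) {g : E3 → ℝ} (hg : Continuous g) :
    Integrable fun y => φ.1 y * g y :=
  (φ.continuous.mul hg).integrable_of_hasCompactSupport φ.hasCompactSupport.mul_right

theorem integrable_sq (φ : Test) : Integrable fun y => φ.1 y ^ 2 := φ.memLp.integrable_sq

theorem integrable_norm_fderiv_sq (φ : Test) : Integrable fun y => ‖fderiv ℝ φ.1 y‖ ^ 2 := by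
  simpa [norm_gradient] using φ.memLp_gradient.integrable_norm_pow (by norm_num)

/-- The divergence theorem for a smooth field tested against a test function. -/
theorem integral_mul_divergence (ψ : Test) {F : E3 → E3} (hF : ContDiff ℝ 1 F) :
    ∫ y, ψ.1 y * ∑ k, (fderiv ℝ F y (EuclideanSpace.single k 1)) k
      = -∫ y, fderiv ℝ ψ.1 y (F y) := by
  have hFk : ∀ k : Fin 3, ContDiff ℝ 1 fun y => F y k := fun k =>
    (EuclideanSpace.proj k : E3 →L[ℝ] ℝ).contDiff.comp hF
  have hd : ∀ (k : Fin 3) y v, fderiv ℝ (fun y => F y k) y v = (fderiv ℝ F y v) k := by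
    intro k y v
    have h := (EuclideanSpace.proj k : E3 →L[ℝ] ℝ).hasFDerivAt.comp y
      ((hF.differentiable (by simp)) y).hasFDerivAt
    have h2 : fderiv ℝ (fun y => F y k) y = _ := h.fderiv
    rw [h2]
    rfl
  have hc : ∀ k : Fin 3, Continuous fun y => (fderiv ℝ F y (EuclideanSpace.single k 1)) k :=
    fun k => (EuclideanSpace.proj k : E3 →L[ℝ] ℝ).continuous.comp
      ((hF.continuous_fderiv (by simp)).clm_apply continuous_const)
  have hk : ∀ k : Fin 3, ∫ y, ψ.1 y * (fderiv ℝ F y (EuclideanSpace.single k 1)) k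
      = -∫ y, fderiv ℝ ψ.1 y (EuclideanSpace.single k 1) * F y k := by
    intro k
    simp_rw [← hd]
    refine integral_mul_fderiv_eq_neg_fderiv_mul_of_integrable ?_ ?_ ?_
      (fun y _ => ψ.differentiable y) (fun y _ => (hFk k).differentiable (by simp) y)
    · exact (ψ.lineDeriv _).integrable_mul_continuous (hFk k).continuous
    · simp_rw [hd]
      exact ψ.integrable_mul_continuous (hc k)
    · exact ψ.integrable_mul_continuous (hFk k).continuous
  simp_rw [Finset.mul_sum]
  rw [integral_finsetSum _ fun k _ => ψ.integrable_mul_continuous (hc k),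
    Finset.sum_congr rfl fun k _ => hk k, Finset.sum_neg_distrib, ← integral_finsetSum]
  · congr 2
    ext y
    have hs : F y = ∑ k, F y k • EuclideanSpace.single k (1 : ℝ) := by
      ext i
      simp [Pi.single_apply]
    conv_rhs => rw [hs]
    rw [map_sum]
    refine Finset.sum_congr rfl fun k _ => ?_
    rw [map_smul, smul_eq_mul, mul_comm]
  · intro k _
    exact (ψ.lineDeriv _).integrable_mul_continuous (hFk k).continuous

/-- `φ²` is tested against the field `F = (y - x) / (a² + ‖y - x‖²)`, whose divergence in dimension
three is at least the Hardy weight and whose squared length is at most that weight. Positivity of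
`a` keeps `F` smooth, while the constant 4 does not depend on `a`. -/
theorem hardy (φ : Test) (x : E3) {a : ℝ} (ha : 0 < a) :
    ∫ y, φ.1 y ^ 2 / (a ^ 2 + ‖y - x‖ ^ 2) ≤ 4 * ∫ y, ‖fderiv ℝ φ.1 y‖ ^ 2 := by
  have hD : ∀ y, 0 < a ^ 2 + ‖y - x‖ ^ 2 := fun y => by positivity
  have hDs : ContDiff ℝ ∞ fun y : E3 => a ^ 2 + ‖y - x‖ ^ 2 :=
    contDiff_const.add ((contDiff_id.sub contDiff_const).norm_sq ℝ)
  let F : E3 → E3 := fun y => (a ^ 2 + ‖y - x‖ ^ 2)⁻¹ • (y - x)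
  have hF : ContDiff ℝ ∞ F := (hDs.inv fun y => (hD y).ne').smul (contDiff_id.sub contDiff_const)
  let ψ : Test := mulLeft φ.1 φ.contDiff φ
  have hψ : ∀ y v, fderiv ℝ ψ.1 y v = 2 * φ.1 y * fderiv ℝ φ.1 y v := by
    intro y v
    have : fderiv ℝ ψ.1 y = _ := fderiv_fun_mul (φ.differentiable y) (φ.differentiable y)
    rw [this]
    simp
    ring
  have hdiv : ∀ y, ∑ k, (fderiv ℝ F y (EuclideanSpace.single k 1)) k
      = 3 / (a ^ 2 + ‖y - x‖ ^ 2) - 2 * ‖y - x‖ ^ 2 / (a ^ 2 + ‖y - x‖ ^ 2) ^ 2 := by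
    intro y
    have h1 : HasFDerivAt (fun y : E3 => y - x) (ContinuousLinearMap.id ℝ E3) y :=
      (hasFDerivAt_id y).sub_const x
    have h2 := (h1.norm_sq).const_add (a ^ 2)
    have h3 := (hasDerivAt_inv (hD y).ne').comp_hasFDerivAt y h2
    have h4 : fderiv ℝ F y = _ := (h3.smul h1).fderiv
    rw [h4]
    have h5 : ‖y - x‖ ^ 2 = ∑ k, (y k - x k) ^ 2 := by
      rw [EuclideanSpace.norm_sq_eq]
      simp
    have hD' := (hD y).ne'
    rw [h5] at hD' ⊢
    simp only [Fin.sum_univ_three] at hD' ⊢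
    simp [EuclideanSpace.inner_single_right]
    rw [h5, Fin.sum_univ_three]
    field_simp
    ring
  have hdiv' : ∀ y, 1 / (a ^ 2 + ‖y - x‖ ^ 2)
      ≤ ∑ k, (fderiv ℝ F y (EuclideanSpace.single k 1)) k := by
    intro y
    rw [hdiv, ← sub_nonneg]
    have : 3 / (a ^ 2 + ‖y - x‖ ^ 2) - 2 * ‖y - x‖ ^ 2 / (a ^ 2 + ‖y - x‖ ^ 2) ^ 2
        - 1 / (a ^ 2 + ‖y - x‖ ^ 2) = 2 * a ^ 2 / (a ^ 2 + ‖y - x‖ ^ 2) ^ 2 := by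
      have := (hD y).ne'
      field_simp
      ring
    rw [this]
    positivity
  have hmain := ψ.integral_mul_divergence (hF.of_le (by simp))
  have i0 : Integrable fun y => φ.1 y ^ 2 / (a ^ 2 + ‖y - x‖ ^ 2) := by
    refine (ψ.integrable_mul_continuous (hDs.inv fun y => (hD y).ne').continuous).congr
      (ae_of_all _ fun y => ?_)
    simp only [ψ, mulLeft, Pi.inv_apply]
    field_simp
  have i1 : Integrable fun y => ψ.1 y * ∑ k, (fderiv ℝ F y (EuclideanSpace.single k 1)) k := by
    refine ψ.integrable_mul_continuous (continuous_finsetSum _ fun k _ => ?_)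
    exact (EuclideanSpace.proj k : E3 →L[ℝ] ℝ).continuous.comp
      ((hF.continuous_fderiv (by simp)).clm_apply continuous_const)
  have i2 : Integrable fun y => fderiv ℝ ψ.1 y (F y) := by
    refine Continuous.integrable_of_hasCompactSupport
      (ψ.continuous_fderiv.clm_apply hF.continuous) ?_
    exact (ψ.hasCompactSupport.fderiv (𝕜 := ℝ)).mono fun y hy => by
      contrapose! hy
      simp only [Function.mem_support, not_not] at hy ⊢
      simp [hy]
  have e1 : ∫ y, φ.1 y ^ 2 / (a ^ 2 + ‖y - x‖ ^ 2)
      ≤ ∫ y, ψ.1 y * ∑ k, (fderiv ℝ F y (EuclideanSpace.single k 1)) k := by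
    refine integral_mono i0 i1 fun y => ?_
    have := mul_le_mul_of_nonneg_left (hdiv' y) (sq_nonneg (φ.1 y))
    calc φ.1 y ^ 2 / (a ^ 2 + ‖y - x‖ ^ 2) = φ.1 y ^ 2 * (1 / (a ^ 2 + ‖y - x‖ ^ 2)) := by ring
      _ ≤ _ := this
      _ = _ := by simp only [ψ, mulLeft]; ring
  -- Young's inequality with weights 1/2 and 2: half of the left side is absorbed, which produces
  -- the constant 4.
  have e2 : -∫ y, fderiv ℝ ψ.1 y (F y)
      ≤ ∫ y, (1 / 2 * (φ.1 y ^ 2 / (a ^ 2 + ‖y - x‖ ^ 2)) + 2 * ‖fderiv ℝ φ.1 y‖ ^ 2) := by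
    rw [← integral_neg]
    refine integral_mono i2.neg ((i0.const_mul _).add (φ.integrable_norm_fderiv_sq.const_mul _))
      fun y => ?_
    simp only
    rw [hψ]
    have h1 : |fderiv ℝ φ.1 y (F y)| ≤ ‖fderiv ℝ φ.1 y‖ * ‖F y‖ :=
      (fderiv ℝ φ.1 y).le_opNorm (F y)
    have h2 : ‖F y‖ ^ 2 ≤ (a ^ 2 + ‖y - x‖ ^ 2)⁻¹ := by
      simp only [F, norm_smul, mul_pow, norm_inv, Real.norm_of_nonneg (hD y).le]
      rw [← sub_nonneg]
      have : (a ^ 2 + ‖y - x‖ ^ 2)⁻¹ - (a ^ 2 + ‖y - x‖ ^ 2)⁻¹ ^ 2 * ‖y - x‖ ^ 2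
          = a ^ 2 / (a ^ 2 + ‖y - x‖ ^ 2) ^ 2 := by
        have := (hD y).ne'
        field_simp
        ring
      rw [this]
      positivity
    have h3 : |2 * φ.1 y * fderiv ℝ φ.1 y (F y)| ≤ 2 * (|φ.1 y| * ‖F y‖) * ‖fderiv ℝ φ.1 y‖ := by
      rw [abs_mul, abs_mul, abs_two]
      nlinarith [mul_le_mul_of_nonneg_left h1 (abs_nonneg (φ.1 y))]
    have h4 : (|φ.1 y| * ‖F y‖) ^ 2 ≤ φ.1 y ^ 2 / (a ^ 2 + ‖y - x‖ ^ 2) := by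
      rw [mul_pow, sq_abs, div_eq_mul_inv]
      exact mul_le_mul_of_nonneg_left h2 (sq_nonneg _)
    have h5 := (abs_le.1 h3).1
    nlinarith [sq_nonneg (|φ.1 y| * ‖F y‖ - 2 * ‖fderiv ℝ φ.1 y‖)]
  rw [integral_add (i0.const_mul _) (φ.integrable_norm_fderiv_sq.const_mul _),
    integral_const_mul, integral_const_mul] at e2
  linarith

end Test

/-! ### The Poincaré inequality on balls -/

section Poincare

variable (f : Test) (x : E3) (R : ℝ)

theorem Test.exists_bound_fderiv_sq : ∃ M, ∀ y, ‖fderiv ℝ f.1 y‖ ^ 2 ≤ M := by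
  obtain ⟨M, hM⟩ := f.continuous_fderiv.bounded_above_of_compact_support
    (f.hasCompactSupport.fderiv (𝕜 := ℝ))
  exact ⟨M ^ 2, fun y => pow_le_pow_left₀ (norm_nonneg _) (hM y) 2⟩

theorem Test.exists_bound : ∃ M, ∀ y, |f.1 y| ≤ M :=
  f.continuous.bounded_above_of_compact_support f.hasCompactSupport

theorem sq_intervalIntegral_half_le {g : ℝ → ℝ} (hg : Continuous g) :
    (∫ t in (1 / 2 : ℝ)..1, g t) ^ 2 ≤ 1 / 2 * ∫ t in (1 / 2 : ℝ)..1, g t ^ 2 := by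
  set c := 2 * ∫ t in (1 / 2 : ℝ)..1, g t with hc
  have h : 0 ≤ ∫ t in (1 / 2 : ℝ)..1, (g t - c) ^ 2 :=
    intervalIntegral.integral_nonneg (by norm_num) fun t _ => sq_nonneg _
  have e : ∫ t in (1 / 2 : ℝ)..1, (g t - c) ^ 2
      = (∫ t in (1 / 2 : ℝ)..1, g t ^ 2) - 2 * c * (∫ t in (1 / 2 : ℝ)..1, g t) + c ^ 2 / 2 := by
    have : ∀ t, (g t - c) ^ 2 = g t ^ 2 - 2 * c * g t + c ^ 2 := fun t => by ring
    simp_rw [this]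
    rw [intervalIntegral.integral_add, intervalIntegral.integral_sub,
      intervalIntegral.integral_const_mul, intervalIntegral.integral_const]
    · rw [smul_eq_mul]; ring
    all_goals exact Continuous.intervalIntegrable (by fun_prop) _ _
  rw [e] at h
  nlinarith

/-- Stopping at the midpoint keeps the parameter in `[1/2, 1]`, where the map `y ↦ t y + (1 - t) z`
does not degenerate; integrating up to `z` would let its Jacobian vanish. -/
theorem sq_sub_midpoint_le {y z : E3} {d : ℝ} (hd : ‖y - z‖ ≤ d) :
    (f.1 y - f.1 ((1 / 2 : ℝ) • (y + z))) ^ 2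
      ≤ d ^ 2 / 2 * ∫ t in (1 / 2 : ℝ)..1, ‖fderiv ℝ f.1 (t • y + (1 - t) • z)‖ ^ 2 := by
  have hder : ∀ t : ℝ, HasDerivAt (fun t : ℝ => f.1 (t • y + (1 - t) • z))
      (fderiv ℝ f.1 (t • y + (1 - t) • z) (y - z)) t := by
    intro t
    have h1 : HasDerivAt (fun t : ℝ => t • y + (1 - t) • z) (y - z) t := by
      have h2 : HasDerivAt (fun t : ℝ => t • y + (1 - t) • z) ((1 : ℝ) • y + (-1 : ℝ) • z) t :=
        ((hasDerivAt_id t).smul_const y).add (((hasDerivAt_id t).const_sub 1).smul_const z)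
      rwa [one_smul, neg_one_smul, ← sub_eq_add_neg] at h2
    exact (f.differentiable _).hasFDerivAt.comp_hasDerivAt t h1
  have hseg : Continuous fun t : ℝ => t • y + (1 - t) • z := by fun_prop
  have hcont : Continuous fun t : ℝ => fderiv ℝ f.1 (t • y + (1 - t) • z) (y - z) :=
    (f.continuous_fderiv.comp hseg).clm_apply continuous_const
  have e := intervalIntegral.integral_eq_sub_of_hasDerivAt (a := 1 / 2) (b := 1)
    (fun t _ => hder t) (hcont.intervalIntegrable _ _)
  have e2 : f.1 y - f.1 ((1 / 2 : ℝ) • (y + z))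
      = ∫ t in (1 / 2 : ℝ)..1, fderiv ℝ f.1 (t • y + (1 - t) • z) (y - z) := by
    rw [e]
    congr 2
    · simp
    · rw [smul_add]; norm_num
  rw [e2]
  refine (sq_intervalIntegral_half_le hcont).trans ?_
  have h3 : ∫ t in (1 / 2 : ℝ)..1, (fderiv ℝ f.1 (t • y + (1 - t) • z) (y - z)) ^ 2
      ≤ ∫ t in (1 / 2 : ℝ)..1, d ^ 2 * ‖fderiv ℝ f.1 (t • y + (1 - t) • z)‖ ^ 2 := by
    refine intervalIntegral.integral_mono_on (by norm_num)
      ((hcont.pow 2).intervalIntegrable _ _)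
      (Continuous.intervalIntegrable
        (continuous_const.mul ((f.continuous_fderiv.comp hseg).norm.pow 2)) _ _) fun t _ => ?_
    have h4 := (fderiv ℝ f.1 (t • y + (1 - t) • z)).le_opNorm (y - z)
    have h5 : ‖fderiv ℝ f.1 (t • y + (1 - t) • z) (y - z)‖
        ≤ d * ‖fderiv ℝ f.1 (t • y + (1 - t) • z)‖ := by
      refine h4.trans ?_
      rw [mul_comm]
      exact mul_le_mul_of_nonneg_right hd (norm_nonneg _)
    have h6 := pow_le_pow_left₀ (norm_nonneg _) h5 2
    rwa [mul_pow, Real.norm_eq_abs, sq_abs] at h6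
  rw [intervalIntegral.integral_const_mul] at h3
  linarith

/-- Contraction towards `z` maps the ball into itself by convexity, and the change of variables
costs `t⁻³ ≤ 8`. -/
theorem integral_ball_contract_le {h : E3 → ℝ} (hc : Continuous h) (h0 : ∀ y, 0 ≤ h y)
    {z : E3} (hz : z ∈ Metric.ball x R) {t : ℝ} (ht : 1 / 2 ≤ t) (ht1 : t ≤ 1) :
    ∫ y in Metric.ball x R, h (t • y + (1 - t) • z) ≤ 8 * ∫ y in Metric.ball x R, h y := by
  have hm : MeasurableSet (Metric.ball x R) := measurableSet_ball
  have hi : IntegrableOn h (Metric.ball x R) :=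
    (hc.continuousOn.integrableOn_compact (isCompact_closedBall x R)).mono_set
      Metric.ball_subset_closedBall
  set k := (Metric.ball x R).indicator h with hk
  have hki : Integrable k := hi.integrable_indicator hm
  have hk0 : ∀ y, 0 ≤ k y := fun y => Set.indicator_nonneg (fun y _ => h0 y) y
  have ht0 : t ≠ 0 := by linarith
  have i1 : Integrable fun y => k (t • y + (1 - t) • z) := by
    have := (hki.comp_add_right ((1 - t) • z)).comp_smul ht0
    exact this
  have e : ∫ y, k (t • y + (1 - t) • z) = |(t ^ 3)⁻¹| * ∫ y, k y := by
    have h1 := Measure.integral_comp_smul (volume : Measure E3)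
      (fun y => k (y + (1 - t) • z)) t
    rw [h1, integral_add_right_eq_self]
    simp
  rw [← integral_indicator hm]
  calc ∫ y, (Metric.ball x R).indicator (fun y => h (t • y + (1 - t) • z)) y
      ≤ ∫ y, k (t • y + (1 - t) • z) := by
        refine integral_mono_of_nonneg
          (ae_of_all _ fun y => Set.indicator_nonneg (fun y _ => h0 _) y) i1
          (ae_of_all _ fun y => ?_)
        by_cases hy : y ∈ Metric.ball x R
        · have : t • y + (1 - t) • z ∈ Metric.ball x R :=
            (convex_ball x R) hy hz (by linarith) (by linarith) (by ring)
          simp only [hk, Set.indicator_of_mem hy, Set.indicator_of_mem this, le_refl]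
        · rw [Set.indicator_of_notMem hy]
          exact hk0 _
    _ = |(t ^ 3)⁻¹| * ∫ y, k y := e
    _ ≤ 8 * ∫ y, k y := by
        refine mul_le_mul_of_nonneg_right ?_ (integral_nonneg hk0)
        rw [abs_of_nonneg (by positivity)]
        rw [inv_le_comm₀ (by positivity) (by norm_num)]
        calc (8 : ℝ)⁻¹ = (1 / 2) ^ 3 := by norm_num
          _ ≤ t ^ 3 := by gcongr
    _ = 8 * ∫ y in Metric.ball x R, h y := by rw [hk, integral_indicator hm]

theorem integral_ball_sq_sub_midpoint_le {z : E3} (hz : z ∈ Metric.ball x R) :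
    ∫ y in Metric.ball x R, (f.1 y - f.1 ((1 / 2 : ℝ) • (y + z))) ^ 2
      ≤ 8 * R ^ 2 * ∫ y in Metric.ball x R, ‖fderiv ℝ f.1 y‖ ^ 2 := by
  set μ := (volume : Measure E3).restrict (Metric.ball x R) with hμ
  have hfin : IsFiniteMeasure μ := ⟨by
    rw [hμ, Measure.restrict_apply_univ]; exact measure_ball_lt_top⟩
  obtain ⟨M, hM⟩ := f.exists_bound_fderiv_sq
  obtain ⟨M', hM'⟩ := f.exists_bound
  have hh : Continuous fun y => ‖fderiv ℝ f.1 y‖ ^ 2 := f.continuous_fderiv.norm.pow 2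
  have hcc : Continuous fun p : E3 × ℝ => ‖fderiv ℝ f.1 (p.2 • p.1 + (1 - p.2) • z)‖ ^ 2 :=
    hh.comp (by fun_prop : Continuous fun p : E3 × ℝ => p.2 • p.1 + (1 - p.2) • z)
  have hint : Integrable (fun p : E3 × ℝ => ‖fderiv ℝ f.1 (p.2 • p.1 + (1 - p.2) • z)‖ ^ 2)
      (μ.prod ((volume : Measure ℝ).restrict (Set.Ioc (1 / 2) 1))) :=
    Integrable.of_bound hcc.aestronglyMeasurable M (ae_of_all _ fun p => by
      rw [Real.norm_of_nonneg (by positivity)]; exact hM _)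
  have hx : ∀ y ∈ Metric.ball x R, ‖y - z‖ ≤ 2 * R := by
    intro y hy
    have h1 := dist_triangle_right y z x
    rw [Metric.mem_ball] at hy hz
    rw [← dist_eq_norm]
    linarith
  have hfm : Continuous fun y => f.1 ((1 / 2 : ℝ) • (y + z)) := f.continuous.comp (by fun_prop)
  calc ∫ y, (f.1 y - f.1 ((1 / 2 : ℝ) • (y + z))) ^ 2 ∂μ
      ≤ ∫ y, (2 * R) ^ 2 / 2 * (∫ t in Set.Ioc (1 / 2 : ℝ) 1,
          ‖fderiv ℝ f.1 (t • y + (1 - t) • z)‖ ^ 2) ∂μ := by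
        refine integral_mono_ae ?_ (hint.integral_prod_left.const_mul _) ?_
        · refine Integrable.of_bound ((f.continuous.sub hfm).pow 2).aestronglyMeasurable
            ((M' + M') ^ 2) (ae_of_all _ fun y => ?_)
          rw [norm_pow]
          exact pow_le_pow_left₀ (norm_nonneg _) ((norm_sub_le _ _).trans
            (add_le_add (hM' _) (hM' _))) 2
        · refine (ae_restrict_iff' measurableSet_ball).2 (ae_of_all _ fun y hy => ?_)
          have := sq_sub_midpoint_le f (hx y hy)
          rwa [intervalIntegral.integral_of_le (by norm_num)] at this
    _ = (2 * R) ^ 2 / 2 * ∫ t in Set.Ioc (1 / 2 : ℝ) 1, ∫ y,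
          ‖fderiv ℝ f.1 (t • y + (1 - t) • z)‖ ^ 2 ∂μ := by
        rw [integral_const_mul]
        congr 1
        exact integral_integral_swap
          (f := fun y t => ‖fderiv ℝ f.1 (t • y + (1 - t) • z)‖ ^ 2) hint
    _ ≤ (2 * R) ^ 2 / 2 * ∫ t in Set.Ioc (1 / 2 : ℝ) 1,
          8 * ∫ y, ‖fderiv ℝ f.1 y‖ ^ 2 ∂μ := by
        refine mul_le_mul_of_nonneg_left ?_ (by positivity)
        refine integral_mono_ae hint.integral_prod_right (integrable_const _) ?_
        refine (ae_restrict_iff' measurableSet_Ioc).2 (ae_of_all _ fun t ht => ?_)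
        exact integral_ball_contract_le x R hh (fun y => by positivity) hz ht.1.le ht.2
    _ = 8 * R ^ 2 * ∫ y, ‖fderiv ℝ f.1 y‖ ^ 2 ∂μ := by
        rw [setIntegral_const, Real.volume_real_Ioc_of_le (by norm_num), smul_eq_mul]
        ring

/-- The witness is the mean value, and the integral of `(f y - f z)²` over pairs is `2 |B|` times
the variance. Going through the midpoint, symmetric in the pair, bounds that integral by four times
the one in `integral_ball_sq_sub_midpoint_le`, whence `4 · 8 / 2 = 16`. The other two bounds say
that the mean minimises the quadratic deviation and that Jensen's inequality holds. -/
theorem poincare_ball (hR : 0 < R) :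
    ∃ m : ℝ, (∫ y in Metric.ball x R, (f.1 y - m) ^ 2
        ≤ 16 * R ^ 2 * ∫ y in Metric.ball x R, ‖fderiv ℝ f.1 y‖ ^ 2) ∧
      (∫ y in Metric.ball x R, (f.1 y - m) ^ 2 ≤ ∫ y in Metric.ball x R, f.1 y ^ 2) ∧
      m ^ 2 * volume.real (Metric.ball x R) ≤ ∫ y in Metric.ball x R, f.1 y ^ 2 := by
  set μ := (volume : Measure E3).restrict (Metric.ball x R) with hμ
  have hfin : IsFiniteMeasure μ := ⟨by
    rw [hμ, Measure.restrict_apply_univ]; exact measure_ball_lt_top⟩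
  set b := volume.real (Metric.ball x R) with hb
  have hb0 : 0 < b := ENNReal.toReal_pos (Metric.measure_ball_pos volume x hR).ne'
    measure_ball_lt_top.ne
  have hbμ : μ.real Set.univ = b := by simp [hμ, hb, Measure.real]
  set S₁ := ∫ y, f.1 y ∂μ with hS₁
  set S₂ := ∫ y, f.1 y ^ 2 ∂μ with hS₂
  set D := ∫ y, ‖fderiv ℝ f.1 y‖ ^ 2 ∂μ with hD
  have i1 : Integrable f.1 μ := f.integrable.restrict
  have i2 : Integrable (fun y => f.1 y ^ 2) μ := f.integrable_sq.restrict
  have hvar : ∀ c : ℝ, ∫ y, (f.1 y - c) ^ 2 ∂μ = S₂ - 2 * c * S₁ + c ^ 2 * b := by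
    intro c
    have : ∀ y, (f.1 y - c) ^ 2 = f.1 y ^ 2 - 2 * c * f.1 y + c ^ 2 := fun y => by ring
    simp_rw [this]
    have i3 : Integrable (fun y => f.1 y ^ 2 - 2 * c * f.1 y) μ := i2.sub (i1.const_mul _)
    rw [integral_add i3 (integrable_const _),
      integral_sub i2 (i1.const_mul _), integral_const_mul, integral_const, hbμ, smul_eq_mul]
    ring
  have hdouble : ∫ z, ∫ y, (f.1 y - f.1 z) ^ 2 ∂μ ∂μ = 2 * b * S₂ - 2 * S₁ ^ 2 := by
    simp_rw [hvar]
    have i3 : Integrable (fun z => S₂ - 2 * f.1 z * S₁) μ :=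
      (integrable_const _).sub ((i1.const_mul 2).mul_const _)
    rw [integral_add i3 (i2.mul_const _), integral_sub (integrable_const _)
      ((i1.const_mul 2).mul_const _), integral_mul_const, integral_mul_const, integral_const_mul,
      integral_const, hbμ, smul_eq_mul]
    ring
  obtain ⟨M, hM⟩ := f.exists_bound
  let q : E3 × E3 → ℝ := fun p => (f.1 p.2 - f.1 ((1 / 2 : ℝ) • (p.2 + p.1))) ^ 2
  have hqc : Continuous q := by
    refine Continuous.pow (Continuous.sub (f.continuous.comp continuous_snd)
      (f.continuous.comp ?_)) 2
    fun_prop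
  have hqb : ∀ p, ‖q p‖ ≤ (M + M) ^ 2 := fun p => by
    simp only [q, norm_pow]
    exact pow_le_pow_left₀ (norm_nonneg _) ((norm_sub_le _ _).trans
      (add_le_add (hM _) (hM _))) 2
  have iq : Integrable q (μ.prod μ) :=
    Integrable.of_bound hqc.aestronglyMeasurable _ (ae_of_all _ hqb)
  have iq' : Integrable (fun p => q p.swap) (μ.prod μ) := iq.swap
  have hq : ∫ p, q p ∂(μ.prod μ) ≤ b * (8 * R ^ 2 * D) := by
    rw [integral_prod _ iq]
    calc ∫ z, ∫ y, q (z, y) ∂μ ∂μ ≤ ∫ z, 8 * R ^ 2 * D ∂μ := by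
          refine integral_mono_ae iq.integral_prod_left (integrable_const _) ?_
          refine (ae_restrict_iff' measurableSet_ball).2 (ae_of_all _ fun z hz => ?_)
          exact integral_ball_sq_sub_midpoint_le f x R hz
      _ = b * (8 * R ^ 2 * D) := by rw [integral_const, hbμ, smul_eq_mul]
  have hle : ∫ z, ∫ y, (f.1 y - f.1 z) ^ 2 ∂μ ∂μ ≤ 4 * (b * (8 * R ^ 2 * D)) := by
    let p₀ : E3 × E3 → ℝ := fun p => (f.1 p.2 - f.1 p.1) ^ 2
    have ip : Integrable p₀ (μ.prod μ) := by
      refine Integrable.of_bound (C := (M + M) ^ 2) ?_ (ae_of_all _ fun p => ?_)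
      · exact (((f.continuous.comp continuous_snd).sub
          (f.continuous.comp continuous_fst)).pow 2).aestronglyMeasurable
      · simp only [p₀, norm_pow]
        exact pow_le_pow_left₀ (norm_nonneg _) ((norm_sub_le _ _).trans
          (add_le_add (hM _) (hM _))) 2
    have e0 : ∫ z, ∫ y, (f.1 y - f.1 z) ^ 2 ∂μ ∂μ = ∫ p, p₀ p ∂(μ.prod μ) :=
      (integral_prod _ ip).symm
    rw [e0]
    calc ∫ p, p₀ p ∂(μ.prod μ) ≤ ∫ p, (2 * q p + 2 * q p.swap) ∂(μ.prod μ) := by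
          refine integral_mono ip ((iq.const_mul 2).add (iq'.const_mul 2)) fun p => ?_
          simp only [p₀, q, Prod.fst_swap, Prod.snd_swap]
          rw [add_comm p.1 p.2]
          nlinarith [sq_nonneg (f.1 p.2 + f.1 p.1 - 2 * f.1 ((1 / 2 : ℝ) • (p.2 + p.1)))]
      _ = 4 * ∫ p, q p ∂(μ.prod μ) := by
          rw [integral_add (iq.const_mul 2) (iq'.const_mul 2), integral_const_mul,
            integral_const_mul, integral_prod_swap]
          ring
      _ ≤ _ := by linarith
  refine ⟨S₁ / b, ?_, ?_, ?_⟩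
  · rw [hvar]
    have e : S₂ - 2 * (S₁ / b) * S₁ + (S₁ / b) ^ 2 * b = (2 * b * S₂ - 2 * S₁ ^ 2) / (2 * b) := by
      field_simp
      ring
    rw [e, div_le_iff₀ (by positivity), ← hdouble]
    linarith
  · rw [hvar]
    have e : S₂ - 2 * (S₁ / b) * S₁ + (S₁ / b) ^ 2 * b = S₂ - S₁ ^ 2 / b := by
      field_simp
      ring
    rw [e]
    have : 0 ≤ S₁ ^ 2 / b := by positivity
    linarith
  · have h := hvar (S₁ / b)
    have h0 : 0 ≤ ∫ y, (f.1 y - S₁ / b) ^ 2 ∂μ := integral_nonneg fun y => sq_nonneg _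
    have e : S₂ - 2 * (S₁ / b) * S₁ + (S₁ / b) ^ 2 * b = S₂ - (S₁ / b) ^ 2 * b := by
      field_simp
      ring
    rw [h, e] at h0
    linarith

end Poincare

/-! ### Cutoff functions -/

/-- A smooth profile for cutoff functions of `‖y - x‖² / r²`, with a scale invariant bound for
its derivative. -/
structure IsCutoffProfile (θ : ℝ → ℝ) (A T : ℝ) : Prop where
  contDiff : ContDiff ℝ ∞ θ
  nonneg : ∀ t, 0 ≤ θ t
  le_one : ∀ t, θ t ≤ 1
  eq_one : ∀ t, 0 ≤ t → t ≤ 1 → θ t = 1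
  eq_zero : ∀ t, T ≤ t → θ t = 0
  deriv_le : ∀ t, 0 ≤ t → |deriv θ t| * (2 * (1 + t)) ≤ A

theorem exists_isCutoffProfile {T : ℝ} (hT : 1 < T) : ∃ θ A, IsCutoffProfile θ A T := by
  let θ : ℝ → ℝ := fun t => Real.smoothTransition ((T - t) / (T - 1))
  have hθ : ContDiff ℝ ∞ θ := Real.smoothTransition.contDiff.comp (by fun_prop)
  have h0 : ∀ t, T ≤ t → θ t = 0 := fun t ht =>
    Real.smoothTransition.zero_of_nonpos (div_nonpos_of_nonpos_of_nonneg (by linarith)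
      (by linarith))
  have hc : Continuous fun t => |deriv θ t| * (2 * (1 + t)) :=
    (hθ.continuous_deriv (by simp)).abs.mul (by fun_prop)
  obtain ⟨A, hA⟩ := (isCompact_Icc (a := (0 : ℝ)) (b := T)).bddAbove_image hc.continuousOn
  refine ⟨θ, A, hθ, fun t => Real.smoothTransition.nonneg _, fun t =>
    Real.smoothTransition.le_one _, fun t _ ht =>
    Real.smoothTransition.one_of_one_le ?_, h0, fun t ht => ?_⟩
  · rw [one_le_div (by linarith)]
    linarith
  · rcases le_or_gt t T with h | h
    · exact hA ⟨t, ⟨ht, h⟩, rfl⟩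
    · have : deriv θ t = 0 := by
        have e : θ =ᶠ[𝓝 t] fun _ => 0 := by
          filter_upwards [lt_mem_nhds h] with s hs using h0 s hs.le
        rw [e.deriv_eq]
        simp
      rw [this]
      have h2 := hA ⟨T, ⟨by linarith, le_rfl⟩, rfl⟩
      refine le_trans ?_ h2
      simp only [abs_zero, zero_mul]
      exact mul_nonneg (abs_nonneg _) (by linarith)

/-- Logarithmic profiles have arbitrarily small derivative bounds. -/
theorem exists_isCutoffProfile_small {δ : ℝ} (hδ : 0 < δ) :
    ∃ θ T, 1 < T ∧ IsCutoffProfile θ δ T := by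
  obtain ⟨s, A, hs⟩ := exists_isCutoffProfile (T := 2) (by norm_num)
  have hA : 0 ≤ A := (mul_nonneg (abs_nonneg _) (by norm_num)).trans (hs.deriv_le 0 le_rfl)
  -- A fixed profile `s` is composed with `c log (1 + t²)`. The square keeps this smooth on all of
  -- `ℝ`, `c ≤ 1` keeps its value at most 1 on `[0, 1]`, and the second entry makes the derivative
  -- bound at most `δ`. At `t = exp (2 / c)` the argument has passed 2, where `s` vanishes.
  set c := min 1 (δ / (4 * (A + 1))) with hc
  have hc0 : 0 < c := lt_min one_pos (by positivity)
  have hc1 : c ≤ 1 := min_le_left _ _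
  have hcA : c * (4 * (A + 1)) ≤ δ := by
    rw [← le_div_iff₀ (by positivity)]
    exact min_le_right _ _
  let L : ℝ → ℝ := fun t => c * Real.log (1 + t ^ 2)
  have hpos : ∀ t : ℝ, 0 < 1 + t ^ 2 := fun t => by positivity
  have hL : ContDiff ℝ ∞ L :=
    contDiff_const.mul (ContDiff.log (by fun_prop) fun t => (hpos t).ne')
  have hL0 : ∀ t, 0 ≤ L t := fun t =>
    mul_nonneg hc0.le (Real.log_nonneg (by nlinarith [sq_nonneg t]))
  have hLd : ∀ t, HasDerivAt L (c * (2 * t / (1 + t ^ 2))) t := by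
    intro t
    have h1 : HasDerivAt (fun t : ℝ => 1 + t ^ 2) (2 * t) t := by
      simpa using ((hasDerivAt_id t).pow 2).const_add 1
    exact (h1.log (hpos t).ne').const_mul c
  refine ⟨fun t => s (L t), Real.exp (2 / c), Real.one_lt_exp_iff.2 (by positivity),
    hs.contDiff.comp hL, fun t => hs.nonneg _, fun t => hs.le_one _, fun t h0 h1 =>
    hs.eq_one _ (hL0 t) ?_, fun t ht => hs.eq_zero _ ?_, fun t ht => ?_⟩
  · have h2 : Real.log (1 + t ^ 2) ≤ 1 := by
      have := Real.log_le_sub_one_of_pos (hpos t)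
      nlinarith
    have h3 : 0 ≤ Real.log (1 + t ^ 2) := Real.log_nonneg (by nlinarith [sq_nonneg t])
    calc L t ≤ 1 * 1 := mul_le_mul hc1 h2 h3 (by norm_num)
      _ = 1 := by norm_num
  · have h1 : 1 ≤ Real.exp (2 / c) := Real.one_le_exp (by positivity)
    have h2 : 2 / c ≤ Real.log (1 + t ^ 2) := by
      rw [Real.le_log_iff_exp_le (hpos t)]
      nlinarith
    rw [div_le_iff₀ hc0] at h2
    simp only [L]
    linarith
  · have hd : HasDerivAt (fun t => s (L t)) (deriv s (L t) * (c * (2 * t / (1 + t ^ 2)))) t :=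
      (hs.contDiff.differentiable (by simp) (L t)).hasDerivAt.comp t (hLd t)
    rw [hd.deriv, abs_mul, abs_of_nonneg (by positivity : 0 ≤ c * (2 * t / (1 + t ^ 2)))]
    have h1 : |deriv s (L t)| * 2 ≤ A := by
      refine le_trans ?_ (hs.deriv_le (L t) (hL0 t))
      nlinarith [abs_nonneg (deriv s (L t)), hL0 t, mul_nonneg (abs_nonneg (deriv s (L t))) (hL0 t)]
    have h2 : 2 * t / (1 + t ^ 2) * (2 * (1 + t)) ≤ 8 := by
      rw [div_mul_eq_mul_div, div_le_iff₀ (hpos t)]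
      nlinarith [sq_nonneg (t - 1)]
    calc |deriv s (L t)| * (c * (2 * t / (1 + t ^ 2))) * (2 * (1 + t))
        = |deriv s (L t)| * c * (2 * t / (1 + t ^ 2) * (2 * (1 + t))) := by ring
      _ ≤ |deriv s (L t)| * c * 8 := mul_le_mul_of_nonneg_left h2 (by positivity)
      _ = c * (4 * (|deriv s (L t)| * 2)) := by ring
      _ ≤ c * (4 * (A + 1)) := by gcongr; linarith
      _ ≤ δ := hcA

/-- The radial cutoff function with profile `θ`, centre `x` and radius `r`. -/
def radialCutoff (θ : ℝ → ℝ) (x : E3) (r : ℝ) (y : E3) : ℝ := θ (‖y - x‖ ^ 2 / r ^ 2)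

namespace IsCutoffProfile

variable {θ : ℝ → ℝ} {A T : ℝ} (hθ : IsCutoffProfile θ A T) (x : E3) {r : ℝ} (hr : 0 < r)
include hθ

theorem contDiff_radialCutoff : ContDiff ℝ ∞ (radialCutoff θ x r) :=
  hθ.contDiff.comp (((contDiff_id.sub contDiff_const).norm_sq ℝ).div_const _)

theorem radialCutoff_nonneg (y : E3) : 0 ≤ radialCutoff θ x r y := hθ.nonneg _

theorem radialCutoff_sq_le_one (y : E3) : radialCutoff θ x r y ^ 2 ≤ 1 :=
  pow_le_one₀ (hθ.nonneg _) (hθ.le_one _)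

include hr in
theorem radialCutoff_eq_one {y : E3} (hy : ‖y - x‖ ≤ r) : radialCutoff θ x r y = 1 :=
  hθ.eq_one _ (by positivity) (by rw [div_le_one (by positivity)]; gcongr)

include hr in
theorem radialCutoff_eq_zero {y : E3} (hy : T * r ^ 2 ≤ ‖y - x‖ ^ 2) : radialCutoff θ x r y = 0 :=
  hθ.eq_zero _ (by rwa [le_div_iff₀ (by positivity)])

/-- A zero of a nonnegative function is a minimum. This covers the boundary of the support without a
separate argument. -/
theorem fderiv_radialCutoff_eq_zero {y : E3} (hy : radialCutoff θ x r y = 0) :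
    fderiv ℝ (radialCutoff θ x r) y = 0 := by
  refine IsLocalMin.fderiv_eq_zero (Eventually.of_forall fun z => ?_)
  rw [hy]
  exact hθ.radialCutoff_nonneg x z

include hr in
-- The weight `2 (1 + t)` in `IsCutoffProfile.deriv_le` is chosen so that the squared gradient is
-- dominated by the Hardy weight, with a constant independent of centre and radius.
theorem norm_fderiv_radialCutoff_sq_le (y : E3) :
    ‖fderiv ℝ (radialCutoff θ x r) y‖ ^ 2 ≤ A ^ 2 / (r ^ 2 + ‖y - x‖ ^ 2) := by
  set t := ‖y - x‖ ^ 2 / r ^ 2 with ht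
  have ht0 : 0 ≤ t := by positivity
  have h1 : HasFDerivAt (fun y : E3 => y - x) (ContinuousLinearMap.id ℝ E3) y :=
    (hasFDerivAt_id y).sub_const x
  have h2 := (h1.norm_sq).mul_const (r ^ 2)⁻¹
  simp_rw [← div_eq_mul_inv] at h2
  have h3 : fderiv ℝ (radialCutoff θ x r) y = _ :=
    ((hθ.contDiff.differentiable (by simp) t).hasDerivAt.comp_hasFDerivAt y h2).fderiv
  have hA := hθ.deriv_le t ht0
  have hle : ‖fderiv ℝ (radialCutoff θ x r) y‖ ≤ |deriv θ t| * (2 * ‖y - x‖ / r ^ 2) := by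
    rw [h3]
    refine ContinuousLinearMap.opNorm_le_bound _ (by positivity) fun v => ?_
    simp only [smul_apply, ContinuousLinearMap.comp_apply, ContinuousLinearMap.id_apply,
      innerSL_apply_apply, smul_eq_mul, nsmul_eq_mul, Nat.cast_ofNat, norm_mul, Real.norm_eq_abs]
    rw [mul_assoc]
    refine mul_le_mul_of_nonneg_left ?_ (abs_nonneg _)
    have h4 := abs_real_inner_le_norm (y - x) v
    rw [abs_of_nonneg (by positivity : (0 : ℝ) ≤ (r ^ 2)⁻¹), abs_two]
    calc (r ^ 2)⁻¹ * (2 * |inner ℝ (y - x) v|) ≤ (r ^ 2)⁻¹ * (2 * (‖y - x‖ * ‖v‖)) := by gcongr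
      _ = 2 * ‖y - x‖ / r ^ 2 * ‖v‖ := by ring
  refine (pow_le_pow_left₀ (norm_nonneg _) hle 2).trans ?_
  have h5 : |deriv θ t| * 2 ≤ A / (1 + t) := by
    rw [le_div_iff₀ (by positivity)]
    linarith
  have h6 : (|deriv θ t| * 2) ^ 2 ≤ (A / (1 + t)) ^ 2 := pow_le_pow_left₀ (by positivity) h5 2
  have e1 : r ^ 2 + ‖y - x‖ ^ 2 = r ^ 2 * (1 + t) := by
    rw [ht]; field_simp
  have e2 : ‖y - x‖ ^ 2 = t * r ^ 2 := by
    rw [ht]; field_simp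
  have e3 : (|deriv θ t| * (2 * ‖y - x‖ / r ^ 2)) ^ 2
      = (|deriv θ t| * 2) ^ 2 * (t / r ^ 2) := by
    rw [mul_div_assoc, ← mul_assoc, mul_pow, div_pow, e2]
    field_simp
  rw [e1, e3]
  calc (|deriv θ t| * 2) ^ 2 * (t / r ^ 2) ≤ (A / (1 + t)) ^ 2 * (t / r ^ 2) := by gcongr
    _ = A ^ 2 / (r ^ 2 * (1 + t)) * (t / (1 + t)) := by field_simp
    _ ≤ A ^ 2 / (r ^ 2 * (1 + t)) * 1 := by
        gcongr
        rw [div_le_one (by positivity)]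
        linarith
    _ = _ := mul_one _

end IsCutoffProfile

/-! ### Energies of test functions -/

namespace Test

/-- The energy density of a test function for the operator `-Δ + ξ⁻²`. -/
def energyDensity (ξ : ℝ) (φ : Test) (y : E3) : ℝ :=
  ‖fderiv ℝ φ.1 y‖ ^ 2 + (ξ ^ 2)⁻¹ * φ.1 y ^ 2

theorem energyDensity_nonneg (ξ : ℝ) (φ : Test) (y : E3) : 0 ≤ energyDensity ξ φ y := by
  unfold energyDensity; positivity

theorem integrable_energyDensity (ξ : ℝ) (φ : Test) : Integrable (energyDensity ξ φ) :=
  φ.integrable_norm_fderiv_sq.add (φ.integrable_sq.const_mul _)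

theorem fderiv_mulLeft {η : E3 → ℝ} (hη : ContDiff ℝ ∞ η) (φ : Test) (y : E3) :
    fderiv ℝ (mulLeft η hη φ).1 y = η y • fderiv ℝ φ.1 y + φ.1 y • fderiv ℝ η y :=
  fderiv_fun_mul (hη.differentiable (by simp) y) (φ.differentiable y)

theorem norm_add_sq_le_two {E : Type*} [SeminormedAddCommGroup E] (a b : E) :
    ‖a + b‖ ^ 2 ≤ 2 * ‖a‖ ^ 2 + 2 * ‖b‖ ^ 2 := by
  have h := pow_le_pow_left₀ (norm_nonneg _) (norm_add_le a b) 2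
  nlinarith [sq_nonneg (‖a‖ - ‖b‖)]

theorem integrable_hardy (φ : Test) (x : E3) {r : ℝ} (hr : 0 < r) :
    Integrable fun y => φ.1 y ^ 2 / (r ^ 2 + ‖y - x‖ ^ 2) := by
  refine (φ.integrable_sq.const_mul (r ^ 2)⁻¹).mono' ?_ (ae_of_all _ fun y => ?_)
  · refine Continuous.aestronglyMeasurable ((φ.continuous.pow 2).div (by fun_prop) fun y => ?_)
    positivity
  · rw [Real.norm_of_nonneg (by positivity), div_eq_inv_mul]
    gcongr
    nlinarith [sq_nonneg ‖y - x‖]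

/-- Multiplication by a radial cutoff is bounded for the energy, uniformly in centre, radius and
`ξ`. -/
theorem integral_energyDensity_mulLeft_le {θ : ℝ → ℝ} {A T : ℝ} (hθ : IsCutoffProfile θ A T)
    (x : E3) {r : ℝ} (hr : 0 < r) (ξ : ℝ) (φ : Test) :
    ∫ y, energyDensity ξ (mulLeft (radialCutoff θ x r) (hθ.contDiff_radialCutoff x) φ) y
      ≤ (2 + 8 * A ^ 2) * ∫ y, energyDensity ξ φ y := by
  have hpt : ∀ y, energyDensity ξ
      (mulLeft (radialCutoff θ x r) (hθ.contDiff_radialCutoff x) φ) y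
      ≤ 2 * energyDensity ξ φ y + 2 * A ^ 2 * (φ.1 y ^ 2 / (r ^ 2 + ‖y - x‖ ^ 2)) := by
    intro y
    have h1 := norm_add_sq_le_two (radialCutoff θ x r y • fderiv ℝ φ.1 y)
      (φ.1 y • fderiv ℝ (radialCutoff θ x r) y)
    rw [← fderiv_mulLeft (hθ.contDiff_radialCutoff x) φ y] at h1
    simp only [norm_smul, mul_pow, Real.norm_eq_abs, sq_abs] at h1
    have h2 := hθ.radialCutoff_sq_le_one x (r := r) y
    have h3 := mul_le_mul_of_nonneg_left (hθ.norm_fderiv_radialCutoff_sq_le x hr y)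
      (sq_nonneg (φ.1 y))
    have h4 := mul_le_mul_of_nonneg_right h2 (sq_nonneg ‖fderiv ℝ φ.1 y‖)
    have h5 := mul_le_mul_of_nonneg_right h2 (by positivity : 0 ≤ (ξ ^ 2)⁻¹ * φ.1 y ^ 2)
    have h6 : 0 ≤ (ξ ^ 2)⁻¹ * φ.1 y ^ 2 := by positivity
    have e : φ.1 y ^ 2 * (A ^ 2 / (r ^ 2 + ‖y - x‖ ^ 2))
        = A ^ 2 * (φ.1 y ^ 2 / (r ^ 2 + ‖y - x‖ ^ 2)) := by ring
    rw [e] at h3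
    have e2 : (mulLeft (radialCutoff θ x r) (hθ.contDiff_radialCutoff x) φ).1 y ^ 2
        = radialCutoff θ x r y ^ 2 * φ.1 y ^ 2 := mul_pow _ _ _
    simp only [energyDensity]
    rw [e2]
    linarith
  have hi := integrable_energyDensity ξ φ
  have hh := φ.integrable_hardy x hr
  have h1 := integral_mono (integrable_energyDensity ξ _)
    ((hi.const_mul 2).add (hh.const_mul (2 * A ^ 2))) hpt
  have e := integral_add (hi.const_mul 2) (hh.const_mul (2 * A ^ 2))
  simp only [Pi.add_apply] at h1
  rw [e, integral_const_mul, integral_const_mul] at h1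
  -- Hardy's inequality turns the term with `2 A²` into `8 A²` times the gradient energy.
  have h2 := φ.hardy x hr
  have h3 : ∫ y, ‖fderiv ℝ φ.1 y‖ ^ 2 ≤ ∫ y, energyDensity ξ φ y :=
    integral_mono φ.integrable_norm_fderiv_sq hi fun y =>
      le_add_of_nonneg_right (by positivity)
  nlinarith [mul_le_mul_of_nonneg_left (h2.trans (mul_le_mul_of_nonneg_left h3
    (by norm_num : (0 : ℝ) ≤ 4))) (by positivity : 0 ≤ 2 * A ^ 2)]

end Test

theorem hasCompactSupport_radialCutoff {θ : ℝ → ℝ} {A T : ℝ} (hθ : IsCutoffProfile θ A T)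
    (x : E3) {r : ℝ} (hr : 0 < r) : HasCompactSupport (radialCutoff θ x r) := by
  refine HasCompactSupport.intro (isCompact_closedBall x (Real.sqrt (T * r ^ 2))) fun y hy => ?_
  refine hθ.radialCutoff_eq_zero x hr ?_
  rw [Metric.mem_closedBall, dist_eq_norm, not_le] at hy
  exact (Real.sqrt_le_left (norm_nonneg _)).1 hy.le

/-- A radial cutoff, as a test function. -/
def cutoffTest {θ : ℝ → ℝ} {A T : ℝ} (hθ : IsCutoffProfile θ A T) (x : E3) {r : ℝ} (hr : 0 < r) :
    Test :=
  ⟨radialCutoff θ x r, hθ.contDiff_radialCutoff x, hasCompactSupport_radialCutoff hθ x hr⟩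

theorem volume_real_ball_E3 (x : E3) {R : ℝ} (hR : 0 ≤ R) :
    volume.real (Metric.ball x R) = R ^ 3 * (Real.pi * 4 / 3) := by
  rw [Measure.real, EuclideanSpace.volume_ball_fin_three, ENNReal.toReal_mul, ENNReal.toReal_pow,
    ENNReal.toReal_ofReal hR, ENNReal.toReal_ofReal (by positivity)]

/-! ### The local comparison function -/

/-- Uneven weights keep the main term almost intact: two applications cost `121/100`, which leaves
room below `3/2` for the perturbations. -/
theorem norm_add_sq_le_weighted {E : Type*} [SeminormedAddCommGroup E] (a b : E) :
    ‖a + b‖ ^ 2 ≤ 11 * ‖a‖ ^ 2 + 11 / 10 * ‖b‖ ^ 2 := by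
  have h := pow_le_pow_left₀ (norm_nonneg _) (norm_add_le a b) 2
  nlinarith [sq_nonneg (10 * ‖a‖ - ‖b‖)]

/-- The left side bounds the cost of cutting off the constant `m` in a ball of radius `2 r`: a
capacity part of order `r m²` and a mass part of order `r³ m² / ξ²`. Both are small against `ξ⁻² m²
R³`, which is controlled by the zeroth order energy in the large ball. -/
theorem mul_capacity_le {A ξ r R τ m S : ℝ} (hξ : 0 < ξ) (hr : 0 < r) (hR : 0 < R) (hτ0 : 0 < τ)
    (hτ3 : τ ≤ 1 / 2) (hτ2 : (A ^ 2 + 1) * τ ≤ 1 / 1000) (hrR : r ≤ τ * R)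
    (hrξ : r * ξ ^ 2 ≤ τ * R ^ 3) (hm3 : m ^ 2 * (R ^ 3 * (Real.pi * 4 / 3)) ≤ S) :
    (2 * r) ^ 3 * (Real.pi * 4 / 3) * (11 * m ^ 2 * (A ^ 2 / r ^ 2 + (ξ ^ 2)⁻¹))
      ≤ 1 / 10 * ((ξ ^ 2)⁻¹ * S) := by
  have hpi := Real.pi_pos
  have hS0 : 0 ≤ S := le_trans (by positivity) hm3
  have c1 : r ^ 3 ≤ τ * R ^ 3 := by
    have h3 : r ^ 3 ≤ (τ * R) ^ 3 := pow_le_pow_left₀ hr.le hrR 3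
    have h4 : τ ^ 3 ≤ τ := by
      have : τ ^ 2 ≤ 1 := pow_le_one₀ hτ0.le (by linarith)
      nlinarith
    calc r ^ 3 ≤ τ ^ 3 * R ^ 3 := by rw [← mul_pow]; exact h3
      _ ≤ τ * R ^ 3 := by gcongr
  have c2 : A ^ 2 * r * ξ ^ 2 + r ^ 3 ≤ 1 / 1000 * R ^ 3 := by
    have := mul_le_mul_of_nonneg_left hrξ (sq_nonneg A)
    have h4 : (A ^ 2 + 1) * τ * R ^ 3 ≤ 1 / 1000 * R ^ 3 := by gcongr
    nlinarith
  have c3 : (2 * r) ^ 3 * (Real.pi * 4 / 3) * (11 * m ^ 2 * (A ^ 2 / r ^ 2 + (ξ ^ 2)⁻¹))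
      = 88 * (ξ ^ 2)⁻¹ * (A ^ 2 * r * ξ ^ 2 + r ^ 3) * (m ^ 2 * (Real.pi * 4 / 3)) := by
    field_simp
    ring
  rw [c3]
  calc 88 * (ξ ^ 2)⁻¹ * (A ^ 2 * r * ξ ^ 2 + r ^ 3) * (m ^ 2 * (Real.pi * 4 / 3))
      ≤ 88 * (ξ ^ 2)⁻¹ * (1 / 1000 * R ^ 3) * (m ^ 2 * (Real.pi * 4 / 3)) := by gcongr
    _ = 88 / 1000 * ((ξ ^ 2)⁻¹ * (m ^ 2 * (R ^ 3 * (Real.pi * 4 / 3)))) := by ring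
    _ ≤ 88 / 1000 * ((ξ ^ 2)⁻¹ * S) := by gcongr
    _ ≤ 1 / 10 * ((ξ ^ 2)⁻¹ * S) := mul_le_mul_of_nonneg_right (by norm_num) (by positivity)

namespace Test

/-- The test function `η (ψ - m)` for a radial cutoff `η`. -/
def cutoffSub {θ : ℝ → ℝ} {A T : ℝ} (hθ : IsCutoffProfile θ A T) (x : E3) {r : ℝ} (hr : 0 < r)
    (ψ : Test) (m : ℝ) : Test :=
  mulLeft (radialCutoff θ x r) (hθ.contDiff_radialCutoff x) ψ - m • cutoffTest hθ x hr

section cutoffSub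

variable {θ : ℝ → ℝ} {A T : ℝ} (hθ : IsCutoffProfile θ A T) (x : E3) {r : ℝ} (hr : 0 < r)
    (ψ : Test) (m : ℝ) (y : E3)

theorem cutoffSub_apply : (cutoffSub hθ x hr ψ m).1 y = radialCutoff θ x r y * (ψ.1 y - m) := by
  have : (cutoffSub hθ x hr ψ m).1 y
      = radialCutoff θ x r y * ψ.1 y - m * radialCutoff θ x r y := rfl
  rw [this]
  ring

theorem fderiv_cutoffSub : fderiv ℝ (cutoffSub hθ x hr ψ m).1 y
    = (ψ.1 y - m) • fderiv ℝ (radialCutoff θ x r) y + radialCutoff θ x r y • fderiv ℝ ψ.1 y := by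
  have e : (cutoffSub hθ x hr ψ m).1 = fun y => radialCutoff θ x r y * (ψ.1 y - m) :=
    funext fun y => cutoffSub_apply hθ x hr ψ m y
  rw [e, fderiv_fun_mul ((hθ.contDiff_radialCutoff x).differentiable (by simp) y)
    ((ψ.differentiable y).sub_const m), fderiv_sub_const]
  abel

end cutoffSub

/-- Hardy's inequality for the oscillation of a test function in a ball. -/
theorem integral_hardy_cutoffSub_le {θ : ℝ → ℝ} {A : ℝ} (hθ : IsCutoffProfile θ A 4) (x : E3)
    {r R : ℝ} (hr : 0 < r) (hR : 0 < R) (ψ : Test) {m : ℝ}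
    (hm : ∫ y in Metric.ball x R, (ψ.1 y - m) ^ 2
        ≤ 16 * R ^ 2 * ∫ y in Metric.ball x R, ‖fderiv ℝ ψ.1 y‖ ^ 2) :
    ∫ y, (cutoffSub hθ x (half_pos hR) ψ m).1 y ^ 2 / (r ^ 2 + ‖y - x‖ ^ 2)
      ≤ (8 + 512 * A ^ 2) * ∫ y in Metric.ball x R, ‖fderiv ℝ ψ.1 y‖ ^ 2 := by
  have hB : MeasurableSet (Metric.ball x R) := measurableSet_ball
  set φ := cutoffSub hθ x (half_pos hR) ψ m with hφ
  have hv : IntegrableOn (fun y => (ψ.1 y - m) ^ 2) (Metric.ball x R) :=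
    (((ψ.continuous.sub continuous_const).pow 2).continuousOn.integrableOn_compact
      (isCompact_closedBall x R)).mono_set Metric.ball_subset_closedBall
  have hd := ψ.integrable_norm_fderiv_sq.integrableOn (s := Metric.ball x R)
  have hpt : ∀ y, ‖fderiv ℝ φ.1 y‖ ^ 2 ≤ (Metric.ball x R).indicator
      (fun y => 8 * A ^ 2 / R ^ 2 * (ψ.1 y - m) ^ 2 + 2 * ‖fderiv ℝ ψ.1 y‖ ^ 2) y := by
    intro y
    rw [hφ, fderiv_cutoffSub]
    by_cases hy : y ∈ Metric.ball x R
    · rw [Set.indicator_of_mem hy]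
      refine (norm_add_sq_le_two _ _).trans ?_
      simp only [norm_smul, mul_pow, Real.norm_eq_abs, sq_abs]
      have h1 := hθ.norm_fderiv_radialCutoff_sq_le x (half_pos hR) y
      have h2 : A ^ 2 / ((R / 2) ^ 2 + ‖y - x‖ ^ 2) ≤ 4 * A ^ 2 / R ^ 2 := by
        rw [div_le_div_iff₀ (by positivity) (by positivity)]
        nlinarith [mul_nonneg (sq_nonneg A) (sq_nonneg ‖y - x‖)]
      have h3 := mul_le_mul_of_nonneg_left (h1.trans h2) (sq_nonneg (ψ.1 y - m))
      have h4 := mul_le_mul_of_nonneg_right (hθ.radialCutoff_sq_le_one x (r := R / 2) y)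
        (sq_nonneg ‖fderiv ℝ ψ.1 y‖)
      have e : 8 * A ^ 2 / R ^ 2 * (ψ.1 y - m) ^ 2
          = 2 * ((ψ.1 y - m) ^ 2 * (4 * A ^ 2 / R ^ 2)) := by ring
      rw [e]
      linarith
    · rw [Set.indicator_of_notMem hy]
      rw [Metric.mem_ball, dist_eq_norm, not_lt] at hy
      have h0 : radialCutoff θ x (R / 2) y = 0 := by
        refine hθ.radialCutoff_eq_zero x (half_pos hR) ?_
        calc 4 * (R / 2) ^ 2 = R ^ 2 := by ring
          _ ≤ _ := by gcongr
      rw [h0, hθ.fderiv_radialCutoff_eq_zero x h0]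
      simp
  have hi : IntegrableOn (fun y => 8 * A ^ 2 / R ^ 2 * (ψ.1 y - m) ^ 2
      + 2 * ‖fderiv ℝ ψ.1 y‖ ^ 2) (Metric.ball x R) := (hv.const_mul _).add (hd.const_mul _)
  have h1 := integral_mono φ.integrable_norm_fderiv_sq (hi.integrable_indicator hB) hpt
  rw [integral_indicator hB] at h1
  rw [integral_add (hv.const_mul _) (hd.const_mul _), integral_const_mul,
    integral_const_mul] at h1
  have h2 := φ.hardy x hr
  have h3 := mul_le_mul_of_nonneg_left hm (by positivity : 0 ≤ 8 * A ^ 2 / R ^ 2)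
  have e3 : 8 * A ^ 2 / R ^ 2 * (16 * R ^ 2 * ∫ y in Metric.ball x R, ‖fderiv ℝ ψ.1 y‖ ^ 2)
      = 128 * A ^ 2 * ∫ y in Metric.ball x R, ‖fderiv ℝ ψ.1 y‖ ^ 2 := by
    field_simp
    ring
  rw [e3] at h3
  linarith

set_option maxHeartbeats 800000 in
/-- Inside a small ball, a test function can be extended with almost no more energy than it has
in a large concentric ball. -/
theorem exists_extension_energy_le : ∃ τ : ℝ, 0 < τ ∧ ∀ (ξ r R : ℝ) (x : E3) (ψ : Test), 0 < ξ →
    0 < r → r ≤ τ * R → r * ξ ^ 2 ≤ τ * R ^ 3 → ∃ w : Test,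
      (∀ y ∈ Metric.closedBall x r, w.1 y = ψ.1 y) ∧
      ∫ y, energyDensity ξ w y ≤ 3 / 2 * ∫ y in Metric.ball x R, energyDensity ξ ψ y := by
  obtain ⟨θ₁, A, h₁⟩ := exists_isCutoffProfile (T := 4) (by norm_num)
  set H := 8 + 512 * A ^ 2 with hH
  have hH0 : 0 < H := by positivity
  obtain ⟨θ₂, T, hT, h₂⟩ := exists_isCutoffProfile_small (δ := Real.sqrt (1 / (50 * H)))
    (Real.sqrt_pos.2 (by positivity))
  set δ := Real.sqrt (1 / (50 * H)) with hδ
  have hδH : δ ^ 2 * H = 1 / 50 := by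
    rw [hδ, Real.sq_sqrt (by positivity)]
    field_simp
  -- The first entry places the support of the logarithmic cutoff, of radius at most `√T r`, inside
  -- the ball of radius `R / 2`; the second makes the capacity cost small.
  set τ := min (1 / (2 * T)) (1 / (1000 * (A ^ 2 + 1))) with hτ
  have hτ0 : 0 < τ := lt_min (by positivity) (by positivity)
  have hτ1 : T * τ ≤ 1 / 2 := by
    have : τ ≤ 1 / (2 * T) := min_le_left _ _
    rw [le_div_iff₀ (by positivity)] at this
    linarith
  have hτ2 : (A ^ 2 + 1) * τ ≤ 1 / 1000 := by
    have : τ ≤ 1 / (1000 * (A ^ 2 + 1)) := min_le_right _ _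
    rw [le_div_iff₀ (by positivity)] at this
    linarith
  have hτ3 : τ ≤ 1 / 2 := by nlinarith
  refine ⟨τ, hτ0, fun ξ r R x ψ hξ hr hrR hrξ => ?_⟩
  have hR : 0 < R := by
    by_contra h
    nlinarith
  obtain ⟨m, hm1, hm2, hm3⟩ := poincare_ball ψ x R hR
  have hφ := integral_hardy_cutoffSub_le h₁ x hr hR ψ hm1
  set φ := cutoffSub h₁ x (half_pos hR) ψ m with hφdef
  set B := Metric.ball x R with hBdef
  have hB : MeasurableSet B := measurableSet_ball
  set B₁ := Metric.ball x (2 * r) with hB₁def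
  have hB₁ : MeasurableSet B₁ := measurableSet_ball
  set D := ∫ y in B, ‖fderiv ℝ ψ.1 y‖ ^ 2 with hD
  set S := ∫ y in B, ψ.1 y ^ 2 with hS
  have hD0 : 0 ≤ D := integral_nonneg fun y => by positivity
  have hS0 : 0 ≤ S := integral_nonneg fun y => by positivity
  have hE : ∫ y in B, energyDensity ξ ψ y = D + (ξ ^ 2)⁻¹ * S := by
    have e := integral_add (ψ.integrable_norm_fderiv_sq.integrableOn (s := B))
      ((ψ.integrable_sq.const_mul (ξ ^ 2)⁻¹).integrableOn (s := B))
    rw [integral_const_mul] at e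
    exact e
  -- The mean is cut off at the scale `r`, where its cost is the capacity of the ball; the
  -- oscillation is cut off logarithmically, where Hardy's inequality makes the cost at most a small
  -- multiple of the gradient energy.
  let w : Test := m • cutoffTest h₁ x hr + cutoffSub h₂ x hr ψ m
  have hw : ∀ y, w.1 y = m * radialCutoff θ₁ x r y + radialCutoff θ₂ x r y * (ψ.1 y - m) := by
    intro y
    rw [← cutoffSub_apply h₂ x hr]
    rfl
  have hdw : ∀ y, fderiv ℝ w.1 y = m • fderiv ℝ (radialCutoff θ₁ x r) y
      + ((ψ.1 y - m) • fderiv ℝ (radialCutoff θ₂ x r) y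
        + radialCutoff θ₂ x r y • fderiv ℝ ψ.1 y) := by
    intro y
    rw [← fderiv_cutoffSub h₂ x hr]
    have h3 : fderiv ℝ w.1 y = _ := fderiv_add
      (((h₁.contDiff_radialCutoff x (r := r)).differentiable (by simp) y).const_smul m)
      ((cutoffSub h₂ x hr ψ m).differentiable y)
    have h4 : fderiv ℝ (m • cutoffTest h₁ x hr).1 y = m • fderiv ℝ (radialCutoff θ₁ x r) y :=
      fderiv_const_smul ((h₁.contDiff_radialCutoff x).differentiable (by simp) y) m
    rw [h3, h4]
  refine ⟨w, fun y hy => ?_, ?_⟩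
  · rw [Metric.mem_closedBall, dist_eq_norm] at hy
    rw [hw, h₁.radialCutoff_eq_one x hr hy, h₂.radialCutoff_eq_one x hr hy]
    ring
  have hsmall : ∀ y, ‖y - x‖ ^ 2 < T * r ^ 2 → ‖y - x‖ ≤ R / 2 := by
    intro y hy
    have h3 : T * r ^ 2 ≤ (R / 2) ^ 2 := by
      have h4 : r ^ 2 ≤ (τ * R) ^ 2 := pow_le_pow_left₀ hr.le hrR 2
      have h5 : T * τ ^ 2 ≤ 1 / 4 := by nlinarith
      calc T * r ^ 2 ≤ T * (τ * R) ^ 2 := by gcongr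
        _ = T * τ ^ 2 * R ^ 2 := by ring
        _ ≤ 1 / 4 * R ^ 2 := by gcongr
        _ = (R / 2) ^ 2 := by ring
    exact (lt_of_pow_lt_pow_left₀ 2 (by positivity) (hy.trans_le h3)).le
  have hterm1 : ∀ y, 11 * (m ^ 2 * ‖fderiv ℝ (radialCutoff θ₁ x r) y‖ ^ 2)
      + (ξ ^ 2)⁻¹ * (11 * (m ^ 2 * radialCutoff θ₁ x r y ^ 2))
      ≤ B₁.indicator (fun _ => 11 * m ^ 2 * (A ^ 2 / r ^ 2 + (ξ ^ 2)⁻¹)) y := by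
    intro y
    by_cases hy : y ∈ B₁
    · rw [Set.indicator_of_mem hy]
      have h3 := h₁.norm_fderiv_radialCutoff_sq_le x hr y
      have h4 : A ^ 2 / (r ^ 2 + ‖y - x‖ ^ 2) ≤ A ^ 2 / r ^ 2 := by
        gcongr
        nlinarith [sq_nonneg ‖y - x‖]
      have h5 := mul_le_mul_of_nonneg_left (h3.trans h4) (sq_nonneg m)
      have h6 := mul_le_mul_of_nonneg_left (h₁.radialCutoff_sq_le_one x (r := r) y)
        (by positivity : 0 ≤ (ξ ^ 2)⁻¹ * m ^ 2)
      nlinarith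
    · rw [Set.indicator_of_notMem hy]
      rw [hB₁def, Metric.mem_ball, dist_eq_norm, not_lt] at hy
      have h0 : radialCutoff θ₁ x r y = 0 := by
        refine h₁.radialCutoff_eq_zero x hr ?_
        calc 4 * r ^ 2 = (2 * r) ^ 2 := by ring
          _ ≤ _ := by gcongr
      rw [h0, h₁.fderiv_radialCutoff_eq_zero x h0]
      simp
  -- `φ` agrees with `ψ - m` wherever the logarithmic cutoff is nonzero, but is compactly supported
  -- in space, so that Hardy's inequality applies to it.
  have hterm2 : ∀ y, 121 / 10 * ((ψ.1 y - m) ^ 2 * ‖fderiv ℝ (radialCutoff θ₂ x r) y‖ ^ 2)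
      ≤ 121 / 10 * δ ^ 2 * (φ.1 y ^ 2 / (r ^ 2 + ‖y - x‖ ^ 2)) := by
    intro y
    rcases lt_or_ge (‖y - x‖ ^ 2) (T * r ^ 2) with hy | hy
    · have h3 := mul_le_mul_of_nonneg_left (h₂.norm_fderiv_radialCutoff_sq_le x hr y)
        (sq_nonneg (ψ.1 y - m))
      have e : φ.1 y = ψ.1 y - m := by
        rw [hφdef, cutoffSub_apply, h₁.radialCutoff_eq_one x (half_pos hR) (hsmall y hy), one_mul]
      rw [e]
      have e2 : (ψ.1 y - m) ^ 2 * (δ ^ 2 / (r ^ 2 + ‖y - x‖ ^ 2))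
          = δ ^ 2 * ((ψ.1 y - m) ^ 2 / (r ^ 2 + ‖y - x‖ ^ 2)) := by ring
      linarith
    · rw [h₂.fderiv_radialCutoff_eq_zero x (h₂.radialCutoff_eq_zero x hr hy)]
      simp only [norm_zero, ne_eq, OfNat.ofNat_ne_zero, not_false_eq_true, zero_pow, mul_zero]
      positivity
  have hterm3 : ∀ y, 121 / 100 * (radialCutoff θ₂ x r y ^ 2 * ‖fderiv ℝ ψ.1 y‖ ^ 2)
      + (ξ ^ 2)⁻¹ * (11 / 10 * (radialCutoff θ₂ x r y ^ 2 * (ψ.1 y - m) ^ 2))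
      ≤ B.indicator (fun y => 121 / 100 * ‖fderiv ℝ ψ.1 y‖ ^ 2
        + 11 / 10 * (ξ ^ 2)⁻¹ * (ψ.1 y - m) ^ 2) y := by
    intro y
    by_cases hy : y ∈ B
    · rw [Set.indicator_of_mem hy]
      have h3 := h₂.radialCutoff_sq_le_one x (r := r) y
      have h4 := mul_le_mul_of_nonneg_right h3 (sq_nonneg ‖fderiv ℝ ψ.1 y‖)
      have h5 := mul_le_mul_of_nonneg_right h3
        (by positivity : 0 ≤ (ξ ^ 2)⁻¹ * (ψ.1 y - m) ^ 2)
      linarith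
    · rw [Set.indicator_of_notMem hy]
      rw [hBdef, Metric.mem_ball, dist_eq_norm, not_lt] at hy
      have h0 : radialCutoff θ₂ x r y = 0 := by
        refine h₂.radialCutoff_eq_zero x hr (not_lt.1 fun h => ?_)
        linarith [hsmall y h]
      rw [h0]
      simp
  have hpt : ∀ y, energyDensity ξ w y
      ≤ (B₁.indicator (fun _ => 11 * m ^ 2 * (A ^ 2 / r ^ 2 + (ξ ^ 2)⁻¹)) y
        + 121 / 10 * δ ^ 2 * (φ.1 y ^ 2 / (r ^ 2 + ‖y - x‖ ^ 2)))
        + B.indicator (fun y => 121 / 100 * ‖fderiv ℝ ψ.1 y‖ ^ 2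
          + 11 / 10 * (ξ ^ 2)⁻¹ * (ψ.1 y - m) ^ 2) y := by
    intro y
    have h3 := norm_add_sq_le_weighted (m • fderiv ℝ (radialCutoff θ₁ x r) y)
      ((ψ.1 y - m) • fderiv ℝ (radialCutoff θ₂ x r) y
        + radialCutoff θ₂ x r y • fderiv ℝ ψ.1 y)
    have h4 := norm_add_sq_le_weighted ((ψ.1 y - m) • fderiv ℝ (radialCutoff θ₂ x r) y)
      (radialCutoff θ₂ x r y • fderiv ℝ ψ.1 y)
    have h5 := norm_add_sq_le_weighted (m * radialCutoff θ₁ x r y)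
      (radialCutoff θ₂ x r y * (ψ.1 y - m))
    rw [← hdw] at h3
    rw [← hw] at h5
    simp only [norm_smul, norm_mul, mul_pow, Real.norm_eq_abs, sq_abs] at h3 h4 h5
    have h6 := mul_le_mul_of_nonneg_left h5 (by positivity : 0 ≤ (ξ ^ 2)⁻¹)
    have h7 := hterm1 y
    have h8 := hterm2 y
    have h9 := hterm3 y
    simp only [energyDensity]
    linarith
  have i1 : Integrable (B₁.indicator fun _ => 11 * m ^ 2 * (A ^ 2 / r ^ 2 + (ξ ^ 2)⁻¹)) :=
    (integrableOn_const (C := 11 * m ^ 2 * (A ^ 2 / r ^ 2 + (ξ ^ 2)⁻¹))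
      (measure_ball_lt_top (μ := (volume : Measure E3)) (x := x)
        (r := 2 * r)).ne).integrable_indicator hB₁
  have i2 := (φ.integrable_hardy x hr).const_mul (121 / 10 * δ ^ 2)
  have hv : IntegrableOn (fun y => (ψ.1 y - m) ^ 2) B :=
    (((ψ.continuous.sub continuous_const).pow 2).continuousOn.integrableOn_compact
      (isCompact_closedBall x R)).mono_set Metric.ball_subset_closedBall
  have hd := ψ.integrable_norm_fderiv_sq.integrableOn (s := B)
  have i3 : IntegrableOn (fun y => 121 / 100 * ‖fderiv ℝ ψ.1 y‖ ^ 2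
          + 11 / 10 * (ξ ^ 2)⁻¹ * (ψ.1 y - m) ^ 2) B := (hd.const_mul _).add (hv.const_mul _)
  have i12 : Integrable fun y => (B₁.indicator
      (fun _ => 11 * m ^ 2 * (A ^ 2 / r ^ 2 + (ξ ^ 2)⁻¹)) y
        + 121 / 10 * δ ^ 2 * (φ.1 y ^ 2 / (r ^ 2 + ‖y - x‖ ^ 2))) := i1.add i2
  have hfin := integral_mono (integrable_energyDensity ξ w)
    (i12.add (i3.integrable_indicator hB)) hpt
  have e3 : ∫ y in B, (121 / 100 * ‖fderiv ℝ ψ.1 y‖ ^ 2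
          + 11 / 10 * (ξ ^ 2)⁻¹ * (ψ.1 y - m) ^ 2)
      = 121 / 100 * D + 11 / 10 * (ξ ^ 2)⁻¹ * ∫ y in B, (ψ.1 y - m) ^ 2 := by
    rw [integral_add (hd.const_mul _) (hv.const_mul _), integral_const_mul, integral_const_mul]
  simp only [Pi.add_apply] at hfin
  rw [integral_add i12 (i3.integrable_indicator hB), integral_add i1 i2, integral_indicator hB,
    integral_indicator hB₁, e3, setIntegral_const, integral_const_mul, hB₁def,
    volume_real_ball_E3 x (by positivity), smul_eq_mul] at hfin
  rw [hBdef, volume_real_ball_E3 x hR.le] at hm3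
  rw [hE]
  have b1 := mul_capacity_le hξ hr hR hτ0 hτ3 hτ2 hrR hrξ hm3
  have b2 : 121 / 10 * δ ^ 2 * ∫ y, φ.1 y ^ 2 / (r ^ 2 + ‖y - x‖ ^ 2) ≤ 121 / 500 * D := by
    calc _ ≤ 121 / 10 * δ ^ 2 * (H * D) := by gcongr
      _ = 121 / 10 * (δ ^ 2 * H) * D := by ring
      _ = 121 / 500 * D := by rw [hδH]; ring
  have b3 : 11 / 10 * (ξ ^ 2)⁻¹ * ∫ y in B, (ψ.1 y - m) ^ 2 ≤ 11 / 10 * (ξ ^ 2)⁻¹ * S := by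
    gcongr
  have hS1 : 0 ≤ (ξ ^ 2)⁻¹ * S := by positivity
  -- The totals are `121/100 + 121/500 = 1.452` for the gradient part and `11/10 + 1/10 = 1.2` for
  -- the zeroth order part.
  linarith

end Test

/-! ### The energy space -/

/-- The space `L² × L²` containing the pairs `(u, ∇u)`. -/
abbrev L2Pair : Type := WithLp 2 (Lp ℝ 2 (volume : Measure E3) × Lp E3 2 (volume : Measure E3))

theorem continuous_smul_fst (c : ℝ) :
    Continuous fun w : L2Pair => (WithLp.toLp 2 (c • w.fst, w.snd) : L2Pair) := by
  have h := WithLp.prod_continuous_ofLp 2 (Lp ℝ 2 (volume : Measure E3))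
    (Lp E3 2 (volume : Measure E3))
  have h1 : Continuous fun w : L2Pair => c • w.fst := h.fst.const_smul c
  exact (WithLp.prod_continuous_toLp 2 _ _).comp (h1.prodMk h.snd)

/-- Scaling of the first component of `L² × L²`. -/
def scaleFst (ξ : ℝ) (hξ : 0 < ξ) :
    L2Pair ≃L[ℝ] L2Pair where
  toFun w := WithLp.toLp 2 (ξ⁻¹ • w.fst, w.snd)
  invFun w := WithLp.toLp 2 (ξ • w.fst, w.snd)
  map_add' v w := by
    apply WithLp.ofLp_injective
    exact Prod.ext (smul_add _ _ _) rfl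
  map_smul' c w := by
    apply WithLp.ofLp_injective
    exact Prod.ext (smul_comm _ _ _) rfl
  left_inv w := by
    apply WithLp.ofLp_injective
    exact Prod.ext (smul_inv_smul₀ hξ.ne' _) rfl
  right_inv w := by
    apply WithLp.ofLp_injective
    exact Prod.ext (inv_smul_smul₀ hξ.ne' _) rfl
  continuous_toFun := continuous_smul_fst _
  continuous_invFun := continuous_smul_fst _

/-- `H¹` with the scalar product `H1.form ξ`, realised as a subspace of `L² × L²`. -/
def EnergySpace (ξ : ℝ) (hξ : 0 < ξ) : Type :=
  Submodule.map ((scaleFst ξ hξ : L2Pair →L[ℝ] L2Pair) : L2Pair →ₗ[ℝ] L2Pair) sobolevGraph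

instance (ξ : ℝ) (hξ : 0 < ξ) : NormedAddCommGroup (EnergySpace ξ hξ) :=
  inferInstanceAs (NormedAddCommGroup (Submodule.map
    ((scaleFst ξ hξ : L2Pair →L[ℝ] L2Pair) : L2Pair →ₗ[ℝ] L2Pair) sobolevGraph))

instance (ξ : ℝ) (hξ : 0 < ξ) : InnerProductSpace ℝ (EnergySpace ξ hξ) :=
  inferInstanceAs (InnerProductSpace ℝ (Submodule.map
    ((scaleFst ξ hξ : L2Pair →L[ℝ] L2Pair) : L2Pair →ₗ[ℝ] L2Pair) sobolevGraph))

/-- The identification of `H¹` with the energy space. -/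
def toEnergy (ξ : ℝ) (hξ : 0 < ξ) : H1 ≃L[ℝ] EnergySpace ξ hξ :=
  (scaleFst ξ hξ).submoduleMap sobolevGraph

section Energy

variable {ξ : ℝ} (hξ : 0 < ξ)

instance : CompleteSpace (EnergySpace ξ hξ) :=
  (completeSpace_congr (e := (toEnergy ξ hξ).toEquiv)
    (toEnergy ξ hξ).isUniformEmbedding).1 inferInstance

theorem toEnergy_neg (u : H1) : toEnergy ξ hξ (-u) = -toEnergy ξ hξ u :=
  (toEnergy ξ hξ).map_neg u

theorem toEnergy_sub (u v : H1) :
    toEnergy ξ hξ (u - v) = toEnergy ξ hξ u - toEnergy ξ hξ v :=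
  (toEnergy ξ hξ).map_sub u v

theorem toEnergy_tsum {J : Type*} (u : J → H1) :
    toEnergy ξ hξ (∑' j, u j) = ∑' j, toEnergy ξ hξ (u j) :=
  (toEnergy ξ hξ).map_tsum

theorem hasSum_toEnergy {J : Type*} {u : J → H1} {s : H1} :
    HasSum (fun j => toEnergy ξ hξ (u j)) (toEnergy ξ hξ s) ↔ HasSum u s := by
  rw [(toEnergy ξ hξ).hasSum, ContinuousLinearEquiv.symm_apply_apply]

theorem inner_toEnergy (u v : H1) :
    inner ℝ (toEnergy ξ hξ u) (toEnergy ξ hξ v) = H1.form ξ u v := by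
  have h : inner ℝ (toEnergy ξ hξ u) (toEnergy ξ hξ v)
      = inner ℝ (ξ⁻¹ • u.val) (ξ⁻¹ • v.val) + inner ℝ u.grad v.grad := WithLp.prod_inner_apply _ _
  rw [h, H1.form, real_inner_smul_left, real_inner_smul_right]
  field_simp
  ring

theorem norm_toEnergy_sq (u : H1) :
    ‖toEnergy ξ hξ u‖ ^ 2 = ‖u.grad‖ ^ 2 + (ξ ^ 2)⁻¹ * ‖u.val‖ ^ 2 := by
  rw [← real_inner_self_eq_norm_sq, inner_toEnergy, H1.form, real_inner_self_eq_norm_sq,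
    real_inner_self_eq_norm_sq]

theorem H1.norm_sq (u : H1) : ‖u‖ ^ 2 = ‖u.val‖ ^ 2 + ‖u.grad‖ ^ 2 := by
  have h : inner ℝ u u = inner ℝ u.val u.val + inner ℝ u.grad u.grad := WithLp.prod_inner_apply _ _
  rw [← real_inner_self_eq_norm_sq, h, real_inner_self_eq_norm_sq, real_inner_self_eq_norm_sq]

theorem norm_le_mul_norm_toEnergy (u : H1) : ‖u‖ ≤ (1 + ξ) * ‖toEnergy ξ hξ u‖ := by
  refine le_of_sq_le_sq ?_ (by positivity)
  rw [mul_pow, norm_toEnergy_sq, H1.norm_sq]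
  have e : (1 + ξ) ^ 2 * (‖u.grad‖ ^ 2 + (ξ ^ 2)⁻¹ * ‖u.val‖ ^ 2) = ‖u.val‖ ^ 2 + ‖u.grad‖ ^ 2
      + ((2 * ξ + ξ ^ 2) * ‖u.grad‖ ^ 2 + (1 + 2 * ξ) * ((ξ ^ 2)⁻¹ * ‖u.val‖ ^ 2)) := by
    field_simp
    ring
  rw [e]
  have : 0 ≤ (2 * ξ + ξ ^ 2) * ‖u.grad‖ ^ 2 + (1 + 2 * ξ) * ((ξ ^ 2)⁻¹ * ‖u.val‖ ^ 2) := by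
    positivity
  linarith

theorem H1.normOn_le_norm (U : Set E3) (u : H1) : H1.normOn U u ≤ ‖u‖ := by
  have h1 : Integrable fun y => (u.val y) ^ 2 := (Lp.memLp u.val).integrable_sq
  have h2 : Integrable fun y => ‖u.grad y‖ ^ 2 :=
    (Lp.memLp u.grad).integrable_norm_pow (by norm_num)
  refine Real.sqrt_le_iff.2 ⟨norm_nonneg _, ?_⟩
  refine (setIntegral_le_integral (h1.add h2) (ae_of_all _ fun y => by
    simp only [Pi.zero_apply, Pi.add_apply]; positivity)).trans ?_
  simp only [Pi.add_apply]
  rw [integral_add h1 h2, H1.norm_sq, ← real_inner_self_eq_norm_sq, ← real_inner_self_eq_norm_sq,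
    L2.inner_def, L2.inner_def]
  refine le_of_eq ?_
  congr 2
  · ext y
    simp [sq]
  · ext y
    rw [real_inner_self_eq_norm_sq]

theorem norm_toEnergy_ofTest_sq (φ : Test) :
    ‖toEnergy ξ hξ (H1.ofTest φ)‖ ^ 2 = ∫ y, Test.energyDensity ξ φ y := by
  rw [← real_inner_self_eq_norm_sq, inner_toEnergy, H1.form_ofTest]
  congr 1
  ext y
  rw [real_inner_self_eq_norm_sq, Test.norm_gradient, Test.energyDensity, sq (φ.1 y)]

theorem dense_toEnergy_ofTest : Dense (Set.range fun φ => toEnergy ξ hξ (H1.ofTest φ)) := by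
  have h := (toEnergy ξ hξ).surjective.denseRange.comp (f := H1.ofTest) H1.dense_range_ofTest
    (toEnergy ξ hξ).continuous
  exact h

/-- The functions vanishing on a set, as a subspace of the energy space. -/
def energyZero (A : Set E3) : Submodule ℝ (EnergySpace ξ hξ) :=
  (H1.zeroSubmodule A).comap
    (((toEnergy ξ hξ).symm : EnergySpace ξ hξ →L[ℝ] H1) : EnergySpace ξ hξ →ₗ[ℝ] H1)

theorem isClosed_energyZero (A : Set E3) :
    IsClosed (energyZero hξ A : Set (EnergySpace ξ hξ)) :=
  (H1.isClosed_zeroSubmodule A).preimage (toEnergy ξ hξ).symm.continuous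

instance (A : Set E3) : CompleteSpace (energyZero hξ A) :=
  (isClosed_energyZero hξ A).completeSpace_coe

theorem toEnergy_mem {A : Set E3} {u : H1} :
    toEnergy ξ hξ u ∈ energyZero hξ A ↔ u ∈ H1.zeroOn A := by
  rw [← H1.coe_zeroSubmodule]
  simp [energyZero]

theorem energyZero_anti {A B : Set E3} (h : A ⊆ B) : energyZero hξ B ≤ energyZero hξ A :=
  Submodule.comap_mono (H1.zeroSubmodule_anti h)

/-- The two conditions on `w` say that `h - w` lies in the space of functions vanishing in `A` and
`w` in its orthogonal complement, which characterises the orthogonal projection onto the latter. -/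
theorem isExteriorSolution_iff {A : Set E3} {h w : H1} : IsExteriorSolution ξ A h w ↔
    toEnergy ξ hξ w = (energyZero hξ A)ᗮ.starProjection (toEnergy ξ hξ h) := by
  have horth : (∀ v ∈ H1.zeroOn A, H1.form ξ w v = 0) ↔
      toEnergy ξ hξ w ∈ (energyZero hξ A)ᗮ := by
    rw [Submodule.mem_orthogonal']
    constructor
    · intro H v hv
      obtain ⟨v, rfl⟩ := (toEnergy ξ hξ).surjective v
      rw [inner_toEnergy]
      exact H v ((toEnergy_mem hξ).1 hv)
    · intro H v hv
      rw [← inner_toEnergy hξ]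
      exact H _ ((toEnergy_mem hξ).2 hv)
  rw [IsExteriorSolution, horth, ← toEnergy_mem hξ, toEnergy_sub]
  constructor
  · rintro ⟨h1, h2⟩
    refine (Submodule.eq_starProjection_of_mem_orthogonal h2 ?_).symm
    refine Submodule.le_orthogonal_orthogonal _ ?_
    rw [← neg_sub]
    exact Submodule.neg_mem _ h1
  · intro H
    refine ⟨?_, H ▸ Submodule.starProjection_apply_mem _ _⟩
    have h1 := Submodule.sub_starProjection_mem_orthogonal (K := (energyZero hξ A)ᗮ)
      (toEnergy ξ hξ h)
    rw [Submodule.orthogonal_orthogonal, ← H] at h1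
    rw [← neg_sub]
    exact Submodule.neg_mem _ h1

/-- The Riesz representative of a functional in the energy space. -/
def energyRiesz (f : Hneg1) : EnergySpace ξ hξ :=
  (InnerProductSpace.toDual ℝ (EnergySpace ξ hξ)).symm
    (f.comp ((toEnergy ξ hξ).symm : EnergySpace ξ hξ →L[ℝ] H1))

theorem inner_energyRiesz (f : Hneg1) (v : H1) :
    inner ℝ (energyRiesz hξ f) (toEnergy ξ hξ v) = f v := by
  rw [energyRiesz, InnerProductSpace.toDual_symm_apply]
  simp

theorem norm_energyRiesz_le (f : Hneg1) : ‖energyRiesz hξ f‖ ≤ (1 + ξ) * ‖f‖ := by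
  rw [energyRiesz, LinearIsometryEquiv.norm_map]
  refine ContinuousLinearMap.opNorm_le_bound _ (by positivity) fun v => ?_
  obtain ⟨v, rfl⟩ := (toEnergy ξ hξ).surjective v
  have h1 := f.le_opNorm v
  have h2 := norm_le_mul_norm_toEnergy hξ v
  simp only [ContinuousLinearMap.comp_apply, ContinuousLinearEquiv.coe_coe,
    ContinuousLinearEquiv.symm_apply_apply]
  calc ‖f v‖ ≤ ‖f‖ * ‖v‖ := h1
    _ ≤ ‖f‖ * ((1 + ξ) * ‖toEnergy ξ hξ v‖) := by gcongr
    _ = _ := by ring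

theorem forall_form_eq_iff {f : Hneg1} {u : H1} :
    (∀ v, H1.form ξ u v = f v) ↔ toEnergy ξ hξ u = energyRiesz hξ f := by
  constructor
  · intro H
    refine ext_inner_right ℝ fun v => ?_
    obtain ⟨v, rfl⟩ := (toEnergy ξ hξ).surjective v
    rw [inner_toEnergy, inner_energyRiesz, H]
  · intro H v
    rw [← inner_toEnergy hξ, H, inner_energyRiesz]

/-- The vector being projected is the Riesz representative of `f`, which is also `Φ 0`; hence the
initial error `Φ 0 - u` is orthogonal to the functions vanishing in `A`. -/
theorem isDirichletSolution_iff {A : Set E3} {f : Hneg1} {u : H1} : IsDirichletSolution ξ A f u ↔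
    toEnergy ξ hξ u = (energyZero hξ A).starProjection (energyRiesz hξ f) := by
  rw [IsDirichletSolution, ← toEnergy_mem hξ]
  constructor
  · rintro ⟨h1, h2⟩
    refine (Submodule.eq_starProjection_of_mem_of_inner_eq_zero h1 fun v hv => ?_).symm
    obtain ⟨v, rfl⟩ := (toEnergy ξ hξ).surjective v
    rw [inner_sub_left, inner_energyRiesz, inner_toEnergy, h2 v ((toEnergy_mem hξ).1 hv), sub_self]
  · intro H
    refine ⟨H ▸ Submodule.starProjection_apply_mem _ _, fun v hv => ?_⟩
    have h1 := Submodule.starProjection_inner_eq_zero (K := energyZero hξ A)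
      (energyRiesz hξ f) (toEnergy ξ hξ v) ((toEnergy_mem hξ).2 hv)
    rw [inner_sub_left, ← H, inner_energyRiesz, inner_toEnergy] at h1
    linarith

theorem isMethodOfReflections_iff {I : Type} {x : I → E3} {r : I → ℝ} {f : Hneg1} {Φ : ℕ → H1}
    {φ : ℕ → I → H1} : IsMethodOfReflections ξ x r f Φ φ ↔
      toEnergy ξ hξ (Φ 0) = energyRiesz hξ f ∧
      (∀ i, toEnergy ξ hξ (φ 0 i) = (energyZero hξ (Metric.closedBall (x i) (r i)))ᗮ.starProjection
        (-toEnergy ξ hξ (Φ 0))) ∧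
      (∀ k i, toEnergy ξ hξ (φ (k + 1) i)
        = (energyZero hξ (Metric.closedBall (x i) (r i)))ᗮ.starProjection
          (-∑' j : {j : I // j ≠ i}, toEnergy ξ hξ (φ k j))) ∧
      (∀ k, HasSum (fun i => toEnergy ξ hξ (φ k i)) (toEnergy ξ hξ (Φ (k + 1)))) := by
  constructor
  · rintro ⟨h0, h1, h2, h3⟩
    refine ⟨(forall_form_eq_iff hξ).1 h0, fun i => ?_, fun k i => ?_, fun k => ?_⟩
    · rw [(isExteriorSolution_iff hξ).1 (h1 i), toEnergy_neg]
    · rw [(isExteriorSolution_iff hξ).1 (h2 k i), toEnergy_neg, toEnergy_tsum]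
    · exact (hasSum_toEnergy hξ).2 (h3 k)
  · rintro ⟨h0, h1, h2, h3⟩
    refine ⟨(forall_form_eq_iff hξ).2 h0, fun i => ?_, fun k i => ?_, fun k => ?_⟩
    · rw [isExteriorSolution_iff hξ, h1 i, toEnergy_neg]
    · rw [isExteriorSolution_iff hξ, h2 k i, toEnergy_neg, toEnergy_tsum]
    · exact (hasSum_toEnergy hξ).1 (h3 k)

end Energy

/-! ### Geometry of the particles -/

section Geometry

variable {I : Type} {x : I → E3} {r : I → ℝ}

theorem two_mul_lt_dist_of_lt_nearestDist {κ : ℝ} {i j : I}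
    (h : ENNReal.ofReal (κ * r i) < nearestDist x i / 2) (hij : i ≠ j) :
    2 * (κ * r i) < dist (x i) (x j) := by
  have h1 : nearestDist x i ≤ edist (x i) (x j) := iInf₂_le j hij.symm
  have h2 : ENNReal.ofReal (κ * r i) < ENNReal.ofReal (dist (x i) (x j) / 2) := by
    refine h.trans_le ?_
    rw [ENNReal.ofReal_div_of_pos two_pos, ← edist_dist]
    simpa using ENNReal.div_le_div_right h1 2
  have h3 := ENNReal.ofReal_lt_ofReal_iff'.1 h2
  linarith [h3.1]

/-- Closedness of the union makes a separated family of particles locally finite. -/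
theorem finite_setOf_mem_closedBall (hK : IsClosed (particles x r)) (hr : ∀ i, 0 < r i)
    (hsep : ∀ i j, i ≠ j → 2 * r i < dist (x i) (x j)) (z : E3) (R : ℝ) :
    {i | x i ∈ Metric.closedBall z R}.Finite := by
  by_contra hinf
  have hinj : Function.Injective x := by
    intro i j hij
    by_contra hne
    have := hsep i j hne
    rw [hij, dist_self] at this
    linarith [hr i]
  have hinf' : (x '' {i | x i ∈ Metric.closedBall z R}).Infinite :=
    Set.Infinite.image hinj.injOn hinf
  obtain ⟨p, -, hp⟩ := hinf'.exists_accPt_of_subset_isCompact (isCompact_closedBall z R) (by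
    rintro _ ⟨i, hi, rfl⟩
    exact hi)
  rw [accPt_iff_frequently] at hp
  -- The centres accumulate at `p`, and closedness puts `p` into some ball `j`. A centre other than
  -- `x j` close to `p` is then nearer than `2 r j` to `x j`, against the separation.
  have hpK : p ∈ particles x r := by
    rw [← hK.closure_eq, mem_closure_iff_frequently]
    refine hp.mono ?_
    rintro y ⟨-, i, -, rfl⟩
    exact Set.mem_iUnion.2 ⟨i, Metric.mem_closedBall_self (hr i).le⟩
  obtain ⟨j, hj⟩ := Set.mem_iUnion.1 hpK
  rw [Metric.mem_closedBall] at hj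
  have hev : ∀ᶠ y in 𝓝 p, dist y p < r j ∧ (p ≠ x j → y ≠ x j) := by
    refine Filter.Eventually.and (Metric.ball_mem_nhds p (hr j)) ?_
    by_cases h : p = x j
    · exact Eventually.of_forall fun y hy => absurd h hy
    · filter_upwards [isOpen_ne.mem_nhds h] with y hy _ using hy
  obtain ⟨y, ⟨hyp, i, -, rfl⟩, hd, hne⟩ := (hp.and_eventually hev).exists
  have hij : j ≠ i := by
    rintro rfl
    by_cases h : p = x j
    · exact hyp h.symm
    · exact hne h rfl
  have h1 := hsep j i hij
  have h2 := dist_triangle (x j) p (x i)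
  rw [dist_comm p (x j)] at hj
  rw [dist_comm] at hd
  linarith

/-- Disjoint large balls around the particles, provided by the capacity bound. -/
theorem exists_disjoint_radii {ξ α κ τ : ℝ} (hξ : 0 < ξ) (hα : 0 < α) (hτ : 0 < τ)
    (hr : ∀ i, 0 < r i) (hd : ∀ i, ENNReal.ofReal (κ * r i) < nearestDist x i / 2)
    (hα' : ∀ i, r i ≤ α * ξ)
    (hμ : capacityBound x r
      < ENNReal.ofReal (min (τ / 8) (τ ^ 3 / (8 * α ^ 2)) * (ξ ^ 2)⁻¹)) :
    ∃ R : I → ℝ, (∀ i, r i ≤ τ * R i) ∧ (∀ i, r i * ξ ^ 2 ≤ τ * R i ^ 3) ∧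
      ∀ i j, i ≠ j → R i + R j ≤ dist (x i) (x j) := by
  -- With radius `d / 2`, the first entry gives `r ξ² ≤ τ (d / 2)³` directly. The second gives `r³ ≤
  -- r (α ξ)² ≤ C₀ α² d³ ≤ (τ d / 2)³`, which is where `r ≤ α ξ` enters.
  set C₀ := min (τ / 8) (τ ^ 3 / (8 * α ^ 2)) with hC₀
  have hC1 : C₀ ≤ τ / 8 := min_le_left _ _
  have hC2 : C₀ * (8 * α ^ 2) ≤ τ ^ 3 := by
    rw [← le_div_iff₀ (by positivity)]
    exact min_le_right _ _
  have hexists : ∀ i, ∃ Ri : ℝ, r i ≤ τ * Ri ∧ r i * ξ ^ 2 ≤ τ * Ri ^ 3 ∧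
      ∀ j, i ≠ j → 2 * Ri ≤ dist (x i) (x j) := by
    intro i
    by_cases htop : nearestDist x i = ⊤
    -- There is no other particle, so any sufficiently large radius will do.
    · refine ⟨max 1 (max (r i / τ) (r i * ξ ^ 2 / τ)), ?_, ?_, fun j hij => ?_⟩
      · rw [← div_le_iff₀' hτ]
        exact (le_max_left _ _).trans (le_max_right _ _)
      · set m := max 1 (max (r i / τ) (r i * ξ ^ 2 / τ)) with hm
        have h1 : 1 ≤ m := le_max_left _ _
        have h2 : r i * ξ ^ 2 / τ ≤ m := (le_max_right _ _).trans (le_max_right _ _)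
        rw [← div_le_iff₀' hτ]
        exact h2.trans (le_self_pow₀ h1 (by norm_num))
      · have h1 : nearestDist x i ≤ edist (x i) (x j) := iInf₂_le j hij.symm
        rw [htop, top_le_iff] at h1
        exact absurd h1 (edist_ne_top _ _)
    · set d := (nearestDist x i).toReal with hdd
      have hdE : nearestDist x i = ENNReal.ofReal d := (ENNReal.ofReal_toReal htop).symm
      have hd0 : 0 < d := by
        refine ENNReal.toReal_pos (fun h0 => ?_) htop
        have := hd i
        rw [h0] at this
        simp at this
      have hcap : ENNReal.ofReal (r i / d ^ 3) < ENNReal.ofReal (C₀ * (ξ ^ 2)⁻¹) := by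
        refine lt_of_le_of_lt ?_ hμ
        rw [ENNReal.ofReal_div_of_pos (by positivity), ENNReal.ofReal_pow hd0.le, ← hdE]
        exact le_iSup (fun i => ENNReal.ofReal (r i) / nearestDist x i ^ 3) i
      have hcap' := (ENNReal.ofReal_lt_ofReal_iff'.1 hcap).1
      rw [div_lt_iff₀ (by positivity)] at hcap'
      have hξ2 : 0 < ξ ^ 2 := by positivity
      have hcap2 : r i * ξ ^ 2 ≤ C₀ * d ^ 3 := by
        have h1 := mul_le_mul_of_nonneg_right hcap'.le hξ2.le
        have e : C₀ * (ξ ^ 2)⁻¹ * d ^ 3 * ξ ^ 2 = C₀ * d ^ 3 := by field_simp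
        rwa [e] at h1
      refine ⟨d / 2, ?_, ?_, fun j hij => ?_⟩
      · have h1 : r i ^ 2 ≤ (α * ξ) ^ 2 := pow_le_pow_left₀ (hr i).le (hα' i) 2
        have h2 : r i ^ 3 ≤ (τ * (d / 2)) ^ 3 := by
          calc r i ^ 3 = r i * r i ^ 2 := by ring
            _ ≤ r i * (α * ξ) ^ 2 := mul_le_mul_of_nonneg_left h1 (hr i).le
            _ = r i * ξ ^ 2 * α ^ 2 := by ring
            _ ≤ C₀ * d ^ 3 * α ^ 2 := by gcongr
            _ = C₀ * (8 * α ^ 2) * (d ^ 3 / 8) := by ring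
            _ ≤ τ ^ 3 * (d ^ 3 / 8) := by gcongr
            _ = (τ * (d / 2)) ^ 3 := by ring
        exact le_of_pow_le_pow_left₀ (by norm_num) (by positivity) h2
      · calc r i * ξ ^ 2 ≤ C₀ * d ^ 3 := hcap2
          _ ≤ τ / 8 * d ^ 3 := by gcongr
          _ = τ * (d / 2) ^ 3 := by ring
      · have h1 : nearestDist x i ≤ edist (x i) (x j) := iInf₂_le j hij.symm
        rw [hdE, edist_dist] at h1
        have := (ENNReal.ofReal_le_ofReal_iff dist_nonneg).1 h1
        linarith
  choose R h1 h2 h3 using hexists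
  refine ⟨R, h1, h2, fun i j hij => ?_⟩
  have h4 := h3 i j hij
  have h5 := h3 j i hij.symm
  rw [dist_comm] at h5
  linarith

end Geometry

/-! ### Bounds for the sum of the projections -/

section Bounds

variable {ξ : ℝ} (hξ : 0 < ξ)

/-- The projection sees only the values on `A`. Since projections do not increase the norm, the
energy of any competitor with these values bounds that of the projection. -/
theorem starProjection_orthogonal_congr {A : Set E3} {φ ψ : Test} (h : ∀ y ∈ A, φ.1 y = ψ.1 y) :
    (energyZero hξ A)ᗮ.starProjection (toEnergy ξ hξ (H1.ofTest φ))
      = (energyZero hξ A)ᗮ.starProjection (toEnergy ξ hξ (H1.ofTest ψ)) := by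
  rw [← sub_eq_zero, ← ContinuousLinearMap.map_sub, ← toEnergy_sub, ← H1.ofTest.map_sub]
  rw [Submodule.starProjection_apply_eq_zero_iff, Submodule.orthogonal_orthogonal,
    toEnergy_mem, ← H1.coe_zeroSubmodule]
  refine H1.ofTest_mem_zeroSubmodule fun y hy => ?_
  have : (φ - ψ).1 y = φ.1 y - ψ.1 y := rfl
  rw [this, h y hy, sub_self]

/-- The upper bound for the sum of the projections. -/
theorem sum_norm_starProjection_sq_le {I : Type} {x : I → E3} {r R : I → ℝ}
    (hdisj : ∀ i j, i ≠ j → R i + R j ≤ dist (x i) (x j))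
    (hext : ∀ i (ψ : Test), ∃ w : Test, (∀ y ∈ Metric.closedBall (x i) (r i), w.1 y = ψ.1 y) ∧
      ∫ y, Test.energyDensity ξ w y
        ≤ 3 / 2 * ∫ y in Metric.ball (x i) (R i), Test.energyDensity ξ ψ y)
    (F : Finset I) (u : EnergySpace ξ hξ) :
    ∑ i ∈ F, ‖(energyZero hξ (Metric.closedBall (x i) (r i)))ᗮ.starProjection u‖ ^ 2
      ≤ 3 / 2 * ‖u‖ ^ 2 := by
  have hcl : IsClosed {u : EnergySpace ξ hξ |
      ∑ i ∈ F, ‖(energyZero hξ (Metric.closedBall (x i) (r i)))ᗮ.starProjection u‖ ^ 2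
        ≤ 3 / 2 * ‖u‖ ^ 2} :=
    isClosed_le (continuous_finsetSum _ fun i _ =>
      (ContinuousLinearMap.continuous _).norm.pow 2) (by fun_prop)
  refine hcl.closure_subset_iff.2 ?_ (dense_toEnergy_ofTest hξ u)
  rintro _ ⟨ψ, rfl⟩
  simp only [Set.mem_ofPred_eq]
  have hi : ∀ i ∈ F, ‖(energyZero hξ (Metric.closedBall (x i) (r i)))ᗮ.starProjection
      (toEnergy ξ hξ (H1.ofTest ψ))‖ ^ 2
      ≤ 3 / 2 * ∫ y in Metric.ball (x i) (R i), Test.energyDensity ξ ψ y := by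
    intro i _
    obtain ⟨w, hw, hE⟩ := hext i ψ
    rw [← starProjection_orthogonal_congr hξ hw]
    refine le_trans ?_ hE
    rw [← norm_toEnergy_ofTest_sq hξ]
    exact pow_le_pow_left₀ (norm_nonneg _) (Submodule.norm_starProjection_apply_le _ _) 2
  refine (Finset.sum_le_sum hi).trans ?_
  rw [← Finset.mul_sum, norm_toEnergy_ofTest_sq]
  refine mul_le_mul_of_nonneg_left ?_ (by norm_num)
  have hint := Test.integrable_energyDensity ξ ψ
  rw [← integral_biUnion_finset F (fun i _ => measurableSet_ball) ?_
    (fun i _ => hint.integrableOn)]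
  · exact setIntegral_le_integral hint (ae_of_all _ fun y => Test.energyDensity_nonneg ξ ψ y)
  · intro i _ j _ hij
    exact Metric.ball_disjoint_ball (hdisj i j hij)

theorem norm_sum_sq_of_pairwise_orthogonal {V I : Type*} [NormedAddCommGroup V]
    [InnerProductSpace ℝ V] (F : Finset I) (v : I → V)
    (h : ∀ i ∈ F, ∀ j ∈ F, i ≠ j → inner ℝ (v i) (v j) = 0) :
    ‖∑ i ∈ F, v i‖ ^ 2 = ∑ i ∈ F, ‖v i‖ ^ 2 := by
  rw [← real_inner_self_eq_norm_sq, sum_inner]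
  refine Finset.sum_congr rfl fun i hi => ?_
  rw [inner_sum, Finset.sum_eq_single i (fun j hj hji => h i hi j hj hji.symm)
    (fun h0 => absurd hi h0), real_inner_self_eq_norm_sq]

/-- Approximation of an exterior projection by test functions with the same values on the set. -/
theorem exists_test_norm_sq_lt (A : Set E3) (ψ : Test) {ε : ℝ} (hε : 0 < ε) :
    ∃ φ : Test, (∀ y ∈ A, φ.1 y = ψ.1 y) ∧ ‖toEnergy ξ hξ (H1.ofTest φ)‖ ^ 2
      < ‖(energyZero hξ A)ᗮ.starProjection (toEnergy ξ hξ (H1.ofTest ψ))‖ ^ 2 + ε := by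
  set u := toEnergy ξ hξ (H1.ofTest ψ) with hu
  set q := (energyZero hξ A)ᗮ.starProjection u with hq
  obtain ⟨v, hv⟩ := (toEnergy ξ hξ).surjective (u - q)
  have hmem : u - q ∈ energyZero hξ A := by
    have h := Submodule.sub_starProjection_mem_orthogonal (K := (energyZero hξ A)ᗮ) u
    rwa [Submodule.orthogonal_orthogonal] at h
  rw [← hv, toEnergy_mem] at hmem
  have hopen : IsOpen {w : H1 | ‖u - toEnergy ξ hξ w‖ ^ 2 < ‖q‖ ^ 2 + ε} :=
    isOpen_lt ((continuous_const.sub (toEnergy ξ hξ).continuous).norm.pow 2) continuous_const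
  have hvm : v ∈ {w : H1 | ‖u - toEnergy ξ hξ w‖ ^ 2 < ‖q‖ ^ 2 + ε} := by
    simp only [Set.mem_ofPred_eq]
    rw [hv, sub_sub_cancel]
    linarith
  obtain ⟨w, hw, χ, h1, h2, h3, h4⟩ := mem_closure_iff.1 hmem _ hopen hvm
  let χ' : Test := ⟨χ, h1, h2⟩
  have hw' : w = H1.ofTest χ' := H1.ext_val (h4.trans (H1.ofTest_val χ').symm)
  refine ⟨ψ - χ', fun y hy => ?_, ?_⟩
  · have : (ψ - χ').1 y = ψ.1 y - χ y := rfl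
    rw [this, h3 y hy, sub_zero]
  · rw [H1.ofTest.map_sub, toEnergy_sub, ← hw']
    exact hw

theorem form_ofTest_eq_zero {φ ψ : Test} (h : ∀ y, (φ.1 y = 0 ∧ fderiv ℝ φ.1 y = 0) ∨
    (ψ.1 y = 0 ∧ fderiv ℝ ψ.1 y = 0)) : H1.form ξ (H1.ofTest φ) (H1.ofTest ψ) = 0 := by
  rw [H1.form_ofTest, integral_congr_ae (g := fun _ => (0 : ℝ)), integral_zero]
  refine ae_of_all _ fun y => ?_
  rcases h y with ⟨h1, h2⟩ | ⟨h1, h2⟩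
  · simp [gradient, h1, h2]
  · simp [gradient, h1, h2]

theorem sum_toEnergy_ofTest {I : Type*} (F : Finset I) (g : I → Test) :
    ∑ i ∈ F, toEnergy ξ hξ (H1.ofTest (g i)) = toEnergy ξ hξ (H1.ofTest (∑ i ∈ F, g i)) :=
  (map_sum ((toEnergy ξ hξ).toLinearEquiv.toLinearMap.comp H1.ofTest) g F).symm

set_option maxHeartbeats 800000 in
/-- The lower bound for the sum of the projections. -/
theorem norm_starProjection_sq_le_sum {I : Type} {x : I → E3} {r : I → ℝ} {κ : ℝ} (hκ : 1 < κ)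
    {θ : ℝ → ℝ} {A : ℝ} (hθ : IsCutoffProfile θ A (κ ^ 2))
    (hK : IsClosed (particles x r)) (hr : ∀ i, 0 < r i) {ρ : ℝ} (hρ : ∀ i, r i ≤ ρ)
    (hsep : ∀ i j, i ≠ j → 2 * (κ * r i) < dist (x i) (x j)) (ψ : Test) :
    ∃ F : Finset I, ‖(energyZero hξ (particles x r))ᗮ.starProjection
        (toEnergy ξ hξ (H1.ofTest ψ))‖ ^ 2
      ≤ (2 + 8 * A ^ 2) * ∑ i ∈ F, ‖(energyZero hξ (Metric.closedBall (x i) (r i)))ᗮ.starProjection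
          (toEnergy ξ hξ (H1.ofTest ψ))‖ ^ 2 := by
  have hsep' : ∀ i j, i ≠ j → 2 * r i < dist (x i) (x j) := fun i j hij => by
    have := hsep i j hij
    nlinarith [hr i]
  have hκρ : ∀ i, κ * r i ≤ κ * ρ := fun i => mul_le_mul_of_nonneg_left (hρ i) (by linarith)
  obtain ⟨R, hR⟩ := ψ.hasCompactSupport.isCompact.isBounded.subset_closedBall (0 : E3)
  -- The radii are bounded, so every particle whose enlarged ball meets the support of `ψ` has its
  -- centre in one fixed ball; by local finiteness there are finitely many.
  have hfin := finite_setOf_mem_closedBall hK hr hsep' 0 (R + κ * ρ)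
  set F := hfin.toFinset with hF
  have hnotF : ∀ i ∉ F, ∀ y ∈ Metric.ball (x i) (κ * r i), ψ.1 y = 0 := by
    intro i hi y hy
    by_contra hne
    apply hi
    have h1 := hR (subset_tsupport _ (Function.mem_support.2 hne))
    rw [hF, Set.Finite.mem_toFinset, Set.mem_ofPred_eq, Metric.mem_closedBall]
    rw [Metric.mem_closedBall] at h1
    rw [Metric.mem_ball, dist_comm] at hy
    linarith [dist_triangle (x i) y 0, hκρ i]
  have hdisj : ∀ i j, i ≠ j → ∀ y, dist y (x i) < κ * r i → κ * r j ≤ dist y (x j) := by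
    intro i j hij y hy
    have h1 := hsep i j hij
    have h2 := hsep j i hij.symm
    rw [dist_comm] at h2
    have h3 := dist_triangle_left (x i) (x j) y
    linarith
  -- The profile is a function of the squared distance, hence the threshold `κ ^ 2`.
  have hcut : ∀ i y, κ * r i ≤ dist y (x i) → radialCutoff θ (x i) (r i) y = 0 := by
    intro i y hy
    refine hθ.radialCutoff_eq_zero (x i) (hr i) ?_
    rw [← mul_pow, ← dist_eq_norm]
    have : 0 ≤ κ * r i := mul_nonneg (by linarith) (hr i).le
    gcongr
  refine ⟨F, ?_⟩
  refine le_of_forall_pos_le_add fun ε hε => ?_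
  -- The errors of the approximate minimisers, multiplied by the cutoff constant and summed over
  -- `F`, stay below `ε`; the `+ 1` covers an empty `F`.
  set δ := ε / ((2 + 8 * A ^ 2) * (F.card + 1)) with hδ
  have hδ0 : 0 < δ := by positivity
  choose φ hφ1 hφ2 using fun i =>
    exists_test_norm_sq_lt hξ (Metric.closedBall (x i) (r i)) ψ hδ0
  let g : I → Test := fun i =>
    Test.mulLeft (radialCutoff θ (x i) (r i)) (hθ.contDiff_radialCutoff (x i)) (φ i)
  have hg : ∀ i y, (g i).1 y = radialCutoff θ (x i) (r i) y * (φ i).1 y := fun i y => rfl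
  have hgE : ∀ i, ‖toEnergy ξ hξ (H1.ofTest (g i))‖ ^ 2
      ≤ (2 + 8 * A ^ 2) * ‖toEnergy ξ hξ (H1.ofTest (φ i))‖ ^ 2 := by
    intro i
    rw [norm_toEnergy_ofTest_sq, norm_toEnergy_ofTest_sq]
    exact Test.integral_energyDensity_mulLeft_le hθ (x i) (hr i) ξ (φ i)
  have hsumval : ∀ y, (∑ i ∈ F, g i : Test).1 y = ∑ i ∈ F, (g i).1 y := by
    intro y
    have : (∑ i ∈ F, g i : Test).1 = ∑ i ∈ F, (g i).1 :=
      map_sum (Submodule.subtype testSpace) g F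
    rw [this, Finset.sum_apply]
  -- In the ball `j` only the `j`-th summand survives; if `j ∉ F`, both sides vanish there. The sum
  -- is thus a competitor for the projection belonging to all particles.
  have hagree : ∀ y ∈ particles x r, (∑ i ∈ F, g i : Test).1 y = ψ.1 y := by
    intro y hy
    obtain ⟨j, hj⟩ := Set.mem_iUnion.1 hy
    have hj' : dist y (x j) ≤ r j := hj
    have hj2 : dist y (x j) < κ * r j := by nlinarith [hr j]
    have hz : ∀ i, i ≠ j → (g i).1 y = 0 := fun i hij => by
      rw [hg, hcut i y (hdisj j i hij.symm y hj2), zero_mul]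
    rw [hsumval]
    by_cases hjF : j ∈ F
    · rw [Finset.sum_eq_single j (fun i _ hij => hz i hij) (fun h => absurd hjF h), hg,
        hθ.radialCutoff_eq_one (x j) (hr j) (by rw [← dist_eq_norm]; exact hj'), one_mul,
        hφ1 j y hj]
    · rw [hnotF j hjF y hj2]
      exact Finset.sum_eq_zero fun i hi => hz i fun h => hjF (h ▸ hi)
  have horth : ∀ i ∈ F, ∀ j ∈ F, i ≠ j →
      inner ℝ (toEnergy ξ hξ (H1.ofTest (g i))) (toEnergy ξ hξ (H1.ofTest (g j))) = 0 := by
    intro i _ j _ hij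
    rw [inner_toEnergy]
    refine form_ofTest_eq_zero fun y => ?_
    have hzero : ∀ i, κ * r i ≤ dist y (x i) → (g i).1 y = 0 ∧ fderiv ℝ (g i).1 y = 0 := by
      intro i hi
      have h0 := hcut i y hi
      refine ⟨by rw [hg, h0, zero_mul], ?_⟩
      rw [Test.fderiv_mulLeft, h0, hθ.fderiv_radialCutoff_eq_zero (x i) h0, zero_smul, smul_zero,
        add_zero]
    rcases lt_or_ge (dist y (x i)) (κ * r i) with h | h
    · exact Or.inr (hzero j (hdisj i j hij y h))
    · exact Or.inl (hzero i h)
  rw [← starProjection_orthogonal_congr hξ hagree]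
  have h1 : ‖(energyZero hξ (particles x r))ᗮ.starProjection
      (toEnergy ξ hξ (H1.ofTest (∑ i ∈ F, g i)))‖ ^ 2
      ≤ ‖∑ i ∈ F, toEnergy ξ hξ (H1.ofTest (g i))‖ ^ 2 := by
    have e : ∑ i ∈ F, toEnergy ξ hξ (H1.ofTest (g i))
        = toEnergy ξ hξ (H1.ofTest (∑ i ∈ F, g i)) := sum_toEnergy_ofTest hξ F g
    rw [e]
    exact pow_le_pow_left₀ (norm_nonneg _) (Submodule.norm_starProjection_apply_le _ _) 2
  refine h1.trans ?_
  rw [norm_sum_sq_of_pairwise_orthogonal F _ horth]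
  calc ∑ i ∈ F, ‖toEnergy ξ hξ (H1.ofTest (g i))‖ ^ 2
      ≤ ∑ i ∈ F, (2 + 8 * A ^ 2) *
        (‖(energyZero hξ (Metric.closedBall (x i) (r i)))ᗮ.starProjection
          (toEnergy ξ hξ (H1.ofTest ψ))‖ ^ 2 + δ) :=
        Finset.sum_le_sum fun i _ => (hgE i).trans
          (mul_le_mul_of_nonneg_left (hφ2 i).le (by positivity))
    _ = (2 + 8 * A ^ 2) * ∑ i ∈ F,
        ‖(energyZero hξ (Metric.closedBall (x i) (r i)))ᗮ.starProjection
          (toEnergy ξ hξ (H1.ofTest ψ))‖ ^ 2 + (2 + 8 * A ^ 2) * (F.card * δ) := by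
        rw [← Finset.mul_sum, Finset.sum_add_distrib, Finset.sum_const, nsmul_eq_mul, mul_add]
    _ ≤ _ := by
        have e : (2 + 8 * A ^ 2) * (F.card * δ) = ε * (F.card / (F.card + 1)) := by
          rw [hδ]
          field_simp
        have : (F.card : ℝ) / (F.card + 1) ≤ 1 := by
          rw [div_le_one (by positivity)]
          linarith
        rw [e]
        nlinarith

end Bounds

/-! ### Convergence of the method of reflections -/

section Convergence

variable {ξ : ℝ} {I : Type} {x : I → E3} {r : I → ℝ}

theorem existsUnique_isDirichletSolution (hξ : 0 < ξ) (A : Set E3) (f : Hneg1) :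
    ∃! u : H1, IsDirichletSolution ξ A f u := by
  refine ⟨(toEnergy ξ hξ).symm ((energyZero hξ A).starProjection (energyRiesz hξ f)), ?_, ?_⟩
  · exact (isDirichletSolution_iff hξ).2 ((toEnergy ξ hξ).apply_symm_apply _)
  · intro u hu
    exact (toEnergy ξ hξ).injective
      (((isDirichletSolution_iff hξ).1 hu).trans ((toEnergy ξ hξ).apply_symm_apply _).symm)

theorem IsMethodOfReflections.unique (hξ : 0 < ξ) {f : Hneg1} {Φ Φ' : ℕ → H1} {φ φ' : ℕ → I → H1}
    (h : IsMethodOfReflections ξ x r f Φ φ) (h' : IsMethodOfReflections ξ x r f Φ' φ') :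
    Φ = Φ' ∧ φ = φ' := by
  obtain ⟨a0, a1, a2, a3⟩ := (isMethodOfReflections_iff hξ).1 h
  obtain ⟨b0, b1, b2, b3⟩ := (isMethodOfReflections_iff hξ).1 h'
  have hinj := (toEnergy ξ hξ).injective
  have hzero : Φ 0 = Φ' 0 := hinj (a0.trans b0.symm)
  have hφ : ∀ k, φ k = φ' k := by
    intro k
    induction k with
    | zero =>
      funext i
      exact hinj (by rw [a1, b1, hzero])
    | succ k ih =>
      funext i
      exact hinj (by rw [a2, b2, ih])
  refine ⟨funext fun k => ?_, funext hφ⟩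
  cases k with
  | zero => exact hzero
  | succ k =>
    have h1 := a3 k
    rw [hφ k] at h1
    exact hinj (h1.unique (b3 k))

theorem existsUnique_isMethodOfReflections (hξ : 0 < ξ)
    (hU : ∀ (F : Finset I) (u : EnergySpace ξ hξ),
      ∑ i ∈ F, ‖(energyZero hξ (Metric.closedBall (x i) (r i)))ᗮ.starProjection u‖ ^ 2
        ≤ 3 / 2 * ‖u‖ ^ 2)
    (f : Hneg1) :
    ∃! Φ : (ℕ → H1) × (ℕ → I → H1), IsMethodOfReflections ξ x r f Φ.1 Φ.2 := by
  obtain ⟨Φ, φ, h0, h1, h2, h3⟩ := exists_reflections (by norm_num) hU (energyRiesz hξ f)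
  refine ⟨(fun k => (toEnergy ξ hξ).symm (Φ k), fun k i => (toEnergy ξ hξ).symm (φ k i)), ?_, ?_⟩
  · refine (isMethodOfReflections_iff hξ).2 ?_
    simp only [ContinuousLinearEquiv.apply_symm_apply]
    exact ⟨h0, h1, h2, h3⟩
  · rintro ⟨Ψ, ψ⟩ h
    refine Prod.ext_iff.2 (h.unique hξ ((isMethodOfReflections_iff hξ).2 ?_))
    simp only [ContinuousLinearEquiv.apply_symm_apply]
    exact ⟨h0, h1, h2, h3⟩

/-- One factor `1 + ξ` compares the `H¹` norm with the energy norm of the error, the other bounds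
the Riesz representative of `f`. The contraction takes place on the whole space, and restriction to
the complement of the particles only lowers the norm. -/
theorem normOn_sum_sub_le (hξ : 0 < ξ)
    (hU : ∀ (F : Finset I) (u : EnergySpace ξ hξ),
      ∑ i ∈ F, ‖(energyZero hξ (Metric.closedBall (x i) (r i)))ᗮ.starProjection u‖ ^ 2
        ≤ 3 / 2 * ‖u‖ ^ 2)
    {c : ℝ} (hc : 0 ≤ 1 - (2 - 3 / 2) * (c / 2))
    (hL : ∀ ψ : Test, ∃ F : Finset I, c * ‖(energyZero hξ (particles x r))ᗮ.starProjection
        (toEnergy ξ hξ (H1.ofTest ψ))‖ ^ 2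
      ≤ ∑ i ∈ F, ‖(energyZero hξ (Metric.closedBall (x i) (r i)))ᗮ.starProjection
          (toEnergy ξ hξ (H1.ofTest ψ))‖ ^ 2)
    {f : Hneg1} {u : H1} {Φ : ℕ → H1} {φ : ℕ → I → H1}
    (hu : IsDirichletSolution ξ (particles x r) f u) (h : IsMethodOfReflections ξ x r f Φ φ)
    (N : ℕ) :
    H1.normOn (particles x r)ᶜ (∑ k ∈ Finset.range (N + 1), Φ k - u)
      ≤ (1 + ξ) ^ 2 * Real.sqrt (1 - (2 - 3 / 2) * (c / 2)) ^ N * ‖f‖ := by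
  obtain ⟨h0, h1, h2, h3⟩ := (isMethodOfReflections_iff hξ).1 h
  have hu' := (isDirichletSolution_iff hξ).1 hu
  have hlow : ∀ z ∈ (energyZero hξ (particles x r))ᗮ, c / 2 * ‖z‖ ^ 2
      ≤ ∑' i, ‖(energyZero hξ (Metric.closedBall (x i) (r i)))ᗮ.starProjection z‖ ^ 2 := by
    intro z hz
    refine mul_norm_sq_le_tsum_of_dense _ hU (dense_toEnergy_ofTest hξ) ?_ hz
    rintro _ ⟨ψ, rfl⟩
    exact hL ψ
  have hsub : toEnergy ξ hξ (Φ 0) - toEnergy ξ hξ u ∈ (energyZero hξ (particles x r))ᗮ := by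
    rw [h0, hu']
    exact Submodule.sub_starProjection_mem_orthogonal _
  have hconv := norm_sum_reflections_sub_le (energyZero hξ (particles x r))
    (fun i => (energyZero_anti hξ (Set.subset_iUnion _ i)).trans
      (Submodule.le_orthogonal_orthogonal _)) (by norm_num) (by norm_num) hc hU hlow
    (Φ := fun k => toEnergy ξ hξ (Φ k)) h1 h2 h3
    (hu' ▸ Submodule.starProjection_apply_mem _ _) hsub N
  have hstart : ‖toEnergy ξ hξ (Φ 0) - toEnergy ξ hξ u‖ ≤ (1 + ξ) * ‖f‖ := by
    rw [h0, hu', ← Submodule.starProjection_orthogonal_val]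
    exact (Submodule.norm_starProjection_apply_le _ _).trans (norm_energyRiesz_le hξ f)
  have hsum : ∑ k ∈ Finset.range (N + 1), toEnergy ξ hξ (Φ k) - toEnergy ξ hξ u
      = toEnergy ξ hξ (∑ k ∈ Finset.range (N + 1), Φ k - u) := by
    rw [toEnergy_sub]
    exact congrArg (· - toEnergy ξ hξ u)
      (map_sum (toEnergy ξ hξ).toLinearEquiv.toLinearMap Φ _).symm
  rw [hsum] at hconv
  calc H1.normOn (particles x r)ᶜ (∑ k ∈ Finset.range (N + 1), Φ k - u)
      ≤ ‖∑ k ∈ Finset.range (N + 1), Φ k - u‖ := H1.normOn_le_norm _ _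
    _ ≤ (1 + ξ) * ‖toEnergy ξ hξ (∑ k ∈ Finset.range (N + 1), Φ k - u)‖ :=
        norm_le_mul_norm_toEnergy hξ _
    _ ≤ (1 + ξ) * (Real.sqrt (1 - (2 - 3 / 2) * (c / 2)) ^ N * ((1 + ξ) * ‖f‖)) := by
        refine mul_le_mul_of_nonneg_left (hconv.trans ?_) (by positivity)
        exact mul_le_mul_of_nonneg_left hstart (by positivity)
    _ = _ := by ring

end Convergence

end

theorem theorem1 :
    ∃ (C₀ : ℝ → ℝ → ℝ) (ε C : ℝ → ℝ),
      (∀ α κ : ℝ, 0 < α → 1 < κ → 0 < C₀ α κ) ∧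
      (∀ κ : ℝ, 1 < κ → 0 < ε κ ∧ ε κ < 1) ∧
      ∀ (ξ α κ : ℝ), 0 < ξ → 0 < α → 1 < κ →
        ∀ (I : Type) [Countable I] (x : I → E3) (r : I → ℝ),
          (∀ i, 0 < r i) →
          IsClosed (particles x r) →
          (∀ i, ENNReal.ofReal (κ * r i) < nearestDist x i / 2) →
          (∀ i, r i ≤ α * ξ) →
          capacityBound x r < ENNReal.ofReal (C₀ α κ * (ξ ^ 2)⁻¹) →
          ∀ f : Hneg1,
            (∃! u : H1, IsDirichletSolution ξ (particles x r) f u) ∧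
            (∃! Φ : (ℕ → H1) × (ℕ → I → H1), IsMethodOfReflections ξ x r f Φ.1 Φ.2) ∧
            ∀ (u : H1) (Φ : ℕ → H1) (φ : ℕ → I → H1),
              IsDirichletSolution ξ (particles x r) f u →
              IsMethodOfReflections ξ x r f Φ φ →
              Tendsto (fun N : ℕ =>
                H1.normOn (particles x r)ᶜ (∑ k ∈ Finset.range (N + 1), Φ k - u)) atTop (𝓝 0) ∧
              ∀ N : ℕ,
                H1.normOn (particles x r)ᶜ (∑ k ∈ Finset.range (N + 1), Φ k - u)
                  ≤ C ξ * ε κ ^ N * ‖f‖ := by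
  obtain ⟨τ, hτ, hext⟩ := Test.exists_extension_energy_le
  -- The cutoff constant is fixed as a function of `κ` before any configuration is given, so that
  -- `ε` depends on `κ` alone; its value for `κ ≤ 1` is a dummy.
  have hprof : ∀ κ : ℝ, ∃ A : ℝ, 1 < κ → ∃ θ, IsCutoffProfile θ A (κ ^ 2) := by
    intro κ
    by_cases hκ : 1 < κ
    · obtain ⟨θ, A, h⟩ := exists_isCutoffProfile (T := κ ^ 2) (by nlinarith)
      exact ⟨A, fun _ => ⟨θ, h⟩⟩
    · exact ⟨0, fun h => absurd h hκ⟩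
  choose A hA using hprof
  have hc : ∀ κ, 0 < (2 + 8 * A κ ^ 2)⁻¹ ∧ (2 + 8 * A κ ^ 2)⁻¹ ≤ 1 := fun κ =>
    ⟨by positivity, inv_le_one_of_one_le₀ (by nlinarith [sq_nonneg (A κ)])⟩
  -- `τ` is absolute. In `ε` the factor `2 - 3 / 2` comes from the Bessel constant, the inverse is
  -- the lower bound on test functions, and its half is what remains after the passage by density.
  refine ⟨fun α _ => min (τ / 8) (τ ^ 3 / (8 * α ^ 2)),
    fun κ => Real.sqrt (1 - (2 - 3 / 2) * ((2 + 8 * A κ ^ 2)⁻¹ / 2)), fun ξ => (1 + ξ) ^ 2,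
    fun α κ hα hκ => lt_min (by positivity) (by positivity), fun κ _ => ⟨?_, ?_⟩, ?_⟩
  · exact Real.sqrt_pos.2 (by linarith [(hc κ).2])
  · rw [Real.sqrt_lt' one_pos]
    linarith [(hc κ).1]
  intro ξ α κ hξ hα hκ I _ x r hr hK hd hα' hμ f
  obtain ⟨R, hR1, hR2, hR3⟩ := exists_disjoint_radii hξ hα hτ hr hd hα' hμ
  obtain ⟨θ, hθ⟩ := hA κ hκ
  have hU := sum_norm_starProjection_sq_le hξ hR3
    (fun i ψ => hext ξ (r i) (R i) (x i) ψ hξ (hr i) (hR1 i) (hR2 i))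
  have hε0 : 0 ≤ 1 - (2 - 3 / 2) * ((2 + 8 * A κ ^ 2)⁻¹ / 2) := by linarith [(hc κ).2]
  have hL : ∀ ψ : Test, ∃ F : Finset I, (2 + 8 * A κ ^ 2)⁻¹ *
        ‖(energyZero hξ (particles x r))ᗮ.starProjection (toEnergy ξ hξ (H1.ofTest ψ))‖ ^ 2
      ≤ ∑ i ∈ F, ‖(energyZero hξ (Metric.closedBall (x i) (r i)))ᗮ.starProjection
          (toEnergy ξ hξ (H1.ofTest ψ))‖ ^ 2 := by
    intro ψ
    obtain ⟨F, hF⟩ := norm_starProjection_sq_le_sum hξ hκ hθ hK hr hα'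
      (fun i j hij => two_mul_lt_dist_of_lt_nearestDist (hd i) hij) ψ
    exact ⟨F, (inv_mul_le_iff₀ (by positivity)).2 hF⟩
  refine ⟨existsUnique_isDirichletSolution hξ _ f, existsUnique_isMethodOfReflections hξ hU f,
    fun u Φ φ hu hΦ => ?_⟩
  have hbound := normOn_sum_sub_le hξ hU hε0 hL hu hΦ
  refine ⟨?_, hbound⟩
  refine squeeze_zero (fun N => Real.sqrt_nonneg _) hbound ?_
  have hlt : Real.sqrt (1 - (2 - 3 / 2) * ((2 + 8 * A κ ^ 2)⁻¹ / 2)) < 1 := by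
    rw [Real.sqrt_lt' one_pos]
    linarith [(hc κ).1]
  have := ((tendsto_pow_atTop_nhds_zero_of_lt_one (Real.sqrt_nonneg _) hlt).const_mul
    ((1 + ξ) ^ 2)).mul_const ‖f‖
  simpa using this
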